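/- Let $B$ be a unital algebra over $\mathbb{C}$ and let $(\mathcal A,E,\varepsilon)$ be a $B$-$B$-non-commutative probability space: $\mathcal A$ is a unital $\mathbb C$-algebra, $\varepsilon:B\otimes B^{\mathrm{op}}\to\mathcal A$ is a unital homomorphism that is injective on $B\otimes 1$ and on $1\otimes B^{\mathrm{op}}$, and, with $L_b=\varepsilon(b\otimes 1)$, $R_b=\varepsilon(1\otimes b)$, the map $E:\mathcal A\to B$ is linear with $E(L_{b_1}R_{b_2}T)=b_1E(T)b_2$ and $E(TL_b)=E(TR_b)$. Let $\mathcal A_\ell$ (resp. $\mathcal A_r$) be the set of elements that commute with all $R_b$ (resp. all $L_b$). For $n\ge 1$ and $\chi:\{1,\dots,n\}\to\{\ell,r\}$ let $\prec_\chi$ be the total order on $\{1,\dots,n\}$ that lists the elements of $\chi^{-1}(\ell)$ increasingly and then those of $\chi^{-1}(r)$ decreasingly, and let $BNC(\chi)$ be the lattice of the partitions of $\{1,\dots,n\}$ that are non-crossing for $\prec_\chi$, ordered by refinement, with least and greatest elements $0_\chi$, $1_\chi$. For $S\subseteq\{1,\dots,n\}$, $|_S$ denotes restriction to $S$ (renumbered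 increasingly). *Multiplicative functions.* $IA(BNC)$ consists of the functions $f:\bigcup_{n,\chi}BNC(\chi)\times BNC(\chi)\to\mathbb C$ with $f(\pi,\sigma)=0$ unless $\pi\le\sigma$. To each interval is associated a product of full lattices: $[\pi,\sigma]=\prod_{V\in\sigma}[\pi|_V,1_{\chi|_V}]$, and $[\pi,1_\chi]$ corresponds to a product $\prod_U BNC(\beta_U)$ over the blocks $U$ of the Kreweras complement of $\pi$ with respect to $\prec_\chi$, where $\beta_U$ is the restriction of $\chi$ to a set of $|U|$ nodes, one retained node from the $\pi$-block of each $a\in U$; the retained nodes, and the number of one-point factors, are fixed by an arbitrary rule that depends only on $\pi$ and $\chi$. A function $f\in IA(BNC)$ is multiplicative if, for some such rule, $f(\pi,\sigma)=\prod_j f(0_{\beta_j},1_{\beta_j})$ whenever $\pi\le\sigma$ and $[\pi,\sigma]$ corresponds to $\prod_jBNC(\beta_j)$. $\mu_{BNC}$ is the convolution inverse of the zeta function. *Bi-multiplicative functions.* A function $\Phi:\bigcup_{n\ge1}\bigcup_\chi BNC(\chi)\times\mathcal A_{\chi(1)}\times\cdots\times\mathcal A_{\chi(n)}\to B$ is bi-multiplicative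 if it is linear in each $T_k\in\mathcal A_{\chi(k)}$ and, for all $\chi$, $T_k\in\mathcal A_{\chi(k)}$, $b\in B$, $\pi\in BNC(\chi)$, writing $C_b^{\ell}=L_b$, $C_b^{r}=R_b$: (i) Let $q=\max\{k:\chi(k)\ne\chi(n)\}$. Then $\Phi_{1_\chi}(T_1,\dots,T_{n-1},T_nC_b^{\chi(n)})$ equals $\Phi_{1_\chi}(T_1,\dots,T_qC_b^{\chi(q)},\dots,T_n)$ if $q$ exists; otherwise it equals $\Phi_{1_\chi}(T_1,\dots,T_n)\,b$ if $\chi(n)=\ell$ and $b\,\Phi_{1_\chi}(T_1,\dots,T_n)$ if $\chi(n)=r$. (ii) Let $1\le p\le n$ and $q=\max\{k<p:\chi(k)=\chi(p)\}$. Then $\Phi_{1_\chi}(T_1,\dots,C_b^{\chi(p)}T_p,\dots,T_n)$ equals $\Phi_{1_\chi}(T_1,\dots,T_qC_b^{\chi(q)},\dots,T_n)$ if $q$ exists; otherwise it equals $b\,\Phi_{1_\chi}(T_1,\dots,T_n)$ if $\chi(p)=\ell$ and $\Phi_{1_\chi}(T_1,\dots,T_n)\,b$ if $\chi(p)=r$.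 (iii) If $V_1,\dots,V_m$ are non-empty $\prec_\chi$-intervals that partition $\{1,\dots,n\}$, ordered by $\prec_\chi$, each a union of blocks of $\pi$, then $\Phi_\pi(T_1,\dots,T_n)=\Phi_{\pi|_{V_1}}((T_1,\dots,T_n)|_{V_1})\cdots\Phi_{\pi|_{V_m}}((T_1,\dots,T_n)|_{V_m})$. (iv) Let $V\neq\emptyset$ and $W$ partition $\{1,\dots,n\}$, each a union of blocks of $\pi$, with $V$ a $\prec_\chi$-interval and with the $\prec_\chi$-minimum and $\prec_\chi$-maximum of $\{1,\dots,n\}$ in $W$. Let $\theta$ be the $\prec_\chi$-last element of $W$ before $V$, $\gamma$ the $\prec_\chi$-first element of $W$ after $V$, and $c=\Phi_{\pi|_V}((T_1,\dots,T_n)|_V)$. Then $\Phi_\pi(T_1,\dots,T_n)$ equals $\Phi_{\pi|_W}$ of the tuple $(T_1,\dots,T_n)|_W$ in which $T_\theta$ is replaced by $T_\theta L_c$ if $\chi(\theta)=\ell$ and by $R_cT_\theta$ if $\chi(\theta)=r$; and it also equals $\Phi_{\pi|_W}$ of the tuple $(T_1,\dots,T_n)|_W$ in which $T_\gamma$ is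 replaced by $L_cT_\gamma$ if $\chi(\gamma)=\ell$ and by $T_\gamma R_c$ if $\chi(\gamma)=r$. *Convolution, moments, cumulants.* $(\Phi*f)_\pi(T_1,\dots,T_n)=\sum_{\sigma\in BNC(\chi),\,\sigma\le\pi}\Phi_\sigma(T_1,\dots,T_n)\,f(\sigma,\pi)$. The moment function $\mathcal E_\pi(T_1,\dots,T_n)=E_\pi(T_1,\dots,T_n)$ is defined recursively: $E_{1_\chi}(T_1,\dots,T_n)=E(T_1\cdots T_n)$. If $\pi\ne1_\chi$, let $V$ be the block of $\pi$ with the largest minimum $m$, let $c=E_{\pi|_V}((T_1,\dots,T_n)|_V)$ and let $X=L_c$ if $\chi(m)=\ell$, $X=R_c$ if $\chi(m)=r$. If $V=\{k+1,\dots,n\}$, then $E_\pi(T_1,\dots,T_n)=E_{\pi|_{V^c}}(T_1,\dots,T_{k-1},T_kX)$. Otherwise let $W\neq V$ be the block whose spine is adjacent to $m$ in the bi-non-crossing diagram of $\pi$, that is, the block of the $\prec_\chi$-first (if $\chi(m)=\ell$) or $\prec_\chi$-last (if $\chi(m)=r$) element of $\{k>m:k\notin V\}$, and let $k$ be the smallest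 element of $W$ larger than $m$; then $E_\pi(T_1,\dots,T_n)=E_{\pi|_{V^c}}((T_1,\dots,XT_k,\dots,T_n)|_{V^c})$. The operator-valued bi-free cumulant function is $\kappa=\mathcal E*\mu_{BNC}$. **Theorem.** If $\Phi$ is bi-multiplicative and $f\in IA(BNC)$ is multiplicative, then $\Phi*f$ is bi-multiplicative. Moreover, the operator-valued bi-free cumulant function $\kappa=\mathcal E*\mu_{BNC}$ is bi-multiplicative. -/

import Mathlib

open scoped TensorProduct

namespace BiFree

/-! ### Left and right nodes, the order along the boundary, bi-non-crossing partitions -/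

/-- The two labels `ℓ` (left) and `r` (right). -/
inductive Side : Type
  | left : Side
  | right : Side

/-- The total order `≺_χ` on the nodes: the left nodes in increasing order, followed by the right
nodes in decreasing order. -/
def Prec {n : ℕ} (χ : Fin n → Side) (a b : Fin n) : Prop :=
  match χ a, χ b with
  | Side.left, Side.left => a < b
  | Side.left, Side.right => True
  | Side.right, Side.left => False
  | Side.right, Side.right => b < a

/-- `a` is the `≺_χ`-minimal element of `S`. -/
def IsFirst {n : ℕ} (χ : Fin n → Side) (S : Set (Fin n)) (a : Fin n) : Prop :=
  a ∈ S ∧ ∀ b ∈ S, b ≠ a → Prec χ a b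

/-- `a` is the `≺_χ`-maximal element of `S`. -/
def IsLast {n : ℕ} (χ : Fin n → Side) (S : Set (Fin n)) (a : Fin n) : Prop :=
  a ∈ S ∧ ∀ b ∈ S, b ≠ a → Prec χ b a

/-- `V` is an interval for `≺_χ`. -/
def IsChiInterval {n : ℕ} (χ : Fin n → Side) (V : Finset (Fin n)) : Prop :=
  ∀ a ∈ V, ∀ c ∈ V, ∀ b, Prec χ a b → Prec χ b c → b ∈ V

/-- A partition (given by its equivalence relation) is bi-non-crossing with respect to `χ`. -/
def BiNonCrossing {n : ℕ} (χ : Fin n → Side) (π : Setoid (Fin n)) : Prop :=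
  ∀ u₁ v₁ u₂ v₂ : Fin n, Prec χ u₁ v₁ → Prec χ v₁ u₂ → Prec χ u₂ v₂ →
    π u₁ u₂ → π v₁ v₂ → π u₁ v₁

/-- The set `BNC(χ)`, ordered by refinement (the order of `Setoid`). -/
abbrev BNC {n : ℕ} (χ : Fin n → Side) : Type :=
  {π : Setoid (Fin n) // BiNonCrossing χ π}

theorem Prec.irrefl {n : ℕ} {χ : Fin n → Side} {a : Fin n} (h : Prec χ a a) : False := by
  unfold Prec at h
  cases hc : χ a <;> simp [hc] at h

theorem Prec.trans {n : ℕ} {χ : Fin n → Side} {a b c : Fin n} (h : Prec χ a b)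
    (h' : Prec χ b c) : Prec χ a c := by
  unfold Prec at *
  cases ha : χ a <;> cases hb : χ b <;> cases hc : χ c <;> simp_all <;> omega

/-- `0_χ`: all blocks are singletons. -/
def BNC.zero {n : ℕ} (χ : Fin n → Side) : BNC χ :=
  ⟨⊥, by
    intro u₁ v₁ u₂ v₂ h₁ h₂ _ hu _
    have hu' : u₁ = u₂ := hu
    subst hu'
    exact ((h₁.trans h₂).irrefl).elim⟩

/-- `1_χ`: there is one block. -/
def BNC.one {n : ℕ} (χ : Fin n → Side) : BNC χ :=
  ⟨⊤, fun _ _ _ _ _ _ _ _ _ => trivial⟩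

noncomputable instance BNC.instFintype {n : ℕ} (χ : Fin n → Side) : Fintype (BNC χ) := by
  classical
  exact Fintype.ofInjective (fun (π : BNC χ) (a b : Fin n) => π.1 a b) (by
    intro π σ h
    apply Subtype.ext
    apply Setoid.ext
    intro a b
    exact iff_of_eq (congrFun (congrFun h a) b))

noncomputable instance BNC.instDecidableEq {n : ℕ} (χ : Fin n → Side) : DecidableEq (BNC χ) :=
  Classical.decEq _

open Classical in
noncomputable instance BNC.instLocallyFiniteOrder {n : ℕ} (χ : Fin n → Side) :
    LocallyFiniteOrder (BNC χ) :=
  Fintype.toLocallyFiniteOrder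

open Classical in
/-- The blocks of a partition. -/
noncomputable def blocks {n : ℕ} (π : Setoid (Fin n)) : Finset (Finset (Fin n)) :=
  Finset.univ.image (fun a => Finset.univ.filter (fun b => π a b))

/-- `S` is a union of blocks of `π`. -/
def IsUnionOfBlocks {n : ℕ} (π : Setoid (Fin n)) (S : Finset (Fin n)) : Prop :=
  ∀ a b, π a b → a ∈ S → b ∈ S

/-! ### Restrictions to a subset `S`; the elements of `S` are renumbered increasingly -/

/-- The increasing enumeration of `S`. -/
def enum {n : ℕ} (S : Finset (Fin n)) : Fin S.card ↪o Fin n :=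
  S.orderEmbOfFin rfl

/-- `χ|_S`. -/
def restrict {n : ℕ} (χ : Fin n → Side) (S : Finset (Fin n)) : Fin S.card → Side :=
  fun k => χ (enum S k)

theorem prec_enum {n : ℕ} (χ : Fin n → Side) (S : Finset (Fin n)) (a b : Fin S.card) :
    Prec χ (enum S a) (enum S b) ↔ Prec (restrict χ S) a b := by
  unfold Prec restrict
  cases χ (enum S a) <;> cases χ (enum S b) <;> simp

/-- `π|_S`. -/
def BNC.restrict {n : ℕ} {χ : Fin n → Side} (π : BNC χ) (S : Finset (Fin n)) :
    BNC (BiFree.restrict χ S) :=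
  ⟨Setoid.comap (enum S) π.1, by
    intro u₁ v₁ u₂ v₂ h₁ h₂ h₃ hu hv
    exact π.2 _ _ _ _ ((prec_enum χ S _ _).2 h₁) ((prec_enum χ S _ _).2 h₂)
      ((prec_enum χ S _ _).2 h₃) hu hv⟩

/-! ### The incidence algebra of bi-non-crossing partitions, multiplicative functions -/

/-- The incidence algebra `IA(BNC)`: functions on pairs of elements of `BNC(χ)`, for all `χ`, that
vanish at `(π, σ)` unless `π ≤ σ`. (The value for `n = 0` is never used.) -/
abbrev IA : Type :=
  ∀ ⦃n : ℕ⦄ (χ : Fin n → Side), IncidenceAlgebra ℂ (BNC χ)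

/-- The Möbius function `μ_BNC`, the convolution inverse of the zeta function. -/
noncomputable def moebius : IA :=
  fun _ χ => IncidenceAlgebra.mu ℂ (α := BNC χ)

/-- The Kreweras complement `K(π)` of `π ∈ BNC(χ)`. Think of a new node placed directly after every
node `a` in the order `≺_χ`. The new nodes of `a` and `b` are joined when the set of the old nodes
between them is a union of blocks of `π`; an old node `x` lies between them
iff exactly one of `a ≺ x`, `b ≺ x` holds. -/
def kreweras {n : ℕ} (χ : Fin n → Side) (π : Setoid (Fin n)) : Setoid (Fin n) where
  r a b := ∀ x y, π x y → ((Prec χ a x ↔ Prec χ b x) ↔ (Prec χ a y ↔ Prec χ b y))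
  iseqv :=
    { refl := fun a x y _ => by tauto
      symm := fun {a b} h x y hxy => by have := h x y hxy; tauto
      trans := fun {a b c} h h' x y hxy => by
        have h₁ := h x y hxy
        have h₂ := h' x y hxy
        tauto }

/-- A word `β : {1, …, m} → {ℓ, r}`; it stands for the full lattice `BNC(β)`. -/
abbrev Word : Type := Σ m : ℕ, (Fin m → Side)

/-- The word `χ|_S`. -/
def word {n : ℕ} (χ : Fin n → Side) (S : Finset (Fin n)) : Word :=
  ⟨S.card, restrict χ S⟩

open Classical in
/-- The interval `[π, 1_χ]` corresponds to the product of the full lattices `BNC(β)`, `β ∈ L`.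
The interval is the product, over the blocks `U` of the Kreweras complement, of lattices of
bi-non-crossing partitions of `|U|` nodes, which arise when each block of `π` that borders `U` is
collapsed to one of its nodes: the node of `a ∈ U` is the retained node `keep a` of the block of
`a`. Factors with one node are one-point lattices, so that the product determines `L` only up to
such factors. -/
def Corresponds {n : ℕ} (χ : Fin n → Side) (π : BNC χ) (L : Multiset Word) : Prop :=
  (∀ β ∈ L, 0 < β.1) ∧
  ∃ keep : Fin n → Fin n, (∀ a, π.1 a (keep a)) ∧
    L.filter (fun β => 1 < β.1) =
      ((blocks (kreweras χ π.1)).val.map (fun U => word χ (U.image keep))).filter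
        (fun β => 1 < β.1)

/-- `f` is multiplicative. The interval `[π, σ]` is the product over the blocks `V` of `σ` of the
intervals `[π|_V, 1_{χ|_V}]`, each of which the fixed assignment `R` writes as a product of full
lattices `BNC(β)`; and `f(π, σ)` is the product of the corresponding values `f(0_β, 1_β)`.
Any assignment `R` that makes the choices left open by `Corresponds` is admitted. -/
def IsMultiplicative (f : IA) : Prop :=
  ∃ R : ∀ ⦃n : ℕ⦄ (χ : Fin n → Side), BNC χ → Multiset Word,
    (∀ (n : ℕ) (χ : Fin n → Side) (π : BNC χ), 0 < n → Corresponds χ π (R χ π)) ∧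
    ∀ (n : ℕ) (χ : Fin n → Side) (π σ : BNC χ), 0 < n → π ≤ σ →
      f χ π σ = ∏ V ∈ blocks σ.1,
        ((R (restrict χ V) (π.restrict V)).map
          (fun β => f β.2 (BNC.zero β.2) (BNC.one β.2))).prod

/-! ### `B`-`B`-non-commutative probability spaces -/

/-- A `B`-`B`-non-commutative probability space `(A, E, ε)`. -/
structure BBSpace (B A : Type*) [Ring B] [Algebra ℂ B] [Ring A] [Algebra ℂ A] where
  ε : B ⊗[ℂ] Bᵐᵒᵖ →ₐ[ℂ] A
  E : A →ₗ[ℂ] B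
  injective_left : Function.Injective fun b : B => ε (b ⊗ₜ[ℂ] 1)
  injective_right : Function.Injective fun b : Bᵐᵒᵖ => ε (1 ⊗ₜ[ℂ] b)
  E_mul : ∀ (b₁ b₂ : B) (T : A),
    E (ε (b₁ ⊗ₜ[ℂ] MulOpposite.op b₂) * T) = b₁ * E T * b₂
  E_left_eq_right : ∀ (T : A) (b : B),
    E (T * ε (b ⊗ₜ[ℂ] 1)) = E (T * ε (1 ⊗ₜ[ℂ] MulOpposite.op b))

section Space

variable {B A : Type*} [Ring B] [Algebra ℂ B] [Ring A] [Algebra ℂ A]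

/-- `L_b = ε(b ⊗ 1)`. -/
def BBSpace.L (𝒜 : BBSpace B A) (b : B) : A := 𝒜.ε (b ⊗ₜ[ℂ] 1)

/-- `R_b = ε(1 ⊗ b)`. -/
def BBSpace.R (𝒜 : BBSpace B A) (b : B) : A := 𝒜.ε (1 ⊗ₜ[ℂ] MulOpposite.op b)

/-- The left algebra `A_ℓ` (all elements commuting with every `R_b`) and the right algebra `A_r`
(all elements commuting with every `L_b`). -/
def BBSpace.face (𝒜 : BBSpace B A) : Side → Subalgebra ℂ A
  | Side.left => Subalgebra.centralizer ℂ (Set.range 𝒜.R)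
  | Side.right => Subalgebra.centralizer ℂ (Set.range 𝒜.L)

theorem BBSpace.L_comm_R (𝒜 : BBSpace B A) (b c : B) : 𝒜.L b * 𝒜.R c = 𝒜.R c * 𝒜.L b := by
  simp [BBSpace.L, BBSpace.R, ← map_mul]

/-- `L_b` or `R_b`, as an element of `A_ℓ` or `A_r`: the copy of `b` on the given side. -/
def BBSpace.op (𝒜 : BBSpace B A) : (s : Side) → B → 𝒜.face s
  | Side.left, b => ⟨𝒜.L b, by
      rintro _ ⟨c, rfl⟩
      exact (𝒜.L_comm_R b c).symm⟩
  | Side.right, b => ⟨𝒜.R b, by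
      rintro _ ⟨c, rfl⟩
      exact 𝒜.L_comm_R c b⟩

/-! ### Bi-multiplicative functions -/

/-- The functions `Φ`, `(χ, π, T₁, …, Tₙ) ↦ Φ_π(T₁, …, Tₙ) ∈ B`, with `π ∈ BNC(χ)` and
`T_k ∈ A_{χ(k)}`. (The value for `n = 0` is never used.) -/
abbrev BiFun (𝒜 : BBSpace B A) : Type _ :=
  ∀ ⦃n : ℕ⦄ (χ : Fin n → Side), BNC χ → (∀ k, 𝒜.face (χ k)) → B

/-- `(T₁, …, Tₙ)|_S`. -/
def restrictTuple (𝒜 : BBSpace B A) {n : ℕ} {χ : Fin n → Side} (T : ∀ k, 𝒜.face (χ k))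
    (S : Finset (Fin n)) : ∀ k, 𝒜.face (restrict χ S k) :=
  fun k => T (enum S k)

/-- `Φ_{π|_S}((T₁, …, Tₙ)|_S)`. -/
def BiFun.on {𝒜 : BBSpace B A} (Φ : BiFun 𝒜) {n : ℕ} {χ : Fin n → Side} (π : BNC χ)
    (T : ∀ k, 𝒜.face (χ k)) (S : Finset (Fin n)) : B :=
  Φ (restrict χ S) (π.restrict S) (restrictTuple 𝒜 T S)

/-- Multiplication by `b` on the side where it comes after `T` in the order `≺`:
`T L_b` in `A_ℓ`, and `R_b T` in `A_r`. -/
def BBSpace.after (𝒜 : BBSpace B A) : (s : Side) → 𝒜.face s → B → 𝒜.face s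
  | Side.left, T, b => T * 𝒜.op Side.left b
  | Side.right, T, b => 𝒜.op Side.right b * T

/-- Multiplication by `b` on the side where it comes before `T` in the order `≺`:
`L_b T` in `A_ℓ`, and `T R_b` in `A_r`. -/
def BBSpace.before (𝒜 : BBSpace B A) : (s : Side) → 𝒜.face s → B → 𝒜.face s
  | Side.left, T, b => 𝒜.op Side.left b * T
  | Side.right, T, b => T * 𝒜.op Side.right b

/-- Bi-multiplicative functions. In (i) and (ii), `𝒜.op s b` is `L_b` for `s = ℓ` and `R_b` for
`s = r`. The two cases of (i) (of (ii)) are: the maximum `q` exists; the set is empty. -/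
structure IsBiMultiplicative (𝒜 : BBSpace B A) (Φ : BiFun 𝒜) : Prop where
  linear : ∀ (n : ℕ) (χ : Fin n → Side) (π : BNC χ) (T : ∀ k, 𝒜.face (χ k)) (k : Fin n),
    IsLinearMap ℂ fun x : 𝒜.face (χ k) => Φ χ π (Function.update T k x)
  prop_i : ∀ (n : ℕ) (χ : Fin (n + 1) → Side) (T : ∀ k, 𝒜.face (χ k)) (b : B) (q : Fin (n + 1)),
    IsGreatest {k | χ k ≠ χ (Fin.last n)} q →
    Φ χ (BNC.one χ)
        (Function.update T (Fin.last n) (T (Fin.last n) * 𝒜.op (χ (Fin.last n)) b)) =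
      Φ χ (BNC.one χ) (Function.update T q (T q * 𝒜.op (χ q) b))
  prop_i_empty : ∀ (n : ℕ) (χ : Fin (n + 1) → Side) (T : ∀ k, 𝒜.face (χ k)) (b : B),
    {k | χ k ≠ χ (Fin.last n)} = ∅ →
    Φ χ (BNC.one χ)
        (Function.update T (Fin.last n) (T (Fin.last n) * 𝒜.op (χ (Fin.last n)) b)) =
      match χ (Fin.last n) with
      | Side.left => Φ χ (BNC.one χ) T * b
      | Side.right => b * Φ χ (BNC.one χ) T
  prop_ii : ∀ (n : ℕ) (χ : Fin n → Side) (T : ∀ k, 𝒜.face (χ k)) (b : B) (p q : Fin n),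
    IsGreatest {k | χ k = χ p ∧ k < p} q →
    Φ χ (BNC.one χ) (Function.update T p (𝒜.op (χ p) b * T p)) =
      Φ χ (BNC.one χ) (Function.update T q (T q * 𝒜.op (χ q) b))
  prop_ii_empty : ∀ (n : ℕ) (χ : Fin n → Side) (T : ∀ k, 𝒜.face (χ k)) (b : B) (p : Fin n),
    {k | χ k = χ p ∧ k < p} = ∅ →
    Φ χ (BNC.one χ) (Function.update T p (𝒜.op (χ p) b * T p)) =
      match χ p with
      | Side.left => b * Φ χ (BNC.one χ) T
      | Side.right => Φ χ (BNC.one χ) T * b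
  prop_iii : ∀ (n : ℕ) (χ : Fin n → Side) (π : BNC χ) (T : ∀ k, 𝒜.face (χ k))
    (m : ℕ) (V : Fin m → Finset (Fin n)), 0 < n →
    (∀ i, (V i).Nonempty) → (∀ k, ∃! i, k ∈ V i) →
    (∀ i, IsChiInterval χ (V i)) → (∀ i, IsUnionOfBlocks π.1 (V i)) →
    (∀ i j, i < j → ∀ a ∈ V i, ∀ b ∈ V j, Prec χ a b) →
    Φ χ π T = (List.ofFn fun i => BiFun.on Φ π T (V i)).prod
  prop_iv : ∀ (n : ℕ) (χ : Fin n → Side) (π : BNC χ) (T : ∀ k, 𝒜.face (χ k))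
    (V W : Finset (Fin n)) (v₀ v₁ θ γ : Fin n),
    Disjoint V W → V ∪ W = Finset.univ →
    IsUnionOfBlocks π.1 V → IsUnionOfBlocks π.1 W → IsChiInterval χ V →
    (∀ k, IsFirst χ Set.univ k → k ∈ W) → (∀ k, IsLast χ Set.univ k → k ∈ W) →
    IsFirst χ V v₀ → IsLast χ V v₁ →
    IsLast χ {k | k ∈ W ∧ Prec χ k v₀} θ → IsFirst χ {k | k ∈ W ∧ Prec χ v₁ k} γ →
    Φ χ π T =
        BiFun.on Φ π (Function.update T θ (𝒜.after (χ θ) (T θ) (BiFun.on Φ π T V))) W ∧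
      Φ χ π T =
        BiFun.on Φ π (Function.update T γ (𝒜.before (χ γ) (T γ) (BiFun.on Φ π T V))) W

/-! ### Convolution, moments and cumulants -/

open Classical in
/-- The convolution `Φ ∗ f`. -/
noncomputable def convolution {𝒜 : BBSpace B A} (Φ : BiFun 𝒜) (f : IA) : BiFun 𝒜 :=
  fun _ χ π T => ∑ σ ∈ (Finset.univ : Finset (BNC χ)).filter (fun σ => σ ≤ π),
    f χ σ π • Φ χ σ T

open Classical in
/-- The recursion for `E_π(T₁, …, Tₙ)`. The set `S` is the union of the blocks that have not been
removed yet, so that a call computes `E_{π|_S}((T₁, …, Tₙ)|_S)`.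

* `m` is the largest of the minima of the remaining blocks, and `V` is its block.
* If `V` is the only block, the value is `E` of the product of the `T_k`, `k ∈ V`, in increasing
  order.
* Otherwise `b = E_{π|_V}((T₁, …, Tₙ)|_V)`, and `x` is `L_b` or `R_b`, according to `χ(m)`. Let
  `D` be the set of the remaining nodes below `m` that are not in `V`. Every block that meets `D`
  begins above `m`, so that these blocks are those whose spines pass `m`.
* If `D = ∅`, the last remaining `T_k` outside `V` is replaced by `T_k x`.
* If `D ≠ ∅`, the spine adjacent to `m` is, by planarity, that of the block `W` of the
  `≺_χ`-first node `w` of `D` if `m` is on the left, and of the `≺_χ`-last one if `m` is on the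
  right; with `k` the smallest element of `W` larger than `m`, `T_k` is replaced by `x T_k`. -/
noncomputable def momentAux (𝒜 : BBSpace B A) {n : ℕ} (χ : Fin n → Side) (π : Setoid (Fin n))
    (S : Finset (Fin n)) (T : Fin n → A) : B :=
  if hm : ∃ m, IsGreatest {a | a ∈ S ∧ ∀ c ∈ S, π a c → a ≤ c} m then
    let m := hm.choose
    let V := S.filter (fun c => π m c)
    let b := 𝒜.E ((V.sort (· ≤ ·)).map T).prod
    let x : A := 𝒜.op (χ m) b
    if V = S then b
    else if hk : ∃ k w,
        (match χ m with
          | Side.left => IsFirst χ {d | d ∈ S ∧ m < d ∧ d ∉ V} w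
          | Side.right => IsLast χ {d | d ∈ S ∧ m < d ∧ d ∉ V} w) ∧
        IsLeast {j | j ∈ S ∧ m < j ∧ π w j} k then
      let k := hk.choose
      momentAux 𝒜 χ π (S \ V) (Function.update T k (x * T k))
    else if hl : ∃ k, IsGreatest {j | j ∈ S ∧ j ∉ V} k then
      let k := hl.choose
      momentAux 𝒜 χ π (S \ V) (Function.update T k (T k * x))
    else b
  else 0
termination_by S.card
decreasing_by
  all_goals
    apply Finset.card_lt_card
    have h₁ := hm.choose_spec.1
    refine ⟨Finset.sdiff_subset, fun h => ?_⟩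
    have h₂ := h h₁.1
    rw [Finset.mem_sdiff] at h₂
    exact h₂.2 (Finset.mem_filter.2 ⟨h₁.1, π.refl _⟩)

/-- `E_π(T₁, …, Tₙ)` for `T₁, …, Tₙ ∈ A`. -/
noncomputable def moment (𝒜 : BBSpace B A) {n : ℕ} {χ : Fin n → Side} (π : BNC χ)
    (T : Fin n → A) : B :=
  momentAux 𝒜 χ π.1 Finset.univ T

/-- The bi-free operator-valued moment function `𝓔`. -/
noncomputable def momentFunction (𝒜 : BBSpace B A) : BiFun 𝒜 :=
  fun _ _ π T => moment 𝒜 π fun k => (T k : A)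

/-- The operator-valued bi-free cumulant function `κ = 𝓔 ∗ μ_BNC`. -/
noncomputable def cumulantFunction (𝒜 : BBSpace B A) : BiFun 𝒜 :=
  convolution (momentFunction 𝒜) moebius

end Space

end BiFree

/-! Along the boundary order `≺_χ` the two sides become indistinguishable: `T L_b` on the left and
`R_b T` on the right both mean "b after T", while `L_b T` and `T R_b` both mean "b before T". In
these terms, rules (i) and (ii) say that, for a full partition, an element of B passes from after an
entry to before the next one, and leaves as a factor at either end (`IsBalanced`). Rules (iii) and
(iv) say that a union of blocks forming an interval can be evaluated first, its value being
multiplied on or inserted at the cut it leaves (`IsFactorizing`, `IsNesting`).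

Convolution. The shift rules are postulated only at the full partition, but the convolution at `1_χ`
sums over all partitions. They propagate: if they hold for single blocks and some block can always
be removed and its value inserted at its cut (`IsEvaluation`), then they hold for every partition,
by induction on the set of nodes (`IsEvaluation.insL_eq_insR`). A removable block exists because the
one with the largest minimum is an interval (`isGap_block`). For (iii) and (iv), partitions below π
are pairs of partitions of two complementary unions of blocks (`sum_restrict`), and a multiplicative
f splits accordingly (`IsMultiplicative.isFactorizing`). The convolution becomes a double sum, and
linearity moves the inner sum into the inserted coefficient.

Cumulants. The same argument applies to the Möbius function, which factorizes because the product of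
its restrictions satisfies its defining recursion (`moebius_isFactorizing`). It remains to treat the
moments. Their recursion removes the block with the largest minimum, but multiplies at a node
dictated by the diagram. Since left and right elements of B commute with the opposite face, and `E(T
L_b) = E(T R_b)`, that multiplication can be moved to a node adjacent to the cut
(`momentAux_reduce`); the value survives because the recursion sees the lower part of each block
only through expectations (`momentAux_congr`). The moments are therefore an `IsEvaluation`, and
`IsEvaluation.split`, the independence of the order in which intervals are evaluated, yields (iii)
and (iv). -/

namespace BiFree

/-! ### Positions along the boundary -/

/-- The position of a node along the boundary, so that `≺_χ` is the order of the positions. -/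
def pos {n : ℕ} (χ : Fin n → Side) (a : Fin n) : ℕ :=
  match χ a with
  | Side.left => a
  | Side.right => 2 * n - a

theorem pos_left {n : ℕ} {χ : Fin n → Side} {a : Fin n} (h : χ a = Side.left) :
    pos χ a = a := by
  simp [pos, h]

theorem pos_right {n : ℕ} {χ : Fin n → Side} {a : Fin n} (h : χ a = Side.right) :
    pos χ a = 2 * n - a := by
  simp [pos, h]

/-- Left nodes have positions below n and right nodes positions above n, in reversed order.
Statements about `≺_χ` thereby become linear arithmetic. -/
theorem prec_iff_pos {n : ℕ} {χ : Fin n → Side} {a b : Fin n} :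
    Prec χ a b ↔ pos χ a < pos χ b := by
  have := a.2
  have := b.2
  unfold Prec pos
  cases χ a <;> cases χ b <;> simp only [Fin.lt_def, true_iff, false_iff] <;> omega

theorem pos_injective {n : ℕ} (χ : Fin n → Side) : Function.Injective (pos χ) := by
  intro a b h
  have := a.2
  have := b.2
  unfold pos at h
  apply Fin.ext
  cases ha : χ a <;> cases hb : χ b <;> simp only [ha, hb] at h <;> omega

theorem pos_enum_lt {n : ℕ} (χ : Fin n → Side) (S : Finset (Fin n)) (a b : Fin S.card) :
    pos (restrict χ S) a < pos (restrict χ S) b ↔ pos χ (enum S a) < pos χ (enum S b) := by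
  rw [← prec_iff_pos, ← prec_iff_pos, prec_enum]

theorem pos_enum_le {n : ℕ} (χ : Fin n → Side) (S : Finset (Fin n)) (a b : Fin S.card) :
    pos (restrict χ S) a ≤ pos (restrict χ S) b ↔ pos χ (enum S a) ≤ pos χ (enum S b) := by
  rw [← not_lt, ← not_lt, pos_enum_lt]

/-- `θ` is the last element of `S` before the cut `p`. -/
def IsPred {n : ℕ} (χ : Fin n → Side) (S : Finset (Fin n)) (p : ℕ) (θ : Fin n) : Prop :=
  θ ∈ S ∧ pos χ θ < p ∧ ∀ k ∈ S, pos χ k < p → pos χ k ≤ pos χ θ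

/-- `γ` is the first element of `S` after the cut `p`. -/
def IsSucc {n : ℕ} (χ : Fin n → Side) (S : Finset (Fin n)) (p : ℕ) (γ : Fin n) : Prop :=
  γ ∈ S ∧ p ≤ pos χ γ ∧ ∀ k ∈ S, p ≤ pos χ k → pos χ γ ≤ pos χ k

theorem exists_isPred {n : ℕ} {χ : Fin n → Side} {S : Finset (Fin n)} {p : ℕ} {k : Fin n}
    (hk : k ∈ S) (h : pos χ k < p) : ∃ θ, IsPred χ S p θ := by
  obtain ⟨θ, hθ, hmax⟩ := (S.filter fun k => pos χ k < p).exists_max_image (pos χ)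
    ⟨k, Finset.mem_filter.2 ⟨hk, h⟩⟩
  rw [Finset.mem_filter] at hθ
  exact ⟨θ, hθ.1, hθ.2, fun k hk h => hmax k (Finset.mem_filter.2 ⟨hk, h⟩)⟩

theorem exists_isSucc {n : ℕ} {χ : Fin n → Side} {S : Finset (Fin n)} {p : ℕ} {k : Fin n}
    (hk : k ∈ S) (h : p ≤ pos χ k) : ∃ γ, IsSucc χ S p γ := by
  obtain ⟨θ, hθ, hmax⟩ := (S.filter fun k => p ≤ pos χ k).exists_min_image (pos χ)
    ⟨k, Finset.mem_filter.2 ⟨hk, h⟩⟩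
  rw [Finset.mem_filter] at hθ
  exact ⟨θ, hθ.1, hθ.2, fun k hk h => hmax k (Finset.mem_filter.2 ⟨hk, h⟩)⟩

theorem IsPred.unique {n : ℕ} {χ : Fin n → Side} {S : Finset (Fin n)} {p : ℕ} {a b : Fin n}
    (ha : IsPred χ S p a) (hb : IsPred χ S p b) : a = b :=
  pos_injective χ (le_antisymm (hb.2.2 a ha.1 ha.2.1) (ha.2.2 b hb.1 hb.2.1))

theorem IsSucc.unique {n : ℕ} {χ : Fin n → Side} {S : Finset (Fin n)} {p : ℕ} {a b : Fin n}
    (ha : IsSucc χ S p a) (hb : IsSucc χ S p b) : a = b :=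
  pos_injective χ (le_antisymm (ha.2.2 b hb.1 hb.2.1) (hb.2.2 a ha.1 ha.2.1))

/-- `V ⊆ S`, and the elements of `S` outside `V` lie before `V` or after `V`, according to their
position relative to the cut `p`. -/
def IsGap {n : ℕ} (χ : Fin n → Side) (S V : Finset (Fin n)) (p : ℕ) : Prop :=
  V ⊆ S ∧ ∀ s ∈ S, s ∉ V → ∀ v ∈ V,
    (pos χ s < p → pos χ s < pos χ v) ∧ (p ≤ pos χ s → pos χ v < pos χ s)

/-- `V` is a union of blocks of the restriction of `π` to `S`. -/
def IsSaturated {n : ℕ} (π : Setoid (Fin n)) (S V : Finset (Fin n)) : Prop :=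
  ∀ a ∈ V, ∀ b ∈ S, π a b → b ∈ V

section Space

variable {B A : Type*} [Ring B] [Algebra ℂ B] [Ring A] [Algebra ℂ A] {𝒜 : BBSpace B A}

/-! ### Multiplication by elements of `B` before or after an entry -/

theorem BBSpace.L_mul (b c : B) : 𝒜.L (b * c) = 𝒜.L b * 𝒜.L c := by
  simp [BBSpace.L, ← map_mul]

theorem BBSpace.R_mul (b c : B) : 𝒜.R (b * c) = 𝒜.R c * 𝒜.R b := by
  simp [BBSpace.R, ← map_mul]

theorem BBSpace.L_one : 𝒜.L 1 = 1 := by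
  simp [BBSpace.L, ← Algebra.TensorProduct.one_def]

theorem BBSpace.R_one : 𝒜.R 1 = 1 := by
  simp [BBSpace.R, ← Algebra.TensorProduct.one_def]

theorem BBSpace.L_add (b c : B) : 𝒜.L (b + c) = 𝒜.L b + 𝒜.L c := by
  simp [BBSpace.L, TensorProduct.add_tmul]

theorem BBSpace.R_add (b c : B) : 𝒜.R (b + c) = 𝒜.R b + 𝒜.R c := by
  simp [BBSpace.R, TensorProduct.tmul_add]

theorem BBSpace.L_smul (z : ℂ) (b : B) : 𝒜.L (z • b) = z • 𝒜.L b := by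
  rw [BBSpace.L, BBSpace.L, ← map_smul, TensorProduct.smul_tmul']

theorem BBSpace.R_smul (z : ℂ) (b : B) : 𝒜.R (z • b) = z • 𝒜.R b := by
  simp [BBSpace.R]

theorem BBSpace.coe_op_left (b : B) : (𝒜.op Side.left b : A) = 𝒜.L b := rfl

theorem BBSpace.coe_op_right (b : B) : (𝒜.op Side.right b : A) = 𝒜.R b := rfl

theorem BBSpace.op_isLinearMap (s : Side) : IsLinearMap ℂ (𝒜.op s) := by
  cases s
  · exact ⟨fun b c => Subtype.ext (BBSpace.L_add b c), fun z b => Subtype.ext (BBSpace.L_smul z b)⟩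
  · exact ⟨fun b c => Subtype.ext (BBSpace.R_add b c), fun z b => Subtype.ext (BBSpace.R_smul z b)⟩

/-- On the right side two reversals cancel: `R` is anti-multiplicative and acts by left
multiplication. Hence B acts from the right on both faces, and later arguments need not distinguish
the sides. -/
theorem BBSpace.after_after (s : Side) (T : 𝒜.face s) (b c : B) :
    𝒜.after s (𝒜.after s T b) c = 𝒜.after s T (b * c) := by
  cases s <;> apply Subtype.ext <;>
    simp [BBSpace.after, BBSpace.coe_op_left, BBSpace.coe_op_right, BBSpace.L_mul, BBSpace.R_mul,
      mul_assoc]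

theorem BBSpace.before_before (s : Side) (T : 𝒜.face s) (b c : B) :
    𝒜.before s (𝒜.before s T b) c = 𝒜.before s T (c * b) := by
  cases s <;> apply Subtype.ext <;>
    simp [BBSpace.before, BBSpace.coe_op_left, BBSpace.coe_op_right, BBSpace.L_mul, BBSpace.R_mul,
      mul_assoc]

theorem BBSpace.after_before (s : Side) (T : 𝒜.face s) (b c : B) :
    𝒜.after s (𝒜.before s T b) c = 𝒜.before s (𝒜.after s T c) b := by
  cases s <;> simp [BBSpace.before, BBSpace.after, mul_assoc]

theorem BBSpace.after_one (s : Side) (T : 𝒜.face s) : 𝒜.after s T 1 = T := by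
  cases s <;> apply Subtype.ext <;>
    simp [BBSpace.after, BBSpace.coe_op_left, BBSpace.coe_op_right, BBSpace.L_one, BBSpace.R_one]

theorem BBSpace.after_isLinearMap (s : Side) (T : 𝒜.face s) : IsLinearMap ℂ (𝒜.after s T) := by
  have h := BBSpace.op_isLinearMap (𝒜 := 𝒜) s
  cases s <;> exact ⟨fun b c => by simp [BBSpace.after, h.map_add, mul_add, add_mul],
    fun z b => by simp [BBSpace.after, h.map_smul]⟩

theorem BBSpace.before_isLinearMap (s : Side) (T : 𝒜.face s) : IsLinearMap ℂ (𝒜.before s T) := by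
  have h := BBSpace.op_isLinearMap (𝒜 := 𝒜) s
  cases s <;> exact ⟨fun b c => by simp [BBSpace.before, h.map_add, mul_add, add_mul],
    fun z b => by simp [BBSpace.before, h.map_smul]⟩

theorem BBSpace.after_of_left {s : Side} (h : s = Side.left) (T : 𝒜.face s) (b : B) :
    𝒜.after s T b = T * 𝒜.op s b := by
  subst h; rfl

theorem BBSpace.after_of_right {s : Side} (h : s = Side.right) (T : 𝒜.face s) (b : B) :
    𝒜.after s T b = 𝒜.op s b * T := by
  subst h; rfl

theorem BBSpace.before_of_left {s : Side} (h : s = Side.left) (T : 𝒜.face s) (b : B) :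
    𝒜.before s T b = 𝒜.op s b * T := by
  subst h; rfl

theorem BBSpace.before_of_right {s : Side} (h : s = Side.right) (T : 𝒜.face s) (b : B) :
    𝒜.before s T b = T * 𝒜.op s b := by
  subst h; rfl

variable {n : ℕ} {χ : Fin n → Side}

/-- The tuple in which `b` is inserted after the entry `a`. -/
def insertAfter (T : ∀ k, 𝒜.face (χ k)) (a : Fin n) (b : B) : ∀ k, 𝒜.face (χ k) :=
  Function.update T a (𝒜.after (χ a) (T a) b)

/-- The tuple in which `b` is inserted before the entry `a`. -/
def insertBefore (T : ∀ k, 𝒜.face (χ k)) (a : Fin n) (b : B) : ∀ k, 𝒜.face (χ k) :=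
  Function.update T a (𝒜.before (χ a) (T a) b)

theorem insertAfter_of_ne (T : ∀ k, 𝒜.face (χ k)) {a k : Fin n} (h : k ≠ a) (b : B) :
    insertAfter T a b k = T k := Function.update_of_ne h _ _

theorem insertBefore_of_ne (T : ∀ k, 𝒜.face (χ k)) {a k : Fin n} (h : k ≠ a) (b : B) :
    insertBefore T a b k = T k := Function.update_of_ne h _ _

theorem insertAfter_insertAfter (T : ∀ k, 𝒜.face (χ k)) (a : Fin n) (b c : B) :
    insertAfter (insertAfter T a b) a c = insertAfter T a (b * c) := by
  simp [insertAfter, BBSpace.after_after]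

theorem insertBefore_insertBefore (T : ∀ k, 𝒜.face (χ k)) (a : Fin n) (b c : B) :
    insertBefore (insertBefore T a b) a c = insertBefore T a (c * b) := by
  simp [insertBefore, BBSpace.before_before]

/-- The nodes may coincide: multiplications from opposite sides commute by associativity. Two
insertions of the same kind commute in general only at distinct nodes. -/
theorem insertAfter_insertBefore (T : ∀ k, 𝒜.face (χ k)) (a a' : Fin n) (b c : B) :
    insertAfter (insertBefore T a b) a' c = insertBefore (insertAfter T a' c) a b := by
  by_cases h : a' = a
  · subst h
    simp [insertAfter, insertBefore, BBSpace.after_before]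
  · simp only [insertAfter, insertBefore, Function.update_of_ne h,
      Function.update_of_ne (Ne.symm h)]
    exact Function.update_comm (Ne.symm h) _ _ _

theorem insertAfter_comm (T : ∀ k, 𝒜.face (χ k)) {a a' : Fin n} (h : a ≠ a') (b c : B) :
    insertAfter (insertAfter T a b) a' c = insertAfter (insertAfter T a' c) a b := by
  simp only [insertAfter, Function.update_of_ne h, Function.update_of_ne h.symm]
  exact Function.update_comm h _ _ _

theorem insertBefore_comm (T : ∀ k, 𝒜.face (χ k)) {a a' : Fin n} (h : a ≠ a') (b c : B) :
    insertBefore (insertBefore T a b) a' c = insertBefore (insertBefore T a' c) a b := by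
  simp only [insertBefore, Function.update_of_ne h, Function.update_of_ne h.symm]
  exact Function.update_comm h _ _ _

theorem insertAfter_one (T : ∀ k, 𝒜.face (χ k)) (a : Fin n) : insertAfter T a 1 = T := by
  simp [insertAfter, BBSpace.after_one]

/-! ### Evaluations on sets of nodes -/

/-- A family of functions of the entries at the nodes of `S`, for all sets `S` of nodes. -/
abbrev Family (𝒜 : BBSpace B A) {n : ℕ} (χ : Fin n → Side) : Type _ :=
  Finset (Fin n) → (∀ k, 𝒜.face (χ k)) → B

open Classical in
/-- The value of `F` at `S` after `b` has been inserted at the cut `p`: after the last entry before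
`p`, if there is one, and as a left factor otherwise. -/
noncomputable def insL (F : Family 𝒜 χ) (S : Finset (Fin n)) (p : ℕ) (b : B)
    (T : ∀ k, 𝒜.face (χ k)) : B :=
  if h : ∃ θ, IsPred χ S p θ then F S (insertAfter T h.choose b) else b * F S T

open Classical in
/-- The value of `F` at `S` after `b` has been inserted at the cut `p`: before the first entry after
`p`, if there is one, and as a right factor otherwise. -/
noncomputable def insR (F : Family 𝒜 χ) (S : Finset (Fin n)) (p : ℕ) (b : B)
    (T : ∀ k, 𝒜.face (χ k)) : B :=
  if h : ∃ γ, IsSucc χ S p γ then F S (insertBefore T h.choose b) else F S T * b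

variable {F : Family 𝒜 χ} {S V : Finset (Fin n)} {p : ℕ} {b : B} {T : ∀ k, 𝒜.face (χ k)}

theorem insL_of_isPred {θ : Fin n} (h : IsPred χ S p θ) :
    insL F S p b T = F S (insertAfter T θ b) := by
  have h' : ∃ θ, IsPred χ S p θ := ⟨θ, h⟩
  rw [insL, dif_pos h', h'.choose_spec.unique h]

theorem insR_of_isSucc {γ : Fin n} (h : IsSucc χ S p γ) :
    insR F S p b T = F S (insertBefore T γ b) := by
  have h' : ∃ θ, IsSucc χ S p θ := ⟨γ, h⟩
  rw [insR, dif_pos h', h'.choose_spec.unique h]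

theorem insL_of_forall (h : ∀ k ∈ S, p ≤ pos χ k) : insL F S p b T = b * F S T := by
  rw [insL, dif_neg]
  rintro ⟨θ, h₁, h₂, -⟩
  exact absurd (h θ h₁) (by omega)

theorem insR_of_forall (h : ∀ k ∈ S, pos χ k < p) : insR F S p b T = F S T * b := by
  rw [insR, dif_neg]
  rintro ⟨θ, h₁, h₂, -⟩
  exact absurd (h θ h₁) (by omega)

/-- A cut matters only through the way it divides S, so cuts left by different blocks can be
identified on what remains. -/
theorem insL_congr_cut {q : ℕ} (h : ∀ k ∈ S, pos χ k < p ↔ pos χ k < q) :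
    insL F S p b T = insL F S q b T := by
  by_cases h' : ∃ k ∈ S, pos χ k < p
  · obtain ⟨k, hk, hkp⟩ := h'
    obtain ⟨θ, hθ⟩ := exists_isPred hk hkp
    rw [insL_of_isPred hθ, insL_of_isPred
      ⟨hθ.1, (h θ hθ.1).1 hθ.2.1, fun k hk hq => hθ.2.2 k hk ((h k hk).2 hq)⟩]
  · push Not at h'
    rw [insL_of_forall h', insL_of_forall fun k hk => by have := h k hk; have := h' k hk; omega]

/-- The rules of an operator-valued multiplicative function, for single blocks, together with one
way to reduce the number of blocks. -/
structure IsEvaluation (π : Setoid (Fin n)) (F : Family 𝒜 χ) : Prop where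
  empty : ∀ T, F ∅ T = 1
  congr : ∀ S T T', (∀ k ∈ S, T k = T' k) → F S T = F S T'
  single : ∀ S T p b, S.Nonempty → (∀ a ∈ S, ∀ a' ∈ S, π a a') →
    insL F S p b T = insR F S p b T
  reduce : ∀ S, (¬ ∀ a ∈ S, ∀ a' ∈ S, π a a') → ∃ V p, V.Nonempty ∧ V ≠ S ∧ IsGap χ S V p ∧
    IsSaturated π S V ∧ (∀ a ∈ V, ∀ a' ∈ V, π a a') ∧
    ∀ T, F S T = insL F (S \ V) p (F V T) T ∨ F S T = insR F (S \ V) p (F V T) T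

end Space

section Space

variable {B A : Type*} [Ring B] [Algebra ℂ B] [Ring A] [Algebra ℂ A] {𝒜 : BBSpace B A}
  {n : ℕ} {χ : Fin n → Side} {π : Setoid (Fin n)}
  {F : Family 𝒜 χ} {S V : Finset (Fin n)} {p : ℕ} {b : B} {T T' : ∀ k, 𝒜.face (χ k)}

theorem insertAfter_congr {k a : Fin n} (h : T k = T' k) (b : B) :
    insertAfter T a b k = insertAfter T' a b k := by
  by_cases hk : k = a
  · subst hk; simp [insertAfter, h]
  · simp [insertAfter_of_ne _ hk, h]

theorem insertBefore_congr {k a : Fin n} (h : T k = T' k) (b : B) :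
    insertBefore T a b k = insertBefore T' a b k := by
  by_cases hk : k = a
  · subst hk; simp [insertBefore, h]
  · simp [insertBefore_of_ne _ hk, h]

/-! ### Independence of the side of a cut and of the order of evaluation -/

namespace IsEvaluation

theorem insL_congr (hF : IsEvaluation π F) (h : ∀ k ∈ S, T k = T' k) :
    insL F S p b T = insL F S p b T' := by
  unfold insL
  split_ifs with h'
  · exact hF.congr _ _ _ fun k hk => insertAfter_congr (h k hk) b
  · rw [hF.congr _ _ _ h]

theorem insR_congr (hF : IsEvaluation π F) (h : ∀ k ∈ S, T k = T' k) :
    insR F S p b T = insR F S p b T' := by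
  unfold insR
  split_ifs with h'
  · exact hF.congr _ _ _ fun k hk => insertBefore_congr (h k hk) b
  · rw [hF.congr _ _ _ h]

theorem insertAfter_of_notMem (hF : IsEvaluation π F) {a : Fin n} (h : a ∉ S) :
    F S (insertAfter T a b) = F S T :=
  hF.congr _ _ _ fun _ hk => insertAfter_of_ne _ (ne_of_mem_of_not_mem hk h) _

theorem insertBefore_of_notMem (hF : IsEvaluation π F) {a : Fin n} (h : a ∉ S) :
    F S (insertBefore T a b) = F S T :=
  hF.congr _ _ _ fun _ hk => insertBefore_of_ne _ (ne_of_mem_of_not_mem hk h) _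

theorem insL_insertAfter_of_notMem (hF : IsEvaluation π F) {a : Fin n} (h : a ∉ S) {c : B} :
    insL F S p c (insertAfter T a b) = insL F S p c T :=
  hF.insL_congr fun _ hk => insertAfter_of_ne _ (ne_of_mem_of_not_mem hk h) _

theorem insL_insertBefore_of_notMem (hF : IsEvaluation π F) {a : Fin n} (h : a ∉ S) {c : B} :
    insL F S p c (insertBefore T a b) = insL F S p c T :=
  hF.insL_congr fun _ hk => insertBefore_of_ne _ (ne_of_mem_of_not_mem hk h) _

theorem insR_insertAfter_of_notMem (hF : IsEvaluation π F) {a : Fin n} (h : a ∉ S) {c : B} :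
    insR F S p c (insertAfter T a b) = insR F S p c T :=
  hF.insR_congr fun _ hk => insertAfter_of_ne _ (ne_of_mem_of_not_mem hk h) _

/-- Insertion after the last entry before a cut, and before the first entry after it, agree. -/
theorem insL_eq_insR (hF : IsEvaluation π F) (S : Finset (Fin n)) :
    ∀ T p b, insL F S p b T = insR F S p b T := by
  induction S using Finset.strongInduction with
  | H S ih =>
  intro T p b
  rcases S.eq_empty_or_nonempty with rfl | hS
  · rw [insL_of_forall (by simp), insR_of_forall (by simp), hF.empty]
    simp
  by_cases h1 : ∀ a ∈ S, ∀ a' ∈ S, π a a'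
  · exact hF.single S T p b hS h1
  obtain ⟨V, q, ⟨v, hv⟩, hVS, hgap, -, -, hred⟩ := hF.reduce S h1
  obtain ⟨hsub, hgap⟩ := hgap
  have hV : V ⊂ S := ⟨hsub, fun h => hVS (Finset.Subset.antisymm hsub h)⟩
  have hW : S \ V ⊂ S := ⟨Finset.sdiff_subset, fun h => (Finset.mem_sdiff.1 (h (hsub hv))).2 hv⟩
  -- Whichever form the reduction provides, the induction hypothesis on the remaining set supplies
  -- the other one. From here on the more convenient form is used.
  have hL : ∀ T, F S T = insL F (S \ V) q (F V T) T := fun T => by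
    rcases hred T with h | h
    · exact h
    · rw [h, ih _ hW]
  have hR : ∀ T, F S T = insR F (S \ V) q (F V T) T := fun T => by rw [hL, ih _ hW]
  have hmem : ∀ k, k ∈ S \ V ↔ k ∈ S ∧ k ∉ V := fun k => Finset.mem_sdiff
  clear hred h1 hS
  -- Three positions of V relative to the cut p: astride it, entirely before it, entirely after it.
  by_cases hb : ∃ v ∈ V, pos χ v < p
  · obtain ⟨v₁, hv₁, hv₁p⟩ := hb
    by_cases ha : ∃ v ∈ V, p ≤ pos χ v
    · obtain ⟨v₂, hv₂, hv₂p⟩ := ha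
      obtain ⟨θ, hθ⟩ := exists_isPred hv₁ hv₁p
      obtain ⟨γ, hγ⟩ := exists_isSucc hv₂ hv₂p
      -- With V astride p, no other element of S can lie between the neighbours of p in V. Both
      -- insertions therefore take place inside V, where the induction hypothesis applies.
      have hθS : IsPred χ S p θ := by
        refine ⟨hsub hθ.1, hθ.2.1, fun k hk hkp => ?_⟩
        by_cases hkV : k ∈ V
        · exact hθ.2.2 k hkV hkp
        · have h₁ := hgap k hk hkV θ hθ.1
          have h₂ := hgap k hk hkV v₂ hv₂
          omega
      have hγS : IsSucc χ S p γ := by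
        refine ⟨hsub hγ.1, hγ.2.1, fun k hk hkp => ?_⟩
        by_cases hkV : k ∈ V
        · exact hγ.2.2 k hkV hkp
        · have h₁ := hgap k hk hkV γ hγ.1
          have h₂ := hgap k hk hkV v₁ hv₁
          omega
      rw [insL_of_isPred hθS, insR_of_isSucc hγS, hL, hL,
        hF.insL_insertAfter_of_notMem (by simp [hθ.1]),
        hF.insL_insertBefore_of_notMem (by simp [hγ.1]),
        ← insL_of_isPred (F := F) hθ, ← insR_of_isSucc (F := F) hγ, ih V hV]
    · push Not at ha
      obtain ⟨θ, hθ⟩ := exists_isPred (hsub hv₁) hv₁p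
      by_cases hθV : θ ∈ V
      -- Here V ends exactly at p, so b leaves V as a right factor. The next entry γ follows both
      -- the cut p of S and the gap of V, and both sides insert the product `F V T * b` before it.
      · have hθ' : IsPred χ V p θ := ⟨hθV, hθ.2.1, fun k hk => hθ.2.2 k (hsub hk)⟩
        rw [insL_of_isPred hθ, hR, hF.insR_insertAfter_of_notMem (by simp [hθV]),
          ← insL_of_isPred (F := F) hθ', ih V hV, insR_of_forall ha]
        by_cases hs : ∃ k ∈ S, p ≤ pos χ k
        · obtain ⟨k, hk, hkp⟩ := hs
          obtain ⟨γ, hγ⟩ := exists_isSucc hk hkp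
          have hγV : γ ∉ V := fun h => absurd (ha γ h) (by have := hγ.2.1; omega)
          have hγ' : IsSucc χ (S \ V) q γ := by
            refine ⟨(hmem γ).2 ⟨hγ.1, hγV⟩, ?_, fun k hk hkq => ?_⟩
            · have h₁ := hgap γ hγ.1 hγV θ hθV
              have := hγ.2.1
              have := hθ.2.1
              omega
            · obtain ⟨hk, hkV⟩ := (hmem k).1 hk
              have h₁ := hgap k hk hkV θ hθV
              have h₂ := hθ.2.2 k hk
              exact hγ.2.2 k hk (by omega)
          rw [insR_of_isSucc hγ, hR, insR_of_isSucc hγ', insR_of_isSucc hγ',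
            hF.insertBefore_of_notMem hγV, insertBefore_insertBefore]
        · push Not at hs
          have hs' : ∀ k ∈ S \ V, pos χ k < q := fun k hk => by
            obtain ⟨hk, hkV⟩ := (hmem k).1 hk
            have h₁ := hgap k hk hkV θ hθV
            have h₂ := hθ.2.2 k hk
            have h₃ := hs k hk
            omega
          rw [insR_of_forall hs, hR, insR_of_forall hs', insR_of_forall hs', mul_assoc]
      -- Here θ separates V from p. The value of V is inserted before γ, which is at or before θ,
      -- and the shift at p happens in the remaining set. The first entry δ after p differs from γ,
      -- so the two insertions do not interfere.
      · have hθq : q ≤ pos χ θ := by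
          have h₁ := hgap θ hθ.1 hθV v hv
          have h₂ := hθ.2.2 v (hsub hv) (ha v hv)
          omega
        have hθW : θ ∈ S \ V := (hmem θ).2 ⟨hθ.1, hθV⟩
        have hθ' : IsPred χ (S \ V) p θ :=
          ⟨hθW, hθ.2.1, fun k hk => hθ.2.2 k ((hmem k).1 hk).1⟩
        obtain ⟨γ, hγ⟩ := exists_isSucc hθW hθq
        have hγθ := hγ.2.2 θ hθW hθq
        rw [insL_of_isPred hθ, hR, hF.insertAfter_of_notMem hθV, insR_of_isSucc hγ,
          ← insertAfter_insertBefore, ← insL_of_isPred (F := F) hθ', ih _ hW]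
        by_cases hs : ∃ k ∈ S, p ≤ pos χ k
        · obtain ⟨k, hk, hkp⟩ := hs
          obtain ⟨δ, hδ⟩ := exists_isSucc hk hkp
          have hδV : δ ∉ V := fun h => absurd (ha δ h) (by have := hδ.2.1; omega)
          have hδ' : IsSucc χ (S \ V) p δ :=
            ⟨(hmem δ).2 ⟨hδ.1, hδV⟩, hδ.2.1, fun k hk => hδ.2.2 k ((hmem k).1 hk).1⟩
          have hne : γ ≠ δ := by
            rintro rfl
            have := hδ.2.1
            have := hθ.2.1
            omega
          rw [insR_of_isSucc hδ, insR_of_isSucc hδ', hR, insR_of_isSucc hγ,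
            hF.insertBefore_of_notMem hδV, insertBefore_comm _ hne]
        · push Not at hs
          rw [insR_of_forall hs, insR_of_forall fun k hk => hs k ((hmem k).1 hk).1, hR,
            insR_of_isSucc hγ]
  -- The mirror image: V lies after p, and left and right factors exchange roles.
  · push Not at hb
    obtain ⟨γ, hγ⟩ := exists_isSucc (hsub hv) (hb v hv)
    by_cases hγV : γ ∈ V
    · have hγ' : IsSucc χ V p γ := ⟨hγV, hγ.2.1, fun k hk => hγ.2.2 k (hsub hk)⟩
      rw [insR_of_isSucc hγ, hL (insertBefore _ _ _),
        hF.insL_insertBefore_of_notMem (by simp [hγV]), ← insR_of_isSucc (F := F) hγ', ← ih V hV,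
        insL_of_forall hb]
      by_cases hs : ∃ k ∈ S, pos χ k < p
      · obtain ⟨k, hk, hkp⟩ := hs
        obtain ⟨θ, hθ⟩ := exists_isPred hk hkp
        have hθV : θ ∉ V := fun h => absurd (hb θ h) (by have := hθ.2.1; omega)
        have hθ' : IsPred χ (S \ V) q θ := by
          refine ⟨(hmem θ).2 ⟨hθ.1, hθV⟩, ?_, fun k hk hkq => ?_⟩
          · have h₁ := hgap θ hθ.1 hθV γ hγV
            have := hγ.2.1
            have := hθ.2.1
            omega
          · obtain ⟨hk, hkV⟩ := (hmem k).1 hk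
            have h₁ := hgap k hk hkV γ hγV
            have h₂ := hγ.2.2 k hk
            exact hθ.2.2 k hk (by omega)
        rw [insL_of_isPred hθ, hL, insL_of_isPred hθ', insL_of_isPred hθ',
          hF.insertAfter_of_notMem hθV, insertAfter_insertAfter]
      · push Not at hs
        have hs' : ∀ k ∈ S \ V, q ≤ pos χ k := fun k hk => by
          obtain ⟨hk, hkV⟩ := (hmem k).1 hk
          have h₁ := hgap k hk hkV γ hγV
          have h₂ := hγ.2.2 k hk
          have h₃ := hs k hk
          omega
        rw [insL_of_forall hs, hL, insL_of_forall hs', insL_of_forall hs', mul_assoc]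
    · have hγq : pos χ γ < q := by
        have h₁ := hgap γ hγ.1 hγV v hv
        have h₂ := hγ.2.2 v (hsub hv) (hb v hv)
        omega
      have hγW : γ ∈ S \ V := (hmem γ).2 ⟨hγ.1, hγV⟩
      have hγ' : IsSucc χ (S \ V) p γ :=
        ⟨hγW, hγ.2.1, fun k hk => hγ.2.2 k ((hmem k).1 hk).1⟩
      obtain ⟨θ, hθ⟩ := exists_isPred hγW hγq
      have hγθ := hθ.2.2 γ hγW hγq
      rw [insR_of_isSucc hγ, hL (insertBefore _ _ _), hF.insertBefore_of_notMem hγV,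
        insL_of_isPred hθ, insertAfter_insertBefore, ← insR_of_isSucc (F := F) hγ', ← ih _ hW]
      by_cases hs : ∃ k ∈ S, pos χ k < p
      · obtain ⟨k, hk, hkp⟩ := hs
        obtain ⟨δ, hδ⟩ := exists_isPred hk hkp
        have hδV : δ ∉ V := fun h => absurd (hb δ h) (by have := hδ.2.1; omega)
        have hδ' : IsPred χ (S \ V) p δ :=
          ⟨(hmem δ).2 ⟨hδ.1, hδV⟩, hδ.2.1, fun k hk => hδ.2.2 k ((hmem k).1 hk).1⟩
        have hne : θ ≠ δ := by
          rintro rfl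
          have := hδ.2.1
          have := hγ.2.1
          omega
        rw [insL_of_isPred hδ, insL_of_isPred hδ', hL, insL_of_isPred hθ,
          hF.insertAfter_of_notMem hδV, insertAfter_comm _ hne]
      · push Not at hs
        rw [insL_of_forall hs, insL_of_forall fun k hk => hs k ((hmem k).1 hk).1, hL,
          insL_of_isPred hθ]

/-- Two disjoint unions of blocks, the first of which lies before the second, can be removed in
either order. -/
theorem insL_sdiff_eq_insR_sdiff (hF : IsEvaluation π F) {S V U : Finset (Fin n)} {p q : ℕ}
    (hVn : V.Nonempty) (hUn : U.Nonempty) (hV : IsGap χ S V p) (hU : IsGap χ S U q)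
    (hlt : ∀ v ∈ V, ∀ u ∈ U, pos χ v < pos χ u)
    (h₁ : ∀ T, F (S \ U) T = insL F ((S \ U) \ V) p (F V T) T)
    (h₂ : ∀ T, F (S \ V) T = insL F ((S \ V) \ U) q (F U T) T) :
    insL F (S \ U) q (F U T) T = insR F (S \ V) p (F V T) T := by
  have hd : ∀ k ∈ V, k ∉ U := fun k hk hk' => absurd (hlt k hk k hk') (lt_irrefl _)
  obtain ⟨v, hv⟩ := hVn
  obtain ⟨u, hu⟩ := hUn
  have hcomm : (S \ U) \ V = (S \ V) \ U := sdiff_right_comm _ _ _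
  obtain ⟨hVS, hV⟩ := hV
  obtain ⟨hUS, hU⟩ := hU
  have hvq : pos χ v < q := by
    have := hU v (hVS hv) (hd v hv) u hu
    have := hlt v hv u hu
    omega
  have hpu : p ≤ pos χ u := by
    have := hV u (hUS hu) (fun h => hd u h hu) v hv
    have := hlt v hv u hu
    omega
  obtain ⟨θ, hθ⟩ := exists_isPred (Finset.mem_sdiff.2 ⟨hVS hv, hd v hv⟩) hvq
  obtain ⟨γ, hγ⟩ := exists_isSucc (Finset.mem_sdiff.2 ⟨hUS hu, fun h => hd u h hu⟩) hpu
  have hθS := Finset.mem_sdiff.1 hθ.1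
  have hγS := Finset.mem_sdiff.1 hγ.1
  rw [insL_of_isPred hθ, insR_of_isSucc hγ, h₁, h₂]
  -- If the last entry before U is in V, then nothing of S lies between V and U. On either side the
  -- shift rule merges the two values into `F V T * F U T`, inserted at one and the same cut of the
  -- rest.
  by_cases hθV : θ ∈ V
  · have hγU : γ ∈ U := by
      by_contra h
      have h₁ := hV γ hγS.1 hγS.2 θ hθV
      have h₂ := hU γ hγS.1 h u hu
      have h₃ := hγ.2.1
      have h₄ := hγ.2.2 u (Finset.mem_sdiff.2 ⟨hUS hu, fun h => hd u h hu⟩) hpu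
      have h₅ := hθ.2.2 γ (Finset.mem_sdiff.2 ⟨hγS.1, h⟩)
      omega
    have hθ' : IsPred χ V q θ :=
      ⟨hθV, hθ.2.1, fun k hk => hθ.2.2 k (Finset.mem_sdiff.2 ⟨hVS hk, hd k hk⟩)⟩
    have hγ' : IsSucc χ U p γ :=
      ⟨hγU, hγ.2.1, fun k hk => hγ.2.2 k (Finset.mem_sdiff.2 ⟨hUS hk, fun h => hd k h hk⟩)⟩
    have hVq : ∀ k ∈ V, pos χ k < q := fun k hk => by
      have := hU k (hVS hk) (hd k hk) u hu
      have := hlt k hk u hu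
      omega
    have hpU : ∀ k ∈ U, p ≤ pos χ k := fun k hk => by
      have := hV k (hUS hk) (fun h => hd k h hk) v hv
      have := hlt v hv k hk
      omega
    rw [hF.insL_insertAfter_of_notMem (by simp [hθV]),
      hF.insL_insertBefore_of_notMem (by simp [hγU]), ← insL_of_isPred (F := F) hθ', ← insR_of_isSucc (F := F) hγ',
      hF.insL_eq_insR V, ← hF.insL_eq_insR U, insR_of_forall hVq, insL_of_forall hpU, hcomm]
    refine insL_congr_cut fun k hk => ?_
    simp only [Finset.mem_sdiff] at hk
    have a₁ := hV k hk.1.1 hk.1.2 θ hθV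
    have a₂ := hU k hk.1.1 hk.2 u hu
    have a₃ := hθ.2.2 k (Finset.mem_sdiff.2 ⟨hk.1.1, hk.2⟩)
    have a₄ := hlt θ hθV u hu
    omega
  -- Otherwise an entry outside both sets separates them. The values are inserted after θ and before
  -- γ, both outside V and U, and these insertions commute even if θ and γ coincide.
  · have hθv := hθ.2.2 v (Finset.mem_sdiff.2 ⟨hVS hv, hd v hv⟩) hvq
    have hθV' := hV θ hθS.1 hθV v hv
    have hθp : p ≤ pos χ θ := by
      omega
    have hγθ := hγ.2.2 θ (Finset.mem_sdiff.2 ⟨hθS.1, hθV⟩) hθp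
    have hγU : γ ∉ U := fun h => by
      have := hU θ hθS.1 hθS.2 γ h
      have := hθ.2.1
      omega
    have hθ' : IsPred χ ((S \ V) \ U) q θ :=
      ⟨by simp [hθS, hθV], hθ.2.1, fun k hk => hθ.2.2 k (by
        simp only [Finset.mem_sdiff] at hk ⊢; exact ⟨hk.1.1, hk.2⟩)⟩
    have hγ' : IsSucc χ ((S \ V) \ U) p γ :=
      ⟨by simp [hγS, hγU], hγ.2.1, fun k hk => hγ.2.2 k (by
        simp only [Finset.mem_sdiff] at hk ⊢; exact hk.1)⟩
    rw [hF.insertAfter_of_notMem hθV, hF.insertBefore_of_notMem hγU, hF.insL_eq_insR, hcomm,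
      insR_of_isSucc hγ', insL_of_isPred hθ', insertAfter_insertBefore]

/-- A union of blocks that is an interval can be evaluated first. -/
theorem split (hF : IsEvaluation π F) (S : Finset (Fin n)) :
    ∀ V p, IsGap χ S V p → IsSaturated π S V → ∀ T, F S T = insL F (S \ V) p (F V T) T := by
  induction S using Finset.strongInduction with
  | H S ih =>
  intro V p hV hsat T
  rcases V.eq_empty_or_nonempty with rfl | hVn
  · rw [hF.empty, Finset.sdiff_empty]
    unfold insL
    split_ifs
    · rw [insertAfter_one]
    · rw [one_mul]
  by_cases hVS : V = S
  · subst hVS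
    rw [insL_of_forall (by simp), Finset.sdiff_self, hF.empty, mul_one]
  have h1 : ¬ ∀ a ∈ S, ∀ a' ∈ S, π a a' := fun h =>
    hVS (Finset.Subset.antisymm hV.1 fun k hk => by
      obtain ⟨v, hv⟩ := hVn
      exact hsat v hv k hk (h v (hV.1 hv) k hk))
  obtain ⟨U, q, hUn, hUS, hU, hUsat, hUcl, hred⟩ := hF.reduce S h1
  have hL : F S T = insL F (S \ U) q (F U T) T := by
    rcases hred T with h | h
    · exact h
    · rw [h, hF.insL_eq_insR]
  have hUss : S \ U ⊂ S := Finset.sdiff_ssubset hU.1 hUn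
  have hVss : S \ V ⊂ S := Finset.sdiff_ssubset hV.1 hVn
  obtain ⟨u, hu⟩ := hUn
  -- The block U from the reduction is contained in V or disjoint from it, V being saturated.
  by_cases huV : u ∈ V
  · have hUV : U ⊆ V := fun k hk => hsat u huV k (hU.1 hk) (hUcl u hu k hk)
    have hrest : (S \ U) \ (V \ U) = S \ V := by
      ext k
      simp only [Finset.mem_sdiff]
      have := @hUV k
      tauto
    have hgap : IsGap χ (S \ U) (V \ U) p := by
      refine ⟨Finset.sdiff_subset_sdiff hV.1 le_rfl, fun s hs hs' v hv => ?_⟩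
      simp only [Finset.mem_sdiff] at hs hs' hv
      exact hV.2 s hs.1 (fun h => hs' ⟨h, hs.2⟩) v hv.1
    have hsat' : IsSaturated π (S \ U) (V \ U) := by
      intro a ha k hk hak
      simp only [Finset.mem_sdiff] at ha hk ⊢
      exact ⟨hsat a ha.1 k hk.1 hak, hk.2⟩
    by_cases hVU : V ⊆ U
    · obtain rfl := Finset.Subset.antisymm hUV hVU
      rw [hL]
      refine insL_congr_cut fun k hk => ?_
      obtain ⟨hk, hkU⟩ := Finset.mem_sdiff.1 hk
      have := hU.2 k hk hkU u hu
      have := hV.2 k hk hkU u hu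
      omega
    have hV' : F V T = insL F (V \ U) q (F U T) T := by
      refine ih V ⟨hV.1, fun h => hVS (Finset.Subset.antisymm hV.1 h)⟩ U q
        ⟨hUV, fun s hs => hU.2 s (hV.1 hs)⟩ (fun a ha k hk => hUsat a ha k (hV.1 hk)) T
    have key : ∀ T, F (S \ U) T = insL F (S \ V) p (F (V \ U) T) T := fun T => by
      rw [ih _ hUss _ p hgap hsat' T, hrest]
    -- A node of V outside U decides on which side of U the value of U is inserted: on that side the
    -- neighbour of U in S belongs to V. The insertion then stays inside V, and the induction
    -- hypothesis for V reassembles `F V T`.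
    obtain ⟨w, hw, hwU⟩ := Finset.not_subset.1 hVU
    by_cases hwq : pos χ w < q
    · obtain ⟨θ, hθ⟩ := exists_isPred (Finset.mem_sdiff.2 ⟨hw, hwU⟩) hwq
      have hθV := Finset.mem_sdiff.1 hθ.1
      have hθ' : IsPred χ (S \ U) q θ := by
        refine ⟨Finset.mem_sdiff.2 ⟨hV.1 hθV.1, hθV.2⟩, hθ.2.1, fun k hk hkq => ?_⟩
        obtain ⟨hk, hkU⟩ := Finset.mem_sdiff.1 hk
        by_cases hkV : k ∈ V
        · exact hθ.2.2 k (Finset.mem_sdiff.2 ⟨hkV, hkU⟩) hkq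
        · have a₁ := hU.2 k hk hkU u hu
          have a₂ := hV.2 k hk hkV u huV
          have a₃ := hV.2 k hk hkV θ hθV.1
          omega
      rw [hL, insL_of_isPred hθ', key, hF.insL_insertAfter_of_notMem (by simp [hθV.1]),
        ← insL_of_isPred (F := F) hθ, ← hV']
    · obtain ⟨γ, hγ⟩ := exists_isSucc (Finset.mem_sdiff.2 ⟨hw, hwU⟩) (not_lt.1 hwq)
      have hγV := Finset.mem_sdiff.1 hγ.1
      have hγ' : IsSucc χ (S \ U) q γ := by
        refine ⟨Finset.mem_sdiff.2 ⟨hV.1 hγV.1, hγV.2⟩, hγ.2.1, fun k hk hkq => ?_⟩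
        obtain ⟨hk, hkU⟩ := Finset.mem_sdiff.1 hk
        by_cases hkV : k ∈ V
        · exact hγ.2.2 k (Finset.mem_sdiff.2 ⟨hkV, hkU⟩) hkq
        · have a₁ := hU.2 k hk hkU u hu
          have a₂ := hV.2 k hk hkV u huV
          have a₃ := hV.2 k hk hkV γ hγV.1
          omega
      rw [hL, hF.insL_eq_insR, insR_of_isSucc hγ', key,
        hF.insL_insertBefore_of_notMem (by simp [hγV.1]), ← insR_of_isSucc (F := F) hγ, ← hF.insL_eq_insR,
        ← hV']
  -- For disjoint U and V, the induction hypothesis allows removing the other set second in each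
  -- order; since one of them lies entirely before the other, the two orders give the same value.
  · have hdis : ∀ k ∈ U, k ∉ V := fun k hk hkV =>
      huV (hsat k hkV u (hU.1 hu) (hUcl k hk u hu))
    have k₁ : ∀ T, F (S \ U) T = insL F ((S \ U) \ V) p (F V T) T := by
      refine ih _ hUss V p ⟨fun k hk => Finset.mem_sdiff.2 ⟨hV.1 hk, fun h => hdis k h hk⟩,
        fun s hs => hV.2 s (Finset.mem_sdiff.1 hs).1⟩
        fun a ha k hk => hsat a ha k (Finset.mem_sdiff.1 hk).1
    have k₂ : ∀ T, F (S \ V) T = insL F ((S \ V) \ U) q (F U T) T := by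
      refine ih _ hVss U q ⟨fun k hk => Finset.mem_sdiff.2 ⟨hU.1 hk, hdis k hk⟩,
        fun s hs => hU.2 s (Finset.mem_sdiff.1 hs).1⟩
        fun a ha k hk => hUsat a ha k (Finset.mem_sdiff.1 hk).1
    by_cases huq : pos χ u < p
    · have hlt : ∀ u' ∈ U, ∀ v ∈ V, pos χ u' < pos χ v := fun u' hu' v hv => by
        have a₁ := hV.2 u (hU.1 hu) huV v hv
        have a₂ := hV.2 u' (hU.1 hu') (hdis u' hu') v hv
        have a₃ := hU.2 v (hV.1 hv) (fun h => hdis v h hv) u hu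
        have a₄ := hU.2 v (hV.1 hv) (fun h => hdis v h hv) u' hu'
        omega
      rw [hF.insL_sdiff_eq_insR_sdiff ⟨u, hu⟩ hVn hU hV hlt k₂ k₁, hL, hF.insL_eq_insR]
    · have hlt : ∀ v ∈ V, ∀ u' ∈ U, pos χ v < pos χ u' := fun v hv u' hu' => by
        have a₁ := hV.2 u (hU.1 hu) huV v hv
        have a₂ := hV.2 u' (hU.1 hu') (hdis u' hu') v hv
        have a₃ := hU.2 v (hV.1 hv) (fun h => hdis v h hv) u hu
        have a₄ := hU.2 v (hV.1 hv) (fun h => hdis v h hv) u' hu'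
        omega
      rw [hL, hF.insL_sdiff_eq_insR_sdiff hVn ⟨u, hu⟩ hV hU hlt k₁ k₂, hF.insL_eq_insR]

end IsEvaluation

end Space

/-! ### Iterated restriction -/

theorem IsUnionOfBlocks.of_disjoint_union {n : ℕ} {π : Setoid (Fin n)} {V W : Finset (Fin n)}
    (h : IsUnionOfBlocks π V) (hd : Disjoint V W) (hu : V ∪ W = Finset.univ) :
    IsUnionOfBlocks π W := by
  intro a b hab ha
  have hb : b ∈ V ∪ W := hu ▸ Finset.mem_univ b
  rcases Finset.mem_union.1 hb with hb | hb
  · exact absurd ha (Finset.disjoint_left.1 hd (h b a (π.symm hab) hb))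
  · exact hb

theorem enum_mem {n : ℕ} (S : Finset (Fin n)) (i : Fin S.card) : enum S i ∈ S :=
  Finset.orderEmbOfFin_mem S rfl i

theorem exists_enum_eq {n : ℕ} {S : Finset (Fin n)} {k : Fin n} (hk : k ∈ S) :
    ∃ i, enum S i = k := by
  have : k ∈ Set.range (S.orderEmbOfFin rfl) := by rw [Finset.range_orderEmbOfFin]; exact hk
  exact this

theorem eq_card_of_range {m n : ℕ} (e : Fin m ↪o Fin n) {S : Finset (Fin n)}
    (hS : ∀ k, k ∈ S ↔ ∃ i, e i = k) : m = S.card := by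
  have : S = Finset.univ.map e.toEmbedding := by
    ext k
    simp [hS]
  rw [this, Finset.card_map, Finset.card_univ, Fintype.card_fin]

theorem eq_enum {n : ℕ} {S : Finset (Fin n)} (e : Fin S.card ↪o Fin n)
    (hS : ∀ k, k ∈ S ↔ ∃ i, e i = k) : e = enum S :=
  Finset.orderEmbOfFin_unique' rfl fun i => (hS _).2 ⟨i, rfl⟩

/-- The pullback of a bi-non-crossing partition under an increasing map. -/
def BNC.comap {m n : ℕ} {χ : Fin n → Side} (π : BNC χ) (e : Fin m ↪o Fin n) :
    BNC (fun k => χ (e k)) :=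
  ⟨Setoid.comap e π.1, by
    have h : ∀ a b, Prec (fun k => χ (e k)) a b → Prec χ (e a) (e b) := by
      intro a b
      unfold Prec
      dsimp only
      cases χ (e a) <;> cases χ (e b) <;> simp
    intro u₁ v₁ u₂ v₂ h₁ h₂ h₃ hu hv
    exact π.2 _ _ _ _ (h _ _ h₁) (h _ _ h₂) (h _ _ h₃) hu hv⟩

/-- The elements of `V`, as elements of the renumbered set `S`. -/
def pull {n : ℕ} (S V : Finset (Fin n)) : Finset (Fin S.card) :=
  Finset.univ.filter fun i => enum S i ∈ V

theorem mem_pull {n : ℕ} {S V : Finset (Fin n)} {i : Fin S.card} :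
    i ∈ pull S V ↔ enum S i ∈ V := by
  simp [pull]

theorem enum_enum_range {n : ℕ} {S : Finset (Fin n)} (U : Finset (Fin S.card)) (k : Fin n) :
    k ∈ U.map (enum S).toEmbedding ↔ ∃ i, ((enum U).trans (enum S)) i = k := by
  simp only [Finset.mem_map, RelEmbedding.coe_toEmbedding, RelEmbedding.trans_apply]
  constructor
  · rintro ⟨a, ha, rfl⟩
    obtain ⟨i, rfl⟩ := exists_enum_eq ha
    exact ⟨i, rfl⟩
  · rintro ⟨i, rfl⟩
    exact ⟨_, enum_mem U i, rfl⟩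

theorem map_pull {n : ℕ} {S V : Finset (Fin n)} (h : V ⊆ S) :
    (pull S V).map (enum S).toEmbedding = V := by
  ext k
  simp only [Finset.mem_map, RelEmbedding.coe_toEmbedding, mem_pull]
  constructor
  · rintro ⟨a, ha, rfl⟩
    exact ha
  · intro hk
    obtain ⟨i, rfl⟩ := exists_enum_eq (h hk)
    exact ⟨i, hk, rfl⟩

theorem pull_nonempty {n : ℕ} {S V : Finset (Fin n)} (h : V ⊆ S) (hV : V.Nonempty) :
    (pull S V).Nonempty := by
  obtain ⟨v, hv⟩ := hV
  obtain ⟨i, rfl⟩ := exists_enum_eq (h hv)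
  exact ⟨i, mem_pull.2 hv⟩

section Space

variable {B A : Type*} [Ring B] [Algebra ℂ B] [Ring A] [Algebra ℂ A] {𝒜 : BBSpace B A}
  {n : ℕ} {χ : Fin n → Side}

/-- An iterated restriction enumerates a set by a composite of increasing maps, indexed by a
different `Fin`. Increasing enumerations are unique, and after substituting the equality of lengths
and then of maps, both sides agree definitionally; no transport of dependent tuples is needed. -/
theorem BiFun.eq_on_of_range (Φ : BiFun 𝒜) (π : BNC χ) (T : ∀ k, 𝒜.face (χ k)) {m : ℕ}
    (e : Fin m ↪o Fin n) {S : Finset (Fin n)} (hS : ∀ k, k ∈ S ↔ ∃ i, e i = k) :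
    Φ (fun k => χ (e k)) (π.comap e) (fun k => T (e k)) = Φ.on π T S := by
  obtain rfl := eq_card_of_range e hS
  obtain rfl := eq_enum e hS
  rfl

theorem BiFun.on_univ (Φ : BiFun 𝒜) (π : BNC χ) (T : ∀ k, 𝒜.face (χ k)) :
    Φ.on π T Finset.univ = Φ χ π T :=
  (Φ.eq_on_of_range π T (RelEmbedding.refl _) (by simp)).symm

theorem BiFun.on_map (Φ : BiFun 𝒜) (π : BNC χ) (T : ∀ k, 𝒜.face (χ k)) (S : Finset (Fin n))
    (U : Finset (Fin S.card)) :
    Φ.on (π.restrict S) (restrictTuple 𝒜 T S) U = Φ.on π T (U.map (enum S).toEmbedding) :=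
  Φ.eq_on_of_range π T ((enum U).trans (enum S)) (enum_enum_range U)

theorem BiFun.on_pull (Φ : BiFun 𝒜) (π : BNC χ) (T : ∀ k, 𝒜.face (χ k)) {S V : Finset (Fin n)}
    (h : V ⊆ S) : Φ.on (π.restrict S) (restrictTuple 𝒜 T S) (pull S V) = Φ.on π T V := by
  rw [Φ.on_map, map_pull h]

theorem BiFun.on_congr (Φ : BiFun 𝒜) (π : BNC χ) {T T' : ∀ k, 𝒜.face (χ k)} {S : Finset (Fin n)}
    (h : ∀ k ∈ S, T k = T' k) : Φ.on π T S = Φ.on π T' S := by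
  unfold BiFun.on
  congr 1
  funext k
  exact h _ (enum_mem S k)

theorem restrictTuple_insertAfter (T : ∀ k, 𝒜.face (χ k)) (S : Finset (Fin n)) (i : Fin S.card)
    (b : B) : restrictTuple 𝒜 (insertAfter T (enum S i) b) S =
      insertAfter (restrictTuple 𝒜 T S) i b := by
  funext k
  by_cases hk : k = i
  · subst hk
    simp only [restrictTuple, insertAfter, Function.update_self]
    rfl
  · rw [insertAfter_of_ne _ hk]
    exact insertAfter_of_ne _ (fun h => hk ((enum S).injective h)) _

theorem restrictTuple_insertBefore (T : ∀ k, 𝒜.face (χ k)) (S : Finset (Fin n)) (i : Fin S.card)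
    (b : B) : restrictTuple 𝒜 (insertBefore T (enum S i) b) S =
      insertBefore (restrictTuple 𝒜 T S) i b := by
  funext k
  by_cases hk : k = i
  · subst hk
    simp only [restrictTuple, insertBefore, Function.update_self]
    rfl
  · rw [insertBefore_of_ne _ hk]
    exact insertBefore_of_ne _ (fun h => hk ((enum S).injective h)) _

theorem BNC.restrict_eq_one {π : BNC χ} {S : Finset (Fin n)}
    (h : ∀ a ∈ S, ∀ a' ∈ S, π.1 a a') : π.restrict S = BNC.one (BiFree.restrict χ S) := by
  apply Subtype.ext
  apply Setoid.ext
  intro a b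
  exact ⟨fun _ => trivial, fun _ => h _ (enum_mem S a) _ (enum_mem S b)⟩

/-! ### The shift rules for full partitions -/

/-- The rules (i) and (ii), in terms of the order along the boundary: inserting an element of `B`
after an entry or before the next entry has the same effect, and an element inserted at either
end can be pulled out. -/
structure IsBalanced (Φ : BiFun 𝒜) : Prop where
  adjacent : ∀ ⦃n : ℕ⦄ (χ : Fin n → Side) (T : ∀ k, 𝒜.face (χ k)) (b : B) (θ γ : Fin n),
    pos χ θ < pos χ γ → (∀ k, pos χ k ≤ pos χ θ ∨ pos χ γ ≤ pos χ k) →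
    Φ χ (BNC.one χ) (insertAfter T θ b) = Φ χ (BNC.one χ) (insertBefore T γ b)
  first : ∀ ⦃n : ℕ⦄ (χ : Fin n → Side) (T : ∀ k, 𝒜.face (χ k)) (b : B) (γ : Fin n),
    (∀ k, pos χ γ ≤ pos χ k) →
    Φ χ (BNC.one χ) (insertBefore T γ b) = b * Φ χ (BNC.one χ) T
  last : ∀ ⦃n : ℕ⦄ (χ : Fin n → Side) (T : ∀ k, 𝒜.face (χ k)) (b : B) (θ : Fin n),
    (∀ k, pos χ k ≤ pos χ θ) →
    Φ χ (BNC.one χ) (insertAfter T θ b) = Φ χ (BNC.one χ) T * b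

/-- The rules (i) and (ii). -/
structure HasShiftRules (Φ : BiFun 𝒜) : Prop where
  prop_i : ∀ (n : ℕ) (χ : Fin (n + 1) → Side) (T : ∀ k, 𝒜.face (χ k)) (b : B) (q : Fin (n + 1)),
    IsGreatest {k | χ k ≠ χ (Fin.last n)} q →
    Φ χ (BNC.one χ)
        (Function.update T (Fin.last n) (T (Fin.last n) * 𝒜.op (χ (Fin.last n)) b)) =
      Φ χ (BNC.one χ) (Function.update T q (T q * 𝒜.op (χ q) b))
  prop_i_empty : ∀ (n : ℕ) (χ : Fin (n + 1) → Side) (T : ∀ k, 𝒜.face (χ k)) (b : B),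
    {k | χ k ≠ χ (Fin.last n)} = ∅ →
    Φ χ (BNC.one χ)
        (Function.update T (Fin.last n) (T (Fin.last n) * 𝒜.op (χ (Fin.last n)) b)) =
      match χ (Fin.last n) with
      | Side.left => Φ χ (BNC.one χ) T * b
      | Side.right => b * Φ χ (BNC.one χ) T
  prop_ii : ∀ (n : ℕ) (χ : Fin n → Side) (T : ∀ k, 𝒜.face (χ k)) (b : B) (p q : Fin n),
    IsGreatest {k | χ k = χ p ∧ k < p} q →
    Φ χ (BNC.one χ) (Function.update T p (𝒜.op (χ p) b * T p)) =
      Φ χ (BNC.one χ) (Function.update T q (T q * 𝒜.op (χ q) b))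
  prop_ii_empty : ∀ (n : ℕ) (χ : Fin n → Side) (T : ∀ k, 𝒜.face (χ k)) (b : B) (p : Fin n),
    {k | χ k = χ p ∧ k < p} = ∅ →
    Φ χ (BNC.one χ) (Function.update T p (𝒜.op (χ p) b * T p)) =
      match χ p with
      | Side.left => b * Φ χ (BNC.one χ) T
      | Side.right => Φ χ (BNC.one χ) T * b

theorem IsBiMultiplicative.hasShiftRules {Φ : BiFun 𝒜} (h : IsBiMultiplicative 𝒜 Φ) :
    HasShiftRules Φ :=
  ⟨h.prop_i, h.prop_i_empty, h.prop_ii, h.prop_ii_empty⟩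

theorem Side.eq_or_eq (s : Side) : s = Side.left ∨ s = Side.right := by cases s <;> simp

theorem Side.ne_left {s : Side} : s ≠ Side.left ↔ s = Side.right := by cases s <;> simp

theorem Side.ne_right {s : Side} : s ≠ Side.right ↔ s = Side.left := by cases s <;> simp

theorem insertAfter_of_left {T : ∀ k, 𝒜.face (χ k)} {a : Fin n} {b : B} (h : χ a = Side.left) :
    insertAfter T a b = Function.update T a (T a * 𝒜.op (χ a) b) := by
  rw [insertAfter, BBSpace.after_of_left h]

theorem insertAfter_of_right {T : ∀ k, 𝒜.face (χ k)} {a : Fin n} {b : B} (h : χ a = Side.right) :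
    insertAfter T a b = Function.update T a (𝒜.op (χ a) b * T a) := by
  rw [insertAfter, BBSpace.after_of_right h]

theorem insertBefore_of_left {T : ∀ k, 𝒜.face (χ k)} {a : Fin n} {b : B} (h : χ a = Side.left) :
    insertBefore T a b = Function.update T a (𝒜.op (χ a) b * T a) := by
  rw [insertBefore, BBSpace.before_of_left h]

theorem insertBefore_of_right {T : ∀ k, 𝒜.face (χ k)} {a : Fin n} {b : B}
    (h : χ a = Side.right) :
    insertBefore T a b = Function.update T a (T a * 𝒜.op (χ a) b) := by
  rw [insertBefore, BBSpace.before_of_right h]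

/-- Rule (ii) handles neighbours on the same side. Rule (i) handles the turn from the last left node
to the last right node, one of which is node n. The empty cases handle the two ends of the boundary.
-/
theorem HasShiftRules.isBalanced {Φ : BiFun 𝒜} (h : HasShiftRules Φ) : IsBalanced Φ where
  adjacent := by
    intro n χ T b θ γ hlt hadj
    cases hθ : χ θ <;> cases hγ : χ γ
    · rw [insertAfter_of_left hθ, insertBefore_of_left hγ]
      refine (h.prop_ii n χ T b γ θ ⟨⟨by rw [hθ, hγ], ?_⟩, ?_⟩).symm
      · rwa [pos_left hθ, pos_left hγ] at hlt
      · rintro k ⟨hk, hkγ⟩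
        have := hadj k
        rw [pos_left hθ, pos_left hγ, pos_left (hk.trans hγ)] at this
        rw [Fin.lt_def] at hkγ
        rw [Fin.le_def]
        omega
    · rw [insertAfter_of_left hθ, insertBefore_of_right hγ]
      obtain _ | n := n
      · exact θ.elim0
      have key : ∀ k, (χ k = Side.left → k ≤ θ) ∧ (χ k = Side.right → k ≤ γ) := by
        intro k
        have := hadj k
        rw [pos_left hθ, pos_right hγ] at this
        have hk := k.2
        have hθ' := θ.2
        have hγ' := γ.2
        constructor <;> intro h'
        · rw [pos_left h'] at this
          rw [Fin.le_def]
          omega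
        · rw [pos_right h'] at this
          rw [Fin.le_def]
          omega
      -- Adjacency across the sides makes θ the last left node and γ the last right node. The side
      -- of node n decides which of them it is, and rule (i) is read in one direction or the other.
      cases hl : χ (Fin.last n)
      · obtain rfl : θ = Fin.last n := le_antisymm (Fin.le_last _) ((key _).1 hl)
        refine h.prop_i n χ T b γ ⟨by simp [hl, hγ], fun k hk => (key k).2 ?_⟩
        rw [Set.mem_ofPred_eq, hl] at hk
        exact Side.ne_left.1 hk
      · obtain rfl : γ = Fin.last n := le_antisymm (Fin.le_last _) ((key _).2 hl)
        refine (h.prop_i n χ T b θ ⟨by simp [hl, hθ], fun k hk => (key k).1 ?_⟩).symm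
        rw [Set.mem_ofPred_eq, hl] at hk
        exact Side.ne_right.1 hk
    · have := θ.2
      have := γ.2
      rw [pos_right hθ, pos_left hγ] at hlt
      omega
    · rw [insertAfter_of_right hθ, insertBefore_of_right hγ]
      refine h.prop_ii n χ T b θ γ ⟨⟨by rw [hθ, hγ], ?_⟩, ?_⟩
      · rw [pos_right hθ, pos_right hγ] at hlt
        rw [Fin.lt_def]
        omega
      · rintro k ⟨hk, hkγ⟩
        have := hadj k
        rw [pos_right hθ, pos_right hγ, pos_right (hk.trans hθ)] at this
        rw [Fin.lt_def] at hkγ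
        rw [Fin.le_def]
        have := k.2
        have := θ.2
        have := γ.2
        omega
  first := by
    intro n χ T b γ hfirst
    cases hγ : χ γ
    · rw [insertBefore_of_left hγ, h.prop_ii_empty n χ T b γ, hγ]
      refine Set.eq_empty_iff_forall_notMem.2 ?_
      rintro k ⟨hk, hlt⟩
      have := hfirst k
      rw [pos_left hγ, pos_left (hk.trans hγ)] at this
      rw [Fin.lt_def] at hlt
      omega
    · rw [insertBefore_of_right hγ]
      obtain _ | n := n
      · exact γ.elim0
      -- A right node can be first along the boundary only if there are no left nodes; it is then
      -- the node n, and the empty case of (i) applies.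
      have key : ∀ k, χ k = Side.right ∧ k ≤ γ := by
        intro k
        have := hfirst k
        have hk := k.2
        have hγ' := γ.2
        rw [pos_right hγ] at this
        cases h' : χ k
        · rw [pos_left h'] at this
          omega
        · rw [pos_right h'] at this
          refine ⟨rfl, ?_⟩
          rw [Fin.le_def]
          omega
      obtain rfl : γ = Fin.last n := le_antisymm (Fin.le_last _) (key _).2
      rw [h.prop_i_empty n χ T b, hγ]
      refine Set.eq_empty_iff_forall_notMem.2 fun k hk => hk ?_
      rw [(key k).1, hγ]
  last := by
    intro n χ T b θ hlast
    cases hθ : χ θ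
    · rw [insertAfter_of_left hθ]
      obtain _ | n := n
      · exact θ.elim0
      have key : ∀ k, χ k = Side.left ∧ k ≤ θ := by
        intro k
        have := hlast k
        have hk := k.2
        have hθ' := θ.2
        rw [pos_left hθ] at this
        cases h' : χ k
        · rw [pos_left h'] at this
          exact ⟨rfl, this⟩
        · rw [pos_right h'] at this
          omega
      obtain rfl : θ = Fin.last n := le_antisymm (Fin.le_last _) (key _).2
      rw [h.prop_i_empty n χ T b, hθ]
      refine Set.eq_empty_iff_forall_notMem.2 fun k hk => hk ?_
      rw [(key k).1, hθ]
    · rw [insertAfter_of_right hθ, h.prop_ii_empty n χ T b θ, hθ]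
      refine Set.eq_empty_iff_forall_notMem.2 ?_
      rintro k ⟨hk, hlt⟩
      have := hlast k
      rw [pos_right hθ, pos_right (hk.trans hθ)] at this
      rw [Fin.lt_def] at hlt
      have := θ.2
      omega

theorem IsBalanced.hasShiftRules {Φ : BiFun 𝒜} (h : IsBalanced Φ) : HasShiftRules Φ where
  prop_i := by
    intro n χ T b q ⟨hq, hmax⟩
    have hql := Fin.le_last q
    rcases (χ (Fin.last n)).eq_or_eq with hl | hl
    · rw [Set.mem_ofPred_eq, hl] at hq
      have hq := Side.ne_left.1 hq
      rw [← insertBefore_of_right hq, ← insertAfter_of_left hl]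
      refine h.adjacent χ T b _ _ ?_ fun k => ?_
      · rw [pos_left hl, pos_right hq]
        have := q.2
        have := (Fin.last n).2
        omega
      · cases hk : χ k
        · left
          rw [pos_left hk, pos_left hl]
          exact Fin.le_last k
        · right
          have := hmax (show k ∈ {k | χ k ≠ χ (Fin.last n)} by simp [hk, hl])
          rw [pos_right hk, pos_right hq]
          rw [Fin.le_def] at this
          omega
    · rw [Set.mem_ofPred_eq, hl] at hq
      have hq := Side.ne_right.1 hq
      rw [← insertAfter_of_left hq, ← insertBefore_of_right hl]
      refine (h.adjacent χ T b _ _ ?_ fun k => ?_).symm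
      · rw [pos_left hq, pos_right hl]
        have := q.2
        have := (Fin.last n).2
        omega
      · cases hk : χ k
        · left
          have := hmax (show k ∈ {k | χ k ≠ χ (Fin.last n)} by simp [hk, hl])
          rw [pos_left hk, pos_left hq]
          exact this
        · right
          rw [pos_right hk, pos_right hl]
          have := Fin.le_last k
          rw [Fin.le_def] at this
          omega
  prop_i_empty := by
    intro n χ T b hemp
    have hall : ∀ k, χ k = χ (Fin.last n) := fun k => by
      by_contra hk
      exact (Set.eq_empty_iff_forall_notMem.1 hemp) k hk
    rcases (χ (Fin.last n)).eq_or_eq with hl | hl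
    · rw [← insertAfter_of_left hl, h.last, hl]
      intro k
      rw [pos_left hl, pos_left ((hall k).trans hl)]
      exact Fin.le_last k
    · rw [← insertBefore_of_right hl, h.first, hl]
      intro k
      rw [pos_right hl, pos_right ((hall k).trans hl)]
      have := Fin.le_last k
      rw [Fin.le_def] at this
      omega
  prop_ii := by
    intro n χ T b p q ⟨⟨hq, hqp⟩, hmax⟩
    rw [Fin.lt_def] at hqp
    have := p.2
    rcases (χ p).eq_or_eq with hp | hp
    · rw [hp] at hq
      rw [← insertBefore_of_left hp, ← insertAfter_of_left hq]
      refine (h.adjacent χ T b _ _ ?_ fun k => ?_).symm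
      · rwa [pos_left hq, pos_left hp]
      · cases hk : χ k
        · by_cases hkp : k < p
          · have := hmax (show k ∈ {k | χ k = χ p ∧ k < p} from ⟨by rw [hk, hp], hkp⟩)
            rw [pos_left hk, pos_left hq]
            exact Or.inl this
          · rw [pos_left hk, pos_left hp]
            exact Or.inr (not_lt.1 hkp)
        · right
          rw [pos_right hk, pos_left hp]
          have := k.2
          omega
    · rw [hp] at hq
      rw [← insertAfter_of_right hp, ← insertBefore_of_right hq]
      refine h.adjacent χ T b _ _ ?_ fun k => ?_
      · rw [pos_right hq, pos_right hp]
        omega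
      · cases hk : χ k
        · left
          rw [pos_left hk, pos_right hp]
          have := k.2
          omega
        · rw [pos_right hk, pos_right hq, pos_right hp]
          by_cases hkp : k < p
          · have := hmax (show k ∈ {k | χ k = χ p ∧ k < p} from ⟨by rw [hk, hp], hkp⟩)
            rw [Fin.le_def] at this
            omega
          · rw [Fin.lt_def] at hkp
            omega
  prop_ii_empty := by
    intro n χ T b p hemp
    have hall : ∀ k, χ k = χ p → p ≤ k := fun k hk => by
      by_contra hlt
      exact (Set.eq_empty_iff_forall_notMem.1 hemp) k ⟨hk, not_le.1 hlt⟩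
    have := p.2
    rcases (χ p).eq_or_eq with hp | hp
    · rw [← insertBefore_of_left hp, h.first, hp]
      intro k
      cases hk : χ k
      · rw [pos_left hk, pos_left hp]
        exact hall k (by rw [hk, hp])
      · rw [pos_right hk, pos_left hp]
        have := k.2
        omega
    · rw [← insertAfter_of_right hp, h.last, hp]
      intro k
      cases hk : χ k
      · rw [pos_left hk, pos_right hp]
        have := k.2
        omega
      · rw [pos_right hk, pos_right hp]
        have := hall k (by rw [hk, hp])
        rw [Fin.le_def] at this
        omega

end Space

/-! ### The block with the largest minimum -/

theorem exists_isGreatest_min {n : ℕ} (π : Setoid (Fin n)) {S : Finset (Fin n)}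
    (hS : S.Nonempty) : ∃ m, IsGreatest {a | a ∈ S ∧ ∀ c ∈ S, π a c → a ≤ c} m := by
  have hne : ({a | a ∈ S ∧ ∀ c ∈ S, π a c → a ≤ c} : Set (Fin n)).Nonempty := by
    obtain ⟨a, ha, hmin⟩ := S.exists_min_image id hS
    exact ⟨a, ha, fun c hc _ => hmin c hc⟩
  obtain ⟨m, hm, hmax⟩ := Set.exists_max_image _ id (Set.toFinite _) hne
  exact ⟨m, hm, fun a ha => hmax a ha⟩

theorem exists_min_of_block {n : ℕ} (π : Setoid (Fin n)) {S : Finset (Fin n)} {s : Fin n}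
    (hs : s ∈ S) : ∃ a ∈ S, π s a ∧ ∀ c ∈ S, π a c → a ≤ c := by
  classical
  obtain ⟨a, ha, hmin⟩ := (S.filter fun a => π s a).exists_min_image id
    ⟨s, Finset.mem_filter.2 ⟨hs, π.refl s⟩⟩
  rw [Finset.mem_filter] at ha
  exact ⟨a, ha.1, ha.2, fun c hc hac =>
    hmin c (Finset.mem_filter.2 ⟨hc, π.trans ha.2 hac⟩)⟩

open Classical in
/-- The block with the largest minimum is an interval along the boundary. -/
theorem isGap_block {n : ℕ} {χ : Fin n → Side} {π : Setoid (Fin n)} (hπ : BiNonCrossing χ π)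
    {S : Finset (Fin n)} {m : Fin n}
    (hm : IsGreatest {a | a ∈ S ∧ ∀ c ∈ S, π a c → a ≤ c} m) :
    IsGap χ S (S.filter fun c => π m c) (pos χ m) := by
  refine ⟨Finset.filter_subset _ _, fun s hs hsV v hv => ?_⟩
  obtain ⟨⟨hmS, hmin⟩, hmax⟩ := hm
  rw [Finset.mem_filter] at hv hsV
  have hsm : ¬ π m s := fun h => hsV ⟨hs, h⟩
  have hmv := hmin v hv.1 hv.2
  -- The block of s starts at a, and a is strictly smaller than m by maximality of m.
  obtain ⟨a, ha, hsa, hamin⟩ := exists_min_of_block π hs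
  have ham : a ≤ m := hmax ⟨ha, hamin⟩
  have hne : a ≠ m := by
    rintro rfl
    exact hsm (π.symm hsa)
  have hne' : s ≠ v := by
    rintro rfl
    exact hsm hv.2
  have hne'' : pos χ s ≠ pos χ v := fun h => hne' (pos_injective χ h)
  -- A node above m in the diagram is outermost: on the left it precedes, and on the right it
  -- follows, every node from m on.
  have hout : ∀ x y : Fin n, x < m → m ≤ y →
      (χ x = Side.left → pos χ x < pos χ y) ∧ (χ x = Side.right → pos χ y < pos χ x) := by
    intro x y hx hy
    rw [Fin.lt_def] at hx
    rw [Fin.le_def] at hy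
    have := x.2
    have := y.2
    constructor <;> intro h
    · rw [pos_left h]
      rcases (χ y).eq_or_eq with h' | h'
      · rw [pos_left h']; omega
      · rw [pos_right h']; omega
    · rw [pos_right h]
      rcases (χ y).eq_or_eq with h' | h'
      · rw [pos_left h']; omega
      · rw [pos_right h']; omega
  rcases lt_or_ge s m with hlt | hge
  · have h₁ := hout s m hlt le_rfl
    have h₂ := hout s v hlt hmv
    rcases (χ s).eq_or_eq with h | h
    · have := h₁.1 h
      have := h₂.1 h
      omega
    · have := h₁.2 h
      have := h₂.2 h
      omega
  -- If s were between m and v along the boundary, then the pair s, a, with a outside on one side,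
  -- would cross the pair m, v.
  · have ham' := lt_of_le_of_ne ham hne
    have a₁ := hout a m ham' le_rfl
    have a₂ := hout a v ham' hmv
    have a₃ := hout a s ham' hge
    constructor
    · intro hlt
      by_contra hcon
      rcases (χ a).eq_or_eq with h | h
      · exact hsm (π.symm (π.trans hsa (hπ a v s m (prec_iff_pos.2 (a₂.1 h))
          (prec_iff_pos.2 (by omega)) (prec_iff_pos.2 hlt) (π.symm hsa) (π.symm hv.2)
          |> fun h => π.trans h (π.symm hv.2))))
      · exact hsm (π.trans hv.2 (hπ v s m a (prec_iff_pos.2 (by omega)) (prec_iff_pos.2 hlt)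
          (prec_iff_pos.2 (a₁.2 h)) (π.symm hv.2) hsa))
    · intro hle
      have hms : pos χ m ≠ pos χ s := fun h => hsm (by
        rw [pos_injective χ h])
      by_contra hcon
      rcases (χ a).eq_or_eq with h | h
      · exact hsm (π.symm (π.trans hsa (hπ a m s v (prec_iff_pos.2 (a₁.1 h))
          (prec_iff_pos.2 (by omega)) (prec_iff_pos.2 (by omega)) (π.symm hsa) hv.2)))
      · exact hsm (hπ m s v a (prec_iff_pos.2 (by omega)) (prec_iff_pos.2 (by omega))
          (prec_iff_pos.2 (a₂.2 h)) hv.2 hsa)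

open Classical in
theorem isSaturated_block {n : ℕ} (π : Setoid (Fin n)) (S : Finset (Fin n)) (m : Fin n) :
    IsSaturated π S (S.filter fun c => π m c) := by
  intro a ha b hb hab
  rw [Finset.mem_filter] at ha ⊢
  exact ⟨hb, π.trans ha.2 hab⟩

section Space

variable {B A : Type*} [Ring B] [Algebra ℂ B] [Ring A] [Algebra ℂ A] {𝒜 : BBSpace B A}
  {n : ℕ} {χ : Fin n → Side}

/-! ### Factorization over two intervals and over nested intervals -/

/-- The rule (iii) for two intervals. -/
def IsFactorizing (Φ : BiFun 𝒜) : Prop :=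
  ∀ ⦃n : ℕ⦄ (χ : Fin n → Side) (π : BNC χ) (T : ∀ k, 𝒜.face (χ k)) (V W : Finset (Fin n)),
    V.Nonempty → W.Nonempty → Disjoint V W → V ∪ W = Finset.univ → IsUnionOfBlocks π.1 V →
    (∀ a ∈ V, ∀ b ∈ W, pos χ a < pos χ b) → Φ χ π T = Φ.on π T V * Φ.on π T W

theorem IsBiMultiplicative.isFactorizing {Φ : BiFun 𝒜} (h : IsBiMultiplicative 𝒜 Φ) :
    IsFactorizing Φ := by
  intro n χ π T V W hV hW hd hu hπ hlt
  have hn : 0 < n := hV.choose.pos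
  have hmem : ∀ k, k ∈ V ∨ k ∈ W := fun k => by
    rw [← Finset.mem_union, hu]; exact Finset.mem_univ k
  rw [h.prop_iii n χ π T 2 ![V, W] hn]
  · simp
  · intro i
    fin_cases i
    · exact hV
    · exact hW
  · intro k
    rcases hmem k with hk | hk
    · refine ⟨0, hk, fun i hi => ?_⟩
      fin_cases i
      · rfl
      · exact absurd hi (Finset.disjoint_left.1 hd hk)
    · refine ⟨1, hk, fun i hi => ?_⟩
      fin_cases i
      · exact absurd hk (Finset.disjoint_left.1 hd hi)
      · rfl
  · intro i
    fin_cases i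
    · intro a _ c hc b _ h₂
      rcases hmem b with hb | hb
      · exact hb
      · have := hlt c hc b hb
        rw [prec_iff_pos] at h₂
        omega
    · intro a ha c _ b h₁ _
      rcases hmem b with hb | hb
      · have := hlt b hb a ha
        rw [prec_iff_pos] at h₁
        omega
      · exact hb
  · intro i
    fin_cases i
    · exact hπ
    · exact hπ.of_disjoint_union hd hu
  · intro i j hij a ha b hb
    fin_cases i <;> fin_cases j
    · exact absurd hij (lt_irrefl _)
    · exact prec_iff_pos.2 (hlt a ha b hb)
    · exact absurd hij (by simp)
    · exact absurd hij (lt_irrefl _)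

theorem IsFactorizing.on_eq {Φ : BiFun 𝒜} (h : IsFactorizing Φ) (π : BNC χ)
    (T : ∀ k, 𝒜.face (χ k)) {S V W : Finset (Fin n)} (hV : V.Nonempty) (hW : W.Nonempty)
    (hd : Disjoint V W) (hu : V ∪ W = S) (hπ : IsSaturated π.1 S V)
    (hlt : ∀ a ∈ V, ∀ b ∈ W, pos χ a < pos χ b) :
    Φ.on π T S = Φ.on π T V * Φ.on π T W := by
  have hVS : V ⊆ S := hu ▸ Finset.subset_union_left
  have hWS : W ⊆ S := hu ▸ Finset.subset_union_right
  rw [← Φ.on_pull π T hVS, ← Φ.on_pull π T hWS]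
  refine h _ _ _ _ _ (pull_nonempty hVS hV) (pull_nonempty hWS hW) ?_ ?_ ?_ ?_
  · rw [Finset.disjoint_left]
    intro i hi hi'
    exact Finset.disjoint_left.1 hd (mem_pull.1 hi) (mem_pull.1 hi')
  · ext i
    simp only [Finset.mem_union, mem_pull, Finset.mem_univ, iff_true]
    rw [← Finset.mem_union, hu]
    exact enum_mem S i
  · intro a b hab ha
    exact mem_pull.2 (hπ _ (mem_pull.1 ha) _ (enum_mem S b) hab)
  · intro a ha b hb
    exact (pos_enum_lt χ S a b).2 (hlt _ (mem_pull.1 ha) _ (mem_pull.1 hb))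

theorem IsFactorizing.on_biUnion {Φ : BiFun 𝒜} (h : IsFactorizing Φ) (π : BNC χ)
    (T : ∀ k, 𝒜.face (χ k)) : ∀ (m : ℕ) (V : Fin (m + 1) → Finset (Fin n)),
    (∀ i, (V i).Nonempty) → (∀ i, IsUnionOfBlocks π.1 (V i)) →
    (∀ i j, i < j → ∀ a ∈ V i, ∀ b ∈ V j, pos χ a < pos χ b) →
    Φ.on π T (Finset.univ.biUnion V) = (List.ofFn fun i => Φ.on π T (V i)).prod := by
  intro m
  induction m with
  | zero =>
    intro V _ _ _
    simp
  | succ m ih =>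
    intro V hne hπ hlt
    have hlt' : ∀ a ∈ V 0, ∀ b ∈ Finset.univ.biUnion fun i : Fin (m + 1) => V i.succ,
        pos χ a < pos χ b := by
      intro a ha b hb
      obtain ⟨i, -, hi⟩ := Finset.mem_biUnion.1 hb
      exact hlt 0 i.succ (Fin.succ_pos i) a ha b hi
    rw [List.ofFn_succ, List.prod_cons, ← ih (fun i => V i.succ) (fun i => hne _) (fun i => hπ _)
      fun i j hij => hlt _ _ (Fin.succ_lt_succ_iff.2 hij)]
    refine h.on_eq π T (hne 0) ?_ ?_ ?_ ?_ hlt'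
    · obtain ⟨v, hv⟩ := hne (Fin.succ 0)
      exact ⟨v, Finset.mem_biUnion.2 ⟨0, Finset.mem_univ _, hv⟩⟩
    · rw [Finset.disjoint_left]
      intro a ha ha'
      exact lt_irrefl _ (hlt' a ha a ha')
    · ext k
      simp only [Finset.mem_union, Finset.mem_biUnion, Finset.mem_univ, true_and]
      exact (Fin.exists_fin_succ (P := fun i => k ∈ V i)).symm
    · intro a ha b _ hab
      exact hπ 0 a b hab ha

theorem IsFactorizing.prop_iii {Φ : BiFun 𝒜} (h : IsFactorizing Φ) (π : BNC χ)
    (T : ∀ k, 𝒜.face (χ k)) {m : ℕ} (V : Fin m → Finset (Fin n)) (hn : 0 < n)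
    (hne : ∀ i, (V i).Nonempty) (hu : ∀ k, ∃! i, k ∈ V i) (hπ : ∀ i, IsUnionOfBlocks π.1 (V i))
    (hlt : ∀ i j, i < j → ∀ a ∈ V i, ∀ b ∈ V j, Prec χ a b) :
    Φ χ π T = (List.ofFn fun i => Φ.on π T (V i)).prod := by
  obtain _ | m := m
  · exact ((hu ⟨0, hn⟩).exists.choose).elim0
  have huniv : Finset.univ.biUnion V = Finset.univ := by
    ext k
    simpa using (hu k).exists
  rw [← h.on_biUnion π T m V hne hπ fun i j hij a ha b hb => prec_iff_pos.1 (hlt i j hij a ha b hb),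
    huniv, Φ.on_univ]

/-- The rule (iv). -/
def IsNesting (Φ : BiFun 𝒜) : Prop :=
  ∀ ⦃n : ℕ⦄ (χ : Fin n → Side) (π : BNC χ) (T : ∀ k, 𝒜.face (χ k))
    (V W : Finset (Fin n)) (p : ℕ) (θ γ : Fin n), V.Nonempty →
    Disjoint V W → V ∪ W = Finset.univ → IsUnionOfBlocks π.1 V → IsGap χ Finset.univ V p →
    IsPred χ W p θ → IsSucc χ W p γ →
    Φ χ π T = Φ.on π (insertAfter T θ (Φ.on π T V)) W ∧
      Φ χ π T = Φ.on π (insertBefore T γ (Φ.on π T V)) W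

theorem isFirst_iff {S : Set (Fin n)} {a : Fin n} :
    IsFirst χ S a ↔ a ∈ S ∧ ∀ b ∈ S, pos χ a ≤ pos χ b := by
  refine and_congr_right fun ha => forall₂_congr fun b hb => ?_
  rw [prec_iff_pos]
  constructor
  · intro h
    by_cases hba : b = a
    · rw [hba]
    · exact (h hba).le
  · intro h hba
    exact lt_of_le_of_ne h fun h' => hba (pos_injective χ h').symm

theorem isLast_iff {S : Set (Fin n)} {a : Fin n} :
    IsLast χ S a ↔ a ∈ S ∧ ∀ b ∈ S, pos χ b ≤ pos χ a := by
  refine and_congr_right fun ha => forall₂_congr fun b hb => ?_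
  rw [prec_iff_pos]
  constructor
  · intro h
    by_cases hba : b = a
    · rw [hba]
    · exact (h hba).le
  · intro h hba
    exact lt_of_le_of_ne h fun h' => hba (pos_injective χ h')

/-- A gap with neighbours θ and γ in W on both sides encodes the hypotheses of (iv): the two ends of
the boundary cannot lie in V, and θ and γ are also the neighbours of the first and last elements of
V. -/
theorem IsBiMultiplicative.isNesting {Φ : BiFun 𝒜} (h : IsBiMultiplicative 𝒜 Φ) :
    IsNesting Φ := by
  rintro n χ π T V W p θ γ hV hd hu hπ ⟨-, hgap⟩ hθ hγ
  have hW : ∀ k, k ∈ W ↔ k ∉ V := fun k => by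
    constructor
    · exact fun hk hk' => Finset.disjoint_left.1 hd hk' hk
    · intro hk
      have : k ∈ V ∪ W := hu ▸ Finset.mem_univ k
      exact (Finset.mem_union.1 this).resolve_left hk
  replace hgap := fun s hs v hv => hgap s (Finset.mem_univ s) hs v hv
  obtain ⟨v₀, hv₀, hmin⟩ := V.exists_min_image (pos χ) hV
  obtain ⟨v₁, hv₁, hmax⟩ := V.exists_max_image (pos χ) hV
  have hθV := (hW θ).1 hθ.1
  have hγV := (hW γ).1 hγ.1
  refine h.prop_iv n χ π T V W v₀ v₁ θ γ hd hu hπ (hπ.of_disjoint_union hd hu) ?_ ?_ ?_ ?_ ?_ ?_ ?_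
  · intro a ha c hc b hab hbc
    by_contra hb
    rw [prec_iff_pos] at hab hbc
    have := hgap b hb a ha
    have := hgap b hb c hc
    omega
  · intro k hk
    rw [hW]
    intro hkV
    have := (isFirst_iff.1 hk).2 θ trivial
    have := hgap θ hθV k hkV
    have := hθ.2.1
    omega
  · intro k hk
    rw [hW]
    intro hkV
    have := (isLast_iff.1 hk).2 γ trivial
    have := hgap γ hγV k hkV
    have := hγ.2.1
    omega
  · exact isFirst_iff.2 ⟨hv₀, hmin⟩
  · exact isLast_iff.2 ⟨hv₁, hmax⟩
  · refine isLast_iff.2 ⟨⟨hθ.1, prec_iff_pos.2 ((hgap θ hθV v₀ hv₀).1 hθ.2.1)⟩, ?_⟩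
    rintro k ⟨hk, hkv⟩
    rw [prec_iff_pos] at hkv
    have := hgap k ((hW k).1 hk) v₀ hv₀
    exact hθ.2.2 k hk (by omega)
  · refine isFirst_iff.2 ⟨⟨hγ.1, prec_iff_pos.2 ((hgap γ hγV v₁ hv₁).2 hγ.2.1)⟩, ?_⟩
    rintro k ⟨hk, hkv⟩
    rw [prec_iff_pos] at hkv
    have := hgap k ((hW k).1 hk) v₁ hv₁
    exact hγ.2.2 k hk (by omega)

theorem IsNesting.prop_iv {Φ : BiFun 𝒜} (h : IsNesting Φ) (π : BNC χ) (T : ∀ k, 𝒜.face (χ k))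
    {V W : Finset (Fin n)} {v₀ v₁ θ γ : Fin n} (hd : Disjoint V W) (hu : V ∪ W = Finset.univ)
    (hπ : IsUnionOfBlocks π.1 V) (hV : IsChiInterval χ V) (hv₀ : IsFirst χ V v₀)
    (hv₁ : IsLast χ V v₁) (hθ : IsLast χ {k | k ∈ W ∧ Prec χ k v₀} θ)
    (hγ : IsFirst χ {k | k ∈ W ∧ Prec χ v₁ k} γ) :
    Φ χ π T = Φ.on π (insertAfter T θ (Φ.on π T V)) W ∧
      Φ χ π T = Φ.on π (insertBefore T γ (Φ.on π T V)) W := by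
  rw [isLast_iff] at hθ hv₁
  rw [isFirst_iff] at hγ hv₀
  obtain ⟨⟨hθW, hθv⟩, hθmax⟩ := hθ
  obtain ⟨⟨hγW, hγv⟩, hγmin⟩ := hγ
  have hsep : ∀ s ∉ V, ∀ v ∈ V, (pos χ s < pos χ v₀ ∧ pos χ s < pos χ v) ∨
      (pos χ v₁ < pos χ s ∧ pos χ v < pos χ s) := by
    intro s hs v hv
    have a₁ := hv₀.2 v hv
    have a₂ := hv₁.2 v hv
    by_contra hcon
    have a₃ : pos χ s ≠ pos χ v₀ := fun h => hs (pos_injective χ h ▸ hv₀.1)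
    have a₄ : pos χ s ≠ pos χ v₁ := fun h => hs (pos_injective χ h ▸ hv₁.1)
    exact hs (hV v₀ hv₀.1 v₁ hv₁.1 s (prec_iff_pos.2 (by omega)) (prec_iff_pos.2 (by omega)))
  have hWV : ∀ s ∈ W, s ∉ V := fun s hs hs' => Finset.disjoint_left.1 hd hs' hs
  have h01 := hv₀.2 v₁ hv₁.1
  refine h χ π T V W (pos χ v₀) θ γ ⟨v₀, hv₀.1⟩ hd hu hπ ⟨Finset.subset_univ _, ?_⟩
    ⟨hθW, prec_iff_pos.1 hθv, fun k hk hkv => hθmax k ⟨hk, prec_iff_pos.2 hkv⟩⟩ ⟨hγW, ?_, ?_⟩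
  · intro s _ hs v hv
    have := hsep s hs v hv
    omega
  · have := prec_iff_pos.1 hγv
    omega
  · intro k hk hkv
    have := hsep k (hWV k hk) v₀ hv₀.1
    exact hγmin k ⟨hk, prec_iff_pos.2 (by omega)⟩

theorem IsNesting.on_eq {Φ : BiFun 𝒜} (h : IsNesting Φ) (π : BNC χ) (T : ∀ k, 𝒜.face (χ k))
    {S V : Finset (Fin n)} {p : ℕ} {θ γ : Fin n} (hVn : V.Nonempty) (hV : IsGap χ S V p)
    (hπ : IsSaturated π.1 S V) (hθ : IsPred χ (S \ V) p θ) (hγ : IsSucc χ (S \ V) p γ) :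
    Φ.on π T S = Φ.on π (insertAfter T θ (Φ.on π T V)) (S \ V) ∧
      Φ.on π T S = Φ.on π (insertBefore T γ (Φ.on π T V)) (S \ V) := by
  obtain ⟨i, rfl⟩ := exists_enum_eq (Finset.mem_sdiff.1 hθ.1).1
  obtain ⟨j, rfl⟩ := exists_enum_eq (Finset.mem_sdiff.1 hγ.1).1
  have hWS : S \ V ⊆ S := Finset.sdiff_subset
  -- Renumbering changes positions, so the cut p has no meaning inside S. The cut directly after the
  -- predecessor i divides the renumbered complement of V in the same way.
  have hcut : ∀ k, enum S k ∉ V → (pos (restrict χ S) k < pos (restrict χ S) i + 1 ↔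
      pos χ (enum S k) < p) := fun k hk => by
    have h₁ := pos_enum_le χ S k i
    have h₂ := hθ.2.2 _ (Finset.mem_sdiff.2 ⟨enum_mem S k, hk⟩)
    have h₃ := hθ.2.1
    omega
  have hlt := pos_enum_lt χ S
  have hle := pos_enum_le χ S
  have key := h (restrict χ S) (π.restrict S) (restrictTuple 𝒜 T S) (pull S V) (pull S (S \ V))
    (pos (restrict χ S) i + 1) i j (pull_nonempty hV.1 hVn) ?_ ?_ ?_ ?_ ?_ ?_
  · rw [Φ.on_pull π T hV.1, ← restrictTuple_insertAfter, ← restrictTuple_insertBefore,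
      Φ.on_pull π _ hWS, Φ.on_pull π _ hWS] at key
    exact key
  · rw [Finset.disjoint_left]
    intro k hk hk'
    exact (Finset.mem_sdiff.1 (mem_pull.1 hk')).2 (mem_pull.1 hk)
  · ext k
    simp only [Finset.mem_union, mem_pull, Finset.mem_sdiff, enum_mem, Finset.mem_univ]
    tauto
  · intro a b hab ha
    exact mem_pull.2 (hπ _ (mem_pull.1 ha) _ (enum_mem S b) hab)
  · refine ⟨Finset.subset_univ _, fun s _ hs v hv => ?_⟩
    rw [mem_pull] at hs hv
    have h₁ := hcut s hs
    have h₂ := hV.2 _ (enum_mem S s) hs _ hv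
    have h₃ := hlt s v
    have h₄ := hlt v s
    omega
  · refine ⟨mem_pull.2 hθ.1, Nat.lt_succ_self _, fun k _ hk => Nat.lt_succ_iff.1 hk⟩
  · refine ⟨mem_pull.2 hγ.1, ?_, fun k hk hkp => ?_⟩
    · have h₁ := hcut j (Finset.mem_sdiff.1 hγ.1).2
      have h₂ := hγ.2.1
      omega
    · have hk' := mem_pull.1 hk
      have h₁ := hcut k (Finset.mem_sdiff.1 hk').2
      exact (hle j k).2 (hγ.2.2 _ hk' (by omega))

/-! ### Bi-multiplicative functions are balanced at all partitions -/

/-- The family of the functions `Φ_{π|_S}`, with the value `1` for `S = ∅`. -/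
noncomputable def BiFun.family (Φ : BiFun 𝒜) (π : BNC χ) : Family 𝒜 χ :=
  fun S T => if S = ∅ then 1 else Φ.on π T S

theorem BiFun.family_of_nonempty (Φ : BiFun 𝒜) (π : BNC χ) {S : Finset (Fin n)}
    (hS : S.Nonempty) (T : ∀ k, 𝒜.face (χ k)) : Φ.family π S T = Φ.on π T S :=
  if_neg hS.ne_empty

theorem IsBalanced.family_single {Φ : BiFun 𝒜} (h : IsBalanced Φ) (π : BNC χ)
    {S : Finset (Fin n)} (hS : S.Nonempty) (hπ : ∀ a ∈ S, ∀ a' ∈ S, π.1 a a')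
    (T : ∀ k, 𝒜.face (χ k)) (p : ℕ) (b : B) :
    insL (Φ.family π) S p b T = insR (Φ.family π) S p b T := by
  by_cases hl : ∃ k ∈ S, pos χ k < p
  · obtain ⟨k, hk, hkp⟩ := hl
    obtain ⟨θ, hθ⟩ := exists_isPred hk hkp
    obtain ⟨i, rfl⟩ := exists_enum_eq hθ.1
    rw [insL_of_isPred hθ, Φ.family_of_nonempty π hS, BiFun.on, restrictTuple_insertAfter,
      BNC.restrict_eq_one hπ]
    by_cases hr : ∃ k ∈ S, p ≤ pos χ k
    · obtain ⟨k, hk, hkp⟩ := hr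
      obtain ⟨γ, hγ⟩ := exists_isSucc hk hkp
      obtain ⟨j, rfl⟩ := exists_enum_eq hγ.1
      rw [insR_of_isSucc hγ, Φ.family_of_nonempty π hS, BiFun.on, restrictTuple_insertBefore,
        BNC.restrict_eq_one hπ]
      refine h.adjacent _ _ _ _ _ ?_ fun k => ?_
      · rw [pos_enum_lt]
        have := hθ.2.1
        have := hγ.2.1
        omega
      · rw [pos_enum_le, pos_enum_le]
        have := hθ.2.2 _ (enum_mem S k)
        have := hγ.2.2 _ (enum_mem S k)
        omega
    · push Not at hr
      rw [insR_of_forall hr, Φ.family_of_nonempty π hS, BiFun.on, BNC.restrict_eq_one hπ]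
      refine h.last _ _ _ _ fun k => ?_
      rw [pos_enum_le]
      exact hθ.2.2 _ (enum_mem S k) (hr _ (enum_mem S k))
  · push Not at hl
    obtain ⟨k, hk⟩ := hS
    obtain ⟨γ, hγ⟩ := exists_isSucc hk (hl k hk)
    obtain ⟨j, rfl⟩ := exists_enum_eq hγ.1
    rw [insL_of_forall hl, insR_of_isSucc hγ, Φ.family_of_nonempty π ⟨k, hk⟩,
      Φ.family_of_nonempty π ⟨k, hk⟩, BiFun.on, BiFun.on, restrictTuple_insertBefore,
      BNC.restrict_eq_one hπ]
    refine (h.first _ _ _ _ fun k => ?_).symm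
    rw [pos_enum_le]
    exact hγ.2.2 _ (enum_mem S k) (hl _ (enum_mem S k))

theorem BiFun.family_empty (Φ : BiFun 𝒜) (π : BNC χ) (T : ∀ k, 𝒜.face (χ k)) :
    Φ.family π ∅ T = 1 := if_pos rfl

theorem BiFun.family_congr (Φ : BiFun 𝒜) (π : BNC χ) (S : Finset (Fin n))
    (T T' : ∀ k, 𝒜.face (χ k)) (h : ∀ k ∈ S, T k = T' k) : Φ.family π S T = Φ.family π S T' := by
  unfold BiFun.family
  rw [Φ.on_congr π h]

open Classical in
-- The removable block is the one with the largest minimum. If the remaining nodes lie on both sides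
-- of it, the reduction is the nesting rule; if they lie on one side only, it is the factorization
-- into two intervals.
theorem isEvaluation_family {Φ : BiFun 𝒜} (hb : IsBalanced Φ) (hf : IsFactorizing Φ)
    (hn : IsNesting Φ) (π : BNC χ) : IsEvaluation π.1 (Φ.family π) where
  empty := Φ.family_empty π
  congr := Φ.family_congr π
  single := fun _ T p b hS hπ => hb.family_single π hS hπ T p b
  reduce := by
    intro S hS
    have hSn : S.Nonempty := by
      by_contra h
      rw [Finset.not_nonempty_iff_eq_empty] at h
      exact hS (by simp [h])
    obtain ⟨m, hm⟩ := exists_isGreatest_min π.1 hSn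
    have hgap := isGap_block π.2 hm
    have hsat := isSaturated_block π.1 S m
    have hcl : ∀ a ∈ S.filter fun c => π.1 m c, ∀ a' ∈ S.filter fun c => π.1 m c, π.1 a a' :=
      fun a ha a' ha' => π.1.trans (π.1.symm (Finset.mem_filter.1 ha).2) (Finset.mem_filter.1 ha').2
    have hmV : m ∈ S.filter fun c => π.1 m c := Finset.mem_filter.2 ⟨hm.1.1, π.1.refl m⟩
    generalize (S.filter fun c => π.1 m c) = V at hgap hsat hcl hmV
    have hVS : V ≠ S := fun h => hS (h ▸ hcl)
    have hVn : V.Nonempty := ⟨m, hmV⟩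
    have hWn : (S \ V).Nonempty :=
      Finset.sdiff_nonempty.2 fun h => hVS (Finset.Subset.antisymm hgap.1 h)
    refine ⟨V, pos χ m, hVn, hVS, hgap, hsat, hcl, fun T => ?_⟩
    by_cases hl : ∃ k ∈ S \ V, pos χ k < pos χ m
    · by_cases hr : ∃ k ∈ S \ V, pos χ m ≤ pos χ k
      · left
        obtain ⟨k, hk, hkp⟩ := hl
        obtain ⟨θ, hθ⟩ := exists_isPred hk hkp
        obtain ⟨k', hk', hkp'⟩ := hr
        obtain ⟨γ, hγ⟩ := exists_isSucc hk' hkp'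
        rw [insL_of_isPred hθ, Φ.family_of_nonempty π hSn, Φ.family_of_nonempty π hVn,
          Φ.family_of_nonempty π hWn]
        exact (hn.on_eq π T hVn hgap hsat hθ hγ).1
      · right
        push Not at hr
        rw [insR_of_forall hr, Φ.family_of_nonempty π hSn, Φ.family_of_nonempty π hVn,
          Φ.family_of_nonempty π hWn]
        refine hf.on_eq π T hWn hVn Finset.sdiff_disjoint (Finset.sdiff_union_of_subset hgap.1)
          ?_ ?_
        · intro a ha b hb hab
          rw [Finset.mem_sdiff] at ha ⊢
          exact ⟨hb, fun h => ha.2 (hsat b h a ha.1 (π.1.symm hab))⟩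
        · intro a ha b hb
          have ha' := Finset.mem_sdiff.1 ha
          exact (hgap.2 a ha'.1 ha'.2 b hb).1 (hr a ha)
    · left
      push Not at hl
      rw [insL_of_forall hl, Φ.family_of_nonempty π hSn, Φ.family_of_nonempty π hVn,
        Φ.family_of_nonempty π hWn]
      refine hf.on_eq π T hVn hWn Finset.disjoint_sdiff (Finset.union_sdiff_of_subset hgap.1)
        hsat ?_
      intro a ha b hb
      have hb' := Finset.mem_sdiff.1 hb
      exact (hgap.2 b hb'.1 hb'.2 a ha).2 (hl b hb)

/-- The rules (i) and (ii), for arbitrary partitions. -/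
theorem balanced_of_isEvaluation {Φ : BiFun 𝒜} {π : BNC χ}
    (h : IsEvaluation π.1 (Φ.family π)) (T : ∀ k, 𝒜.face (χ k)) (b : B) :
    (∀ θ γ, pos χ θ < pos χ γ → (∀ k, pos χ k ≤ pos χ θ ∨ pos χ γ ≤ pos χ k) →
      Φ χ π (insertAfter T θ b) = Φ χ π (insertBefore T γ b)) ∧
    (∀ γ, (∀ k, pos χ γ ≤ pos χ k) → Φ χ π (insertBefore T γ b) = b * Φ χ π T) ∧
    (∀ θ, (∀ k, pos χ k ≤ pos χ θ) → Φ χ π (insertAfter T θ b) = Φ χ π T * b) := by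
  have hfam : ∀ a : Fin n, ∀ T, Φ.family π Finset.univ T = Φ χ π T := fun a T => by
    rw [Φ.family_of_nonempty π ⟨a, Finset.mem_univ a⟩, Φ.on_univ]
  have key := fun p => h.insL_eq_insR Finset.univ T p b
  refine ⟨fun θ γ hlt hadj => ?_, fun γ hγ => ?_, fun θ hθ => ?_⟩
  · rw [← hfam θ, ← hfam θ]
    have h₁ : IsPred χ Finset.univ (pos χ γ) θ :=
      ⟨Finset.mem_univ _, hlt, fun k _ hk => by have := hadj k; omega⟩
    have h₂ : IsSucc χ Finset.univ (pos χ γ) γ :=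
      ⟨Finset.mem_univ _, le_rfl, fun k _ hk => hk⟩
    rw [← insL_of_isPred (F := Φ.family π) h₁, ← insR_of_isSucc (F := Φ.family π) h₂, key]
  · rw [← hfam γ, ← hfam γ]
    have h₂ : IsSucc χ Finset.univ (pos χ γ) γ :=
      ⟨Finset.mem_univ _, le_rfl, fun k _ hk => hk⟩
    rw [← insR_of_isSucc (F := Φ.family π) h₂, ← key, insL_of_forall fun k _ => hγ k]
  · rw [← hfam θ, ← hfam θ]
    -- The cut must lie strictly after θ, since a cut at `pos χ θ` would count θ among the entries
    -- after it.
    have h₁ : IsPred χ Finset.univ (pos χ θ + 1) θ :=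
      ⟨Finset.mem_univ _, Nat.lt_succ_self _, fun k _ _ => hθ k⟩
    rw [← insL_of_isPred (F := Φ.family π) h₁, key, insR_of_forall fun k _ => Nat.lt_succ_of_le (hθ k)]

end Space

/-! ### Partitions below a partition with two complementary unions of blocks -/

section Glue

variable {n : ℕ} {χ : Fin n → Side}

theorem BNC.restrict_mono (S : Finset (Fin n)) {σ τ : BNC χ} (h : σ ≤ τ) :
    σ.restrict S ≤ τ.restrict S :=
  fun _ _ hab => h hab

theorem IsUnionOfBlocks.of_le {σ π : BNC χ} {S : Finset (Fin n)} (hS : IsUnionOfBlocks π.1 S)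
    (h : σ ≤ π) : IsUnionOfBlocks σ.1 S :=
  fun a b hab => hS a b (h hab)

variable {π : BNC χ} {V W : Finset (Fin n)}

theorem BNC.le_of_restrict_le (hu : V ∪ W = Finset.univ) (hV : IsUnionOfBlocks π.1 V)
    (hW : IsUnionOfBlocks π.1 W) {σ τ : BNC χ} (hσ : σ ≤ π)
    (h₁ : σ.restrict V ≤ τ.restrict V) (h₂ : σ.restrict W ≤ τ.restrict W) : σ ≤ τ := by
  intro a b hab
  have ha : a ∈ V ∪ W := hu ▸ Finset.mem_univ a
  rcases Finset.mem_union.1 ha with ha | ha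
  · have hb := hV a b (hσ hab) ha
    obtain ⟨i, rfl⟩ := exists_enum_eq ha
    obtain ⟨j, rfl⟩ := exists_enum_eq hb
    exact h₁ hab
  · have hb := hW a b (hσ hab) ha
    obtain ⟨i, rfl⟩ := exists_enum_eq ha
    obtain ⟨j, rfl⟩ := exists_enum_eq hb
    exact h₂ hab

/-- The relation that two partitions of complementary sets induce on their union. -/
def glueSetoid (hd : Disjoint V W) (hu : V ∪ W = Finset.univ) (ρ : Setoid (Fin V.card))
    (τ : Setoid (Fin W.card)) : Setoid (Fin n) where
  r a b := (∃ i j, enum V i = a ∧ enum V j = b ∧ ρ i j) ∨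
    ∃ i j, enum W i = a ∧ enum W j = b ∧ τ i j
  iseqv :=
    { refl := fun a => by
        have ha : a ∈ V ∪ W := hu ▸ Finset.mem_univ a
        rcases Finset.mem_union.1 ha with ha | ha
        · obtain ⟨i, hi⟩ := exists_enum_eq ha
          exact Or.inl ⟨i, i, hi, hi, ρ.refl i⟩
        · obtain ⟨i, hi⟩ := exists_enum_eq ha
          exact Or.inr ⟨i, i, hi, hi, τ.refl i⟩
      symm := by
        rintro a b (⟨i, j, hi, hj, h⟩ | ⟨i, j, hi, hj, h⟩)
        · exact Or.inl ⟨j, i, hj, hi, ρ.symm h⟩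
        · exact Or.inr ⟨j, i, hj, hi, τ.symm h⟩
      trans := by
        rintro a b c (⟨i, j, rfl, rfl, h⟩ | ⟨i, j, rfl, rfl, h⟩) (⟨k, l, hk, rfl, h'⟩ |
          ⟨k, l, hk, rfl, h'⟩)
        · obtain rfl := (enum V).injective hk
          exact Or.inl ⟨i, l, rfl, rfl, ρ.trans h h'⟩
        · exact absurd (enum_mem V j) (Finset.disjoint_right.1 hd (hk ▸ enum_mem W k))
        · exact absurd (enum_mem V k) (Finset.disjoint_right.1 hd (hk ▸ enum_mem W j))
        · obtain rfl := (enum W).injective hk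
          exact Or.inr ⟨i, l, rfl, rfl, τ.trans h h'⟩ }

theorem glueSetoid_enum_left (hd : Disjoint V W) (hu : V ∪ W = Finset.univ)
    {ρ : Setoid (Fin V.card)} {τ : Setoid (Fin W.card)} {i j : Fin V.card} :
    glueSetoid hd hu ρ τ (enum V i) (enum V j) ↔ ρ i j := by
  constructor
  · rintro (⟨k, l, hk, hl, h⟩ | ⟨k, l, hk, hl, h⟩)
    · obtain rfl := (enum V).injective hk
      obtain rfl := (enum V).injective hl
      exact h
    · exact absurd (enum_mem V i) (Finset.disjoint_right.1 hd (hk ▸ enum_mem W k))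
  · exact fun h => Or.inl ⟨i, j, rfl, rfl, h⟩

theorem glueSetoid_enum_right (hd : Disjoint V W) (hu : V ∪ W = Finset.univ)
    {ρ : Setoid (Fin V.card)} {τ : Setoid (Fin W.card)} {i j : Fin W.card} :
    glueSetoid hd hu ρ τ (enum W i) (enum W j) ↔ τ i j := by
  constructor
  · rintro (⟨k, l, hk, hl, h⟩ | ⟨k, l, hk, hl, h⟩)
    · exact absurd (enum_mem V k) (Finset.disjoint_right.1 hd (hk ▸ enum_mem W i))
    · obtain rfl := (enum W).injective hk
      obtain rfl := (enum W).injective hl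
      exact h
  · exact fun h => Or.inr ⟨i, j, rfl, rfl, h⟩

/-- A crossing in the glued relation would be a configuration of π as well. As π is non-crossing,
the four nodes then lie in one block of π, hence all in V or all in W, where ρ or τ excludes the
crossing. -/
theorem BNC.exists_restrict_eq (hd : Disjoint V W) (hu : V ∪ W = Finset.univ)
    (hV : IsUnionOfBlocks π.1 V) {ρ : BNC (BiFree.restrict χ V)} {τ : BNC (BiFree.restrict χ W)}
    (hρ : ρ ≤ π.restrict V) (hτ : τ ≤ π.restrict W) :
    ∃ σ ≤ π, σ.restrict V = ρ ∧ σ.restrict W = τ := by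
  have hW := hV.of_disjoint_union hd hu
  have hle : ∀ a b, glueSetoid hd hu ρ.1 τ.1 a b → π.1 a b := by
    rintro a b (⟨i, j, rfl, rfl, h⟩ | ⟨i, j, rfl, rfl, h⟩)
    · exact hρ h
    · exact hτ h
  refine ⟨⟨glueSetoid hd hu ρ.1 τ.1, ?_⟩, fun a b h => hle a b h, ?_, ?_⟩
  · intro u₁ v₁ u₂ v₂ h₁ h₂ h₃ hu' hv'
    have key := π.2 u₁ v₁ u₂ v₂ h₁ h₂ h₃ (hle _ _ hu') (hle _ _ hv')
    have hu₁ : u₁ ∈ V ∪ W := hu ▸ Finset.mem_univ u₁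
    rcases Finset.mem_union.1 hu₁ with ha | ha
    · have hb := hV _ _ key ha
      have hc := hV _ _ (hle _ _ hu') ha
      have hd' := hV _ _ (hle _ _ hv') hb
      obtain ⟨i, rfl⟩ := exists_enum_eq ha
      obtain ⟨j, rfl⟩ := exists_enum_eq hb
      obtain ⟨k, rfl⟩ := exists_enum_eq hc
      obtain ⟨l, rfl⟩ := exists_enum_eq hd'
      rw [glueSetoid_enum_left] at hu' hv' ⊢
      exact ρ.2 i j k l ((prec_enum χ V _ _).1 h₁) ((prec_enum χ V _ _).1 h₂)
        ((prec_enum χ V _ _).1 h₃) hu' hv'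
    · have hb := hW _ _ key ha
      have hc := hW _ _ (hle _ _ hu') ha
      have hd' := hW _ _ (hle _ _ hv') hb
      obtain ⟨i, rfl⟩ := exists_enum_eq ha
      obtain ⟨j, rfl⟩ := exists_enum_eq hb
      obtain ⟨k, rfl⟩ := exists_enum_eq hc
      obtain ⟨l, rfl⟩ := exists_enum_eq hd'
      rw [glueSetoid_enum_right] at hu' hv' ⊢
      exact τ.2 i j k l ((prec_enum χ W _ _).1 h₁) ((prec_enum χ W _ _).1 h₂)
        ((prec_enum χ W _ _).1 h₃) hu' hv'
  · apply Subtype.ext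
    apply Setoid.ext
    exact fun i j => glueSetoid_enum_left hd hu
  · apply Subtype.ext
    apply Setoid.ext
    exact fun i j => glueSetoid_enum_right hd hu

/-- A sum over partitions `σ ≤ π` that are subject to a condition on the restrictions of `σ` to two
complementary unions of blocks of `π`. -/
theorem sum_restrict {M : Type*} [AddCommMonoid M] (hd : Disjoint V W)
    (hu : V ∪ W = Finset.univ) (hV : IsUnionOfBlocks π.1 V) (s : Finset (BNC χ))
    (s₁ : Finset (BNC (restrict χ V))) (s₂ : Finset (BNC (restrict χ W)))
    (hs : ∀ σ, σ ∈ s ↔ σ ≤ π ∧ σ.restrict V ∈ s₁ ∧ σ.restrict W ∈ s₂)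
    (h₁ : ∀ ρ ∈ s₁, ρ ≤ π.restrict V) (h₂ : ∀ τ ∈ s₂, τ ≤ π.restrict W)
    (g : BNC (restrict χ V) → BNC (restrict χ W) → M) :
    ∑ σ ∈ s, g (σ.restrict V) (σ.restrict W) = ∑ ρ ∈ s₁, ∑ τ ∈ s₂, g ρ τ := by
  have hW := hV.of_disjoint_union hd hu
  rw [← Finset.sum_product']
  refine Finset.sum_bij (fun σ _ => (σ.restrict V, σ.restrict W)) ?_ ?_ ?_ ?_
  · intro σ hσ
    exact Finset.mem_product.2 ((hs σ).1 hσ).2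
  · intro σ hσ τ hτ h
    rw [Prod.mk.injEq] at h
    exact le_antisymm
      (BNC.le_of_restrict_le hu hV hW ((hs σ).1 hσ).1 h.1.le h.2.le)
      (BNC.le_of_restrict_le hu hV hW ((hs τ).1 hτ).1 h.1.ge h.2.ge)
  · rintro ⟨ρ, τ⟩ h
    rw [Finset.mem_product] at h
    obtain ⟨σ, hσ, rfl, rfl⟩ := BNC.exists_restrict_eq hd hu hV (h₁ _ h.1) (h₂ _ h.2)
    exact ⟨σ, (hs σ).2 ⟨hσ, h.1, h.2⟩, rfl⟩
  · intro _ _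
    rfl

end Glue

/-! ### Factorizing elements of the incidence algebra -/

/-- The values of `f` factorize over complementary unions of blocks. -/
def IA.IsFactorizing (f : IA) : Prop :=
  ∀ ⦃n : ℕ⦄ (χ : Fin n → Side) (σ π : BNC χ) (V W : Finset (Fin n)), V.Nonempty → W.Nonempty →
    Disjoint V W → V ∪ W = Finset.univ → IsUnionOfBlocks π.1 V → σ ≤ π →
    f χ σ π = f _ (σ.restrict V) (π.restrict V) * f _ (σ.restrict W) (π.restrict W)

/-- The interval `[σ, π]` is the product of its restrictions to V and W. The product of the two
restricted Möbius functions thus sums to the Kronecker delta over it, as the Möbius function does,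
and this recursion determines the values. -/
theorem moebius_isFactorizing : IA.IsFactorizing moebius := by
  intro n χ σ π V W _ _ hd hu hV hσπ
  have hW := hV.of_disjoint_union hd hu
  induction hk : (Finset.Icc σ π).card using Nat.strong_induction_on generalizing π with
  | _ k ih =>
  have hsum : ∑ x ∈ Finset.Icc σ π,
      moebius _ (σ.restrict V) (x.restrict V) * moebius _ (σ.restrict W) (x.restrict W) =
      if σ = π then 1 else 0 := by
    rw [sum_restrict hd hu hV (Finset.Icc σ π) (Finset.Icc (σ.restrict V) (π.restrict V))
      (Finset.Icc (σ.restrict W) (π.restrict W)) (fun x => ?_)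
      (fun ρ hρ => (Finset.mem_Icc.1 hρ).2) (fun ρ hρ => (Finset.mem_Icc.1 hρ).2)
      (fun x y => moebius _ (σ.restrict V) x * moebius _ (σ.restrict W) y),
      ← Finset.sum_mul_sum]
    · unfold moebius
      rw [IncidenceAlgebra.sum_Icc_mu_right, IncidenceAlgebra.sum_Icc_mu_right]
      by_cases h : σ = π
      · simp [h]
      · rw [if_neg h]
        by_cases h₁ : σ.restrict V = π.restrict V
        · rw [if_neg (fun h₂ : σ.restrict W = π.restrict W => h (le_antisymm hσπ
            (BNC.le_of_restrict_le hu hV hW le_rfl h₁.ge h₂.ge))), mul_zero]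
        · rw [if_neg h₁, zero_mul]
    · simp only [Finset.mem_Icc]
      constructor
      · rintro ⟨h₁, h₂⟩
        exact ⟨h₂, ⟨BNC.restrict_mono V h₁, BNC.restrict_mono V h₂⟩, BNC.restrict_mono W h₁,
          BNC.restrict_mono W h₂⟩
      · rintro ⟨h, h₁, h₂⟩
        exact ⟨BNC.le_of_restrict_le hu hV hW hσπ h₁.1 h₂.1, h⟩
  have hsum' : ∑ x ∈ Finset.Icc σ π, moebius χ σ x = if σ = π then 1 else 0 :=
    IncidenceAlgebra.sum_Icc_mu_right σ π
  -- The terms below π agree by induction on the size of the interval, so the top terms agree too.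
  rw [← Finset.sum_erase_add _ _ (Finset.right_mem_Icc.2 hσπ)] at hsum hsum'
  have hE : ∑ x ∈ (Finset.Icc σ π).erase π, moebius χ σ x = ∑ x ∈ (Finset.Icc σ π).erase π,
      moebius _ (σ.restrict V) (x.restrict V) * moebius _ (σ.restrict W) (x.restrict W) := by
    refine Finset.sum_congr rfl fun x hx => ?_
    obtain ⟨hne, hx⟩ := Finset.mem_erase.1 hx
    obtain ⟨h₁, h₂⟩ := Finset.mem_Icc.1 hx
    have hVx := hV.of_le h₂
    refine ih _ ?_ x hVx h₁ (hVx.of_disjoint_union hd hu) rfl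
    rw [← hk]
    refine Finset.card_lt_card ⟨Finset.Icc_subset_Icc_right h₂, fun h => hne ?_⟩
    exact le_antisymm h₂ (Finset.mem_Icc.1 (h (Finset.right_mem_Icc.2 hσπ))).2
  rw [hE, ← hsum] at hsum'
  exact add_left_cancel hsum'

theorem BNC.apply_comap_of_range {X : Sort*} (h : ∀ ⦃n : ℕ⦄ (χ : Fin n → Side), BNC χ → X)
    {n : ℕ} {χ : Fin n → Side} (π : BNC χ) {m : ℕ} (e : Fin m ↪o Fin n) {S : Finset (Fin n)}
    (hS : ∀ k, k ∈ S ↔ ∃ i, e i = k) :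
    h (fun k => χ (e k)) (π.comap e) = h (BiFree.restrict χ S) (π.restrict S) := by
  obtain rfl := eq_card_of_range e hS
  obtain rfl := eq_enum e hS
  rfl

theorem mem_blocks {n : ℕ} {π : Setoid (Fin n)} {U : Finset (Fin n)} :
    U ∈ blocks π ↔ ∃ a, ∀ b, b ∈ U ↔ π a b := by
  simp only [blocks, Finset.mem_image, Finset.mem_univ, true_and]
  refine exists_congr fun a => ?_
  constructor
  · rintro rfl
    simp
  · intro h
    ext b
    simp [h]

theorem map_mem_blocks {n : ℕ} {π : Setoid (Fin n)} {V : Finset (Fin n)}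
    (hV : IsUnionOfBlocks π V) {U : Finset (Fin V.card)} :
    U.map (enum V).toEmbedding ∈ blocks π ↔ U ∈ blocks (Setoid.comap (enum V) π) := by
  rw [mem_blocks, mem_blocks]
  constructor
  · rintro ⟨a, ha⟩
    obtain ⟨i, -, rfl⟩ := Finset.mem_map.1 ((ha a).2 (π.refl a))
    exact ⟨i, fun j => (Finset.mem_map' (enum V).toEmbedding).symm.trans (ha (enum V j))⟩
  · rintro ⟨i, hi⟩
    refine ⟨enum V i, fun b => ?_⟩
    rw [Finset.mem_map]
    constructor
    · rintro ⟨j, hj, rfl⟩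
      exact (hi j).1 hj
    · intro hb
      obtain ⟨j, rfl⟩ := exists_enum_eq (hV _ _ hb (enum_mem V i))
      exact ⟨j, (hi j).2 hb, rfl⟩

theorem prod_blocks {M : Type*} [CommMonoid M] {n : ℕ} {π : Setoid (Fin n)}
    {V W : Finset (Fin n)} (hd : Disjoint V W) (hu : V ∪ W = Finset.univ)
    (hV : IsUnionOfBlocks π V) (g : Finset (Fin n) → M) :
    ∏ U ∈ blocks π, g U =
      (∏ U ∈ blocks (Setoid.comap (enum V) π), g (U.map (enum V).toEmbedding)) *
        ∏ U ∈ blocks (Setoid.comap (enum W) π), g (U.map (enum W).toEmbedding) := by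
  have hW := hV.of_disjoint_union hd hu
  have hmap : ∀ (S : Finset (Fin n)) (hS : IsUnionOfBlocks π S),
      ∏ U ∈ blocks (Setoid.comap (enum S) π), g (U.map (enum S).toEmbedding) =
        ∏ U ∈ (blocks π).filter (fun U => U ⊆ S), g U := by
    intro S hS
    refine Finset.prod_bij (fun U _ => U.map (enum S).toEmbedding) ?_ ?_ ?_ ?_
    · intro U hU
      refine Finset.mem_filter.2 ⟨(map_mem_blocks hS).2 hU, fun k hk => ?_⟩
      obtain ⟨i, -, rfl⟩ := Finset.mem_map.1 hk
      exact enum_mem S i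
    · intro U _ U' _ h
      exact Finset.map_injective _ h
    · intro U hU
      obtain ⟨hU, hUS⟩ := Finset.mem_filter.1 hU
      refine ⟨pull S U, ?_, map_pull hUS⟩
      rw [← map_mem_blocks hS, map_pull hUS]
      exact hU
    · intro _ _
      rfl
  rw [hmap V hV, hmap W hW, ← Finset.prod_filter_mul_prod_filter_not _ (fun U => U ⊆ V)]
  congr 1
  refine Finset.prod_congr (Finset.filter_congr fun U hU => ?_) fun _ _ => rfl
  obtain ⟨a, ha⟩ := mem_blocks.1 hU
  have haU : a ∈ U := (ha a).2 (π.refl a)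
  have haVW : a ∈ V ∪ W := hu ▸ Finset.mem_univ a
  constructor
  · intro h b hb
    rcases Finset.mem_union.1 haVW with h' | h'
    · exact absurd (fun b hb => hV a b ((ha b).1 hb) h') h
    · exact hW a b ((ha b).1 hb) h'
  · intro h h'
    exact Finset.disjoint_left.1 hd (h' haU) (h haU)

/-- The blocks of the upper partition are distributed between V and W. The factor of a block depends
only on the restriction to that block, which is the same whether or not one first restricts to V or
W. -/
theorem IsMultiplicative.isFactorizing {f : IA} (hf : IsMultiplicative f) :
    f.IsFactorizing := by
  obtain ⟨R, -, hR⟩ := hf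
  intro n χ σ π V W hVn hWn hd hu hV hσπ
  have hn : 0 < n := hVn.choose.pos
  rw [hR n χ σ π hn hσπ, hR _ _ _ _ (Finset.card_pos.2 hVn) (BNC.restrict_mono V hσπ),
    hR _ _ _ _ (Finset.card_pos.2 hWn) (BNC.restrict_mono W hσπ), prod_blocks hd hu hV]
  have key := fun (S : Finset (Fin n)) (U : Finset (Fin S.card)) =>
    BNC.apply_comap_of_range (fun _ χ π => ((R χ π).map
      (fun β => f β.2 (BNC.zero β.2) (BNC.one β.2))).prod) σ ((enum U).trans (enum S))
      (enum_enum_range U)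
  congr 1 <;> exact Finset.prod_congr rfl fun U _ => (key _ U).symm

/-! ### Bi-multiplicativity of convolutions -/

section Space

variable {B A : Type*} [Ring B] [Algebra ℂ B] [Ring A] [Algebra ℂ A] {𝒜 : BBSpace B A}

theorem isBiMultiplicative_of_rules {Φ : BiFun 𝒜}
    (hl : ∀ (n : ℕ) (χ : Fin n → Side) (π : BNC χ) (T : ∀ k, 𝒜.face (χ k)) (k : Fin n),
      IsLinearMap ℂ fun x : 𝒜.face (χ k) => Φ χ π (Function.update T k x))
    (hb : IsBalanced Φ) (hf : IsFactorizing Φ) (hn : IsNesting Φ) : IsBiMultiplicative 𝒜 Φ where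
  linear := hl
  prop_i := hb.hasShiftRules.prop_i
  prop_i_empty := hb.hasShiftRules.prop_i_empty
  prop_ii := hb.hasShiftRules.prop_ii
  prop_ii_empty := hb.hasShiftRules.prop_ii_empty
  prop_iii := fun _ _ π T _ V hn hne hu _ hπ hlt => hf.prop_iii π T V hn hne hu hπ hlt
  prop_iv := fun _ _ π T _ _ _ _ _ _ hd hu hπ _ hV _ _ hv₀ hv₁ hθ hγ =>
    hn.prop_iv π T hd hu hπ hV hv₀ hv₁ hθ hγ

variable {Φ : BiFun 𝒜} {f : IA} {n : ℕ} {χ : Fin n → Side}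

/-- Linearity in the inserted coefficient is what allows a sum over the inner partitions to be
carried out inside a nested expression. -/
theorem IsBiMultiplicative.isLinearMap_insertAfter (h : IsBiMultiplicative 𝒜 Φ) (π : BNC χ)
    (T : ∀ k, 𝒜.face (χ k)) (k : Fin n) :
    IsLinearMap ℂ fun b => Φ χ π (insertAfter T k b) :=
  ((h.linear n χ π T k).mk' _ ∘ₗ (BBSpace.after_isLinearMap (χ k) (T k)).mk' _).isLinear

theorem IsBiMultiplicative.isLinearMap_insertBefore (h : IsBiMultiplicative 𝒜 Φ) (π : BNC χ)
    (T : ∀ k, 𝒜.face (χ k)) (k : Fin n) :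
    IsLinearMap ℂ fun b => Φ χ π (insertBefore T k b) :=
  ((h.linear n χ π T k).mk' _ ∘ₗ (BBSpace.before_isLinearMap (χ k) (T k)).mk' _).isLinear

open Classical in
/-- The convolution as a double sum over partitions of complementary unions of blocks. -/
theorem convolution_eq_sum (hf : f.IsFactorizing) (π : BNC χ) (T : ∀ k, 𝒜.face (χ k))
    {V W : Finset (Fin n)} (hVn : V.Nonempty) (hWn : W.Nonempty) (hd : Disjoint V W)
    (hu : V ∪ W = Finset.univ) (hV : IsUnionOfBlocks π.1 V)
    (g : BNC (restrict χ V) → BNC (restrict χ W) → B)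
    (hg : ∀ σ ≤ π, Φ χ σ T = g (σ.restrict V) (σ.restrict W)) :
    convolution Φ f χ π T = ∑ ρ with ρ ≤ π.restrict V, ∑ τ with τ ≤ π.restrict W,
      (f _ ρ (π.restrict V) * f _ τ (π.restrict W)) • g ρ τ := by
  rw [← sum_restrict hd hu hV (Finset.univ.filter (· ≤ π)) _ _ (fun σ => ?_) (fun ρ hρ => ?_)
    (fun τ hτ => ?_) (fun ρ τ => (f _ ρ (π.restrict V) * f _ τ (π.restrict W)) • g ρ τ)]
  · refine Finset.sum_congr rfl fun σ hσ => ?_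
    have hσ' := (Finset.mem_filter.1 hσ).2
    rw [hf χ σ π V W hVn hWn hd hu hV hσ', hg σ hσ']
  · simp only [Finset.mem_filter, Finset.mem_univ, true_and]
    exact ⟨fun h => ⟨h, BNC.restrict_mono V h, BNC.restrict_mono W h⟩, fun h => h.1⟩
  · exact (Finset.mem_filter.1 hρ).2
  · exact (Finset.mem_filter.1 hτ).2

theorem IsBiMultiplicative.convolution (h : IsBiMultiplicative 𝒜 Φ) (hf : f.IsFactorizing) :
    IsBiMultiplicative 𝒜 (convolution Φ f) := by
  classical
  -- The convolution at `1_χ` involves every σ, so the shift rules are needed at all partitions.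
  have hbal : ∀ ⦃n : ℕ⦄ (χ : Fin n → Side) (σ : BNC χ) (T : ∀ k, 𝒜.face (χ k)) (b : B), _ :=
    fun n χ σ => balanced_of_isEvaluation (isEvaluation_family h.hasShiftRules.isBalanced
      h.isFactorizing h.isNesting σ)
  refine isBiMultiplicative_of_rules ?_ ⟨?_, ?_, ?_⟩ ?_ ?_
  · intro n χ π T k
    constructor
    · intro x y
      simp only [BiFree.convolution, (h.linear n χ _ T k).map_add, smul_add,
        Finset.sum_add_distrib]
    · intro z x
      simp only [BiFree.convolution, (h.linear n χ _ T k).map_smul, Finset.smul_sum]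
      exact Finset.sum_congr rfl fun σ _ => smul_comm _ _ _
  · intro n χ T b θ γ hlt hadj
    exact Finset.sum_congr rfl fun σ _ => by rw [(hbal χ σ T b).1 θ γ hlt hadj]
  · intro n χ T b γ hγ
    simp only [BiFree.convolution, Finset.mul_sum]
    exact Finset.sum_congr rfl fun σ _ => by rw [(hbal χ σ T b).2.1 γ hγ, mul_smul_comm]
  · intro n χ T b γ hγ
    simp only [BiFree.convolution, Finset.sum_mul]
    exact Finset.sum_congr rfl fun σ _ => by rw [(hbal χ σ T b).2.2 γ hγ, smul_mul_assoc]
  · intro n χ π T V W hVn hWn hd hu hV hlt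
    rw [convolution_eq_sum hf π T hVn hWn hd hu hV
      (fun ρ τ => Φ _ ρ (restrictTuple 𝒜 T V) * Φ _ τ (restrictTuple 𝒜 T W))
      fun σ hσ => h.isFactorizing χ σ T V W hVn hWn hd hu (hV.of_le hσ) hlt]
    simp only [← smul_mul_smul_comm]
    rw [← Finset.sum_mul_sum]
    rfl
  · intro n χ π T V W p θ γ hVn hd hu hV hgap hθ hγ
    have hnest := fun σ (hσ : σ ≤ π) => h.isNesting χ σ T V W p θ γ hVn hd hu (hV.of_le hσ) hgap
      hθ hγ
    obtain ⟨i, rfl⟩ := exists_enum_eq hθ.1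
    obtain ⟨j, rfl⟩ := exists_enum_eq hγ.1
    constructor
    · rw [convolution_eq_sum hf π T hVn ⟨_, hθ.1⟩ hd hu hV
        (fun ρ τ => Φ _ τ (insertAfter (restrictTuple 𝒜 T W) i (Φ _ ρ (restrictTuple 𝒜 T V))))
        fun σ hσ => by
          rw [← restrictTuple_insertAfter]
          exact (hnest σ hσ).1]
      simp only [BiFun.on, restrictTuple_insertAfter, BiFree.convolution]
      -- For fixed outer τ, the inner sum over ρ turns into one insertion of the linear combination
      -- that defines the convolution on V.
      rw [Finset.sum_comm]
      refine Finset.sum_congr rfl fun τ _ => ?_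
      have hlin := h.isLinearMap_insertAfter τ (restrictTuple 𝒜 T W) i
      have := map_sum (hlin.mk' _) (fun ρ : BNC (restrict χ V) =>
        f _ ρ (π.restrict V) • Φ _ ρ (restrictTuple 𝒜 T V)) (Finset.univ.filter (· ≤ π.restrict V))
      simp only [IsLinearMap.mk'_apply, hlin.map_smul] at this
      rw [this, Finset.smul_sum]
      exact Finset.sum_congr rfl fun ρ _ => by rw [smul_smul, mul_comm]
    · rw [convolution_eq_sum hf π T hVn ⟨_, hθ.1⟩ hd hu hV
        (fun ρ τ => Φ _ τ (insertBefore (restrictTuple 𝒜 T W) j (Φ _ ρ (restrictTuple 𝒜 T V))))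
        fun σ hσ => by
          rw [← restrictTuple_insertBefore]
          exact (hnest σ hσ).2]
      simp only [BiFun.on, restrictTuple_insertBefore, BiFree.convolution]
      rw [Finset.sum_comm]
      refine Finset.sum_congr rfl fun τ _ => ?_
      have hlin := h.isLinearMap_insertBefore τ (restrictTuple 𝒜 T W) j
      have := map_sum (hlin.mk' _) (fun ρ : BNC (restrict χ V) =>
        f _ ρ (π.restrict V) • Φ _ ρ (restrictTuple 𝒜 T V)) (Finset.univ.filter (· ≤ π.restrict V))
      simp only [IsLinearMap.mk'_apply, hlin.map_smul] at this
      rw [this, Finset.smul_sum]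
      exact Finset.sum_congr rfl fun ρ _ => by rw [smul_smul, mul_comm]

end Space

/-! ### Products in increasing order -/

section OrderedProd

variable {A : Type*} [Ring A] {n : ℕ}

/-- The product of the `T_k`, `k ∈ U`, in increasing order. -/
def orderedProd (U : Finset (Fin n)) (T : Fin n → A) : A :=
  ((U.sort (· ≤ ·)).map T).prod

theorem orderedProd_congr {U : Finset (Fin n)} {T T' : Fin n → A} (h : ∀ i ∈ U, T i = T' i) :
    orderedProd U T = orderedProd U T' := by
  unfold orderedProd
  rw [List.map_congr_left fun i hi => h i ((Finset.mem_sort _).1 hi)]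

theorem orderedProd_empty (T : Fin n → A) : orderedProd ∅ T = 1 := by
  simp [orderedProd]

theorem orderedProd_singleton (T : Fin n → A) (k : Fin n) : orderedProd {k} T = T k := by
  simp [orderedProd]

theorem orderedProd_union {U W : Finset (Fin n)} (h : ∀ u ∈ U, ∀ w ∈ W, u < w) (T : Fin n → A) :
    orderedProd (U ∪ W) T = orderedProd U T * orderedProd W T := by
  have hnd : (U.sort (· ≤ ·) ++ W.sort (· ≤ ·)).Nodup := by
    rw [List.nodup_append]
    refine ⟨Finset.sort_nodup _ _, Finset.sort_nodup _ _, fun a ha b hb => ?_⟩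
    exact (h a ((Finset.mem_sort _).1 ha) b ((Finset.mem_sort _).1 hb)).ne
  have hsort : (U ∪ W).sort (· ≤ ·) = U.sort (· ≤ ·) ++ W.sort (· ≤ ·) := by
    have := (List.toFinset_sort (r := (· ≤ ·)) hnd).2 (by
      rw [List.pairwise_append]
      exact ⟨Finset.pairwise_sort _ _, Finset.pairwise_sort _ _, fun a ha b hb =>
        (h a ((Finset.mem_sort _).1 ha) b ((Finset.mem_sort _).1 hb)).le⟩)
    rwa [List.toFinset_append, Finset.sort_toFinset, Finset.sort_toFinset] at this
  simp [orderedProd, hsort]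

theorem orderedProd_eq_mul (U : Finset (Fin n)) (t : Fin n) (T : Fin n → A) :
    orderedProd U T = orderedProd (U.filter (· < t)) T * orderedProd (U.filter (t ≤ ·)) T := by
  rw [← orderedProd_union]
  · refine congrArg (orderedProd · T) (Finset.ext fun k => ?_)
    simp only [Finset.mem_union, Finset.mem_filter, ← and_or_left]
    exact (and_iff_left (lt_or_ge k t)).symm
  · intro u hu w hw
    exact (Finset.mem_filter.1 hu).2.trans_le (Finset.mem_filter.1 hw).2

theorem orderedProd_eq_mul_mul {U : Finset (Fin n)} {k : Fin n} (hk : k ∈ U) (T : Fin n → A) :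
    orderedProd U T =
      orderedProd (U.filter (· < k)) T * (T k * orderedProd (U.filter (k < ·)) T) := by
  have hle : orderedProd (U.filter (k ≤ ·)) T =
      orderedProd ({k} ∪ U.filter (k < ·)) T := by
    refine congrArg (orderedProd · T) (Finset.ext fun j => ?_)
    simp only [Finset.mem_union, Finset.mem_filter, Finset.mem_singleton, le_iff_eq_or_lt]
    constructor
    · rintro ⟨hj, rfl | h⟩
      · exact Or.inl rfl
      · exact Or.inr ⟨hj, h⟩
    · rintro (rfl | ⟨hj, h⟩)
      · exact ⟨hk, Or.inl rfl⟩
      · exact ⟨hj, Or.inr h⟩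
  rw [orderedProd_eq_mul U k, hle, orderedProd_union, orderedProd_singleton]
  intro u hu w hw
  rw [Finset.mem_singleton.1 hu]
  exact (Finset.mem_filter.1 hw).2

theorem orderedProd_update {U : Finset (Fin n)} {k : Fin n} (hk : k ∈ U) (T : Fin n → A) (y : A) :
    orderedProd U (Function.update T k y) =
      orderedProd (U.filter (· < k)) T * (y * orderedProd (U.filter (k < ·)) T) := by
  rw [orderedProd_eq_mul_mul hk, Function.update_self]
  congr 1
  · refine orderedProd_congr fun i hi => Function.update_of_ne ?_ _ _
    exact (Finset.mem_filter.1 hi).2.ne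
  · congr 1
    refine orderedProd_congr fun i hi => Function.update_of_ne ?_ _ _
    exact (Finset.mem_filter.1 hi).2.ne'

theorem orderedProd_update_of_notMem {U : Finset (Fin n)} {k : Fin n} (hk : k ∉ U)
    (T : Fin n → A) (y : A) : orderedProd U (Function.update T k y) = orderedProd U T :=
  orderedProd_congr fun _ hi => Function.update_of_ne (ne_of_mem_of_not_mem hi hk) _ _

theorem commute_orderedProd {U : Finset (Fin n)} {T : Fin n → A} {x : A}
    (h : ∀ i ∈ U, Commute x (T i)) : Commute x (orderedProd U T) := by
  refine Commute.list_prod_right _ _ fun y hy => ?_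
  obtain ⟨i, hi, rfl⟩ := List.mem_map.1 hy
  exact h i ((Finset.mem_sort _).1 hi)

theorem orderedProd_map {m : ℕ} (e : Fin m ↪o Fin n) (U : Finset (Fin m)) (T : Fin n → A) :
    orderedProd (U.map e.toEmbedding) T = orderedProd U fun k => T (e k) := by
  unfold orderedProd
  have hnd : ((U.sort (· ≤ ·)).map e).Nodup := (Finset.sort_nodup _ _).map e.injective
  have := (List.toFinset_sort (r := (· ≤ ·)) hnd).2 (by
    rw [List.pairwise_map]
    exact (Finset.pairwise_sort U (· ≤ ·)).imp fun h => e.monotone h)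
  have hset : ((U.sort (· ≤ ·)).map e).toFinset = U.map e.toEmbedding := by
    ext k
    simp
  rw [hset] at this
  rw [this, List.map_map]
  rfl

end OrderedProd

section Space

variable {B A : Type*} [Ring B] [Algebra ℂ B] [Ring A] [Algebra ℂ A] {𝒜 : BBSpace B A}
  {n : ℕ} {χ : Fin n → Side}

/-! ### The steps of the recursion for the moments -/

/-- `m` is the largest of the minima of the blocks of the restriction of `π` to `S`. -/
def IsTopMin (π : Setoid (Fin n)) (S : Finset (Fin n)) (m : Fin n) : Prop :=
  IsGreatest {a | a ∈ S ∧ ∀ c ∈ S, π a c → a ≤ c} m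

open Classical in
/-- The block of `m` in the restriction of `π` to `S`. -/
noncomputable def blockOf (π : Setoid (Fin n)) (S : Finset (Fin n)) (m : Fin n) :
    Finset (Fin n) :=
  S.filter fun c => π m c

theorem mem_blockOf {π : Setoid (Fin n)} {S : Finset (Fin n)} {m c : Fin n} :
    c ∈ blockOf π S m ↔ c ∈ S ∧ π m c := by
  simp [blockOf]

/-- The node `w` is the nearest one, on the inner side of `m`, of the spines passing `m`, and `k` is
the first node below `m` on its spine. -/
structure IsInnerStep (χ : Fin n → Side) (π : Setoid (Fin n)) (S : Finset (Fin n))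
    (m w k : Fin n) : Prop where
  mem : w ∈ S
  lt : m < w
  not_rel : ¬ π m w
  nearest_left : χ m = Side.left → ∀ d ∈ S, m < d → ¬ π m d → pos χ w ≤ pos χ d
  nearest_right : χ m = Side.right → ∀ d ∈ S, m < d → ¬ π m d → pos χ d ≤ pos χ w
  least_mem : k ∈ S
  lt_least : m < k
  rel : π w k
  least : ∀ j ∈ S, m < j → π w j → k ≤ j

/-- No spine passes `m`, and `k` is the last node outside the block of `m`. -/
structure IsOuterStep (π : Setoid (Fin n)) (S : Finset (Fin n)) (m k : Fin n) : Prop where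
  rel_of_lt : ∀ d ∈ S, m < d → π m d
  mem : k ∈ S
  not_rel : ¬ π m k
  greatest : ∀ j ∈ S, ¬ π m j → j ≤ k

theorem IsOuterStep.lt {π : Setoid (Fin n)} {S : Finset (Fin n)} {m k : Fin n}
    (h : IsOuterStep π S m k) : k < m := by
  rcases lt_trichotomy k m with h' | rfl | h'
  · exact h'
  · exact absurd (π.refl k) h.not_rel
  · exact absurd (h.rel_of_lt k h.mem h') h.not_rel

theorem step_cases (χ : Fin n → Side) (π : Setoid (Fin n)) (S : Finset (Fin n)) (m : Fin n) :
    (∀ c ∈ S, π m c) ∨ (¬ (∀ c ∈ S, π m c) ∧ ((∃ w k, IsInnerStep χ π S m w k) ∨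
      ∃ k, IsOuterStep π S m k)) := by
  classical
  by_cases h : ∀ c ∈ S, π m c
  · exact Or.inl h
  refine Or.inr ⟨h, ?_⟩
  by_cases hD : (S.filter fun d => m < d ∧ ¬ π m d).Nonempty
  · left
    have hmem : ∀ d, d ∈ (S.filter fun d => m < d ∧ ¬ π m d) ↔ d ∈ S ∧ m < d ∧ ¬ π m d :=
      fun d => Finset.mem_filter
    have hk : ∀ w ∈ S, m < w → ∃ k, k ∈ S ∧ m < k ∧ π w k ∧ ∀ j ∈ S, m < j → π w j → k ≤ j := by
      intro w hw hmw
      obtain ⟨k, hk, hmin⟩ := (S.filter fun j => m < j ∧ π w j).exists_min_image id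
        ⟨w, Finset.mem_filter.2 ⟨hw, hmw, π.refl w⟩⟩
      obtain ⟨hk₁, hk₂, hk₃⟩ := Finset.mem_filter.1 hk
      exact ⟨k, hk₁, hk₂, hk₃, fun j hj hmj hwj =>
        hmin j (Finset.mem_filter.2 ⟨hj, hmj, hwj⟩)⟩
    rcases (χ m).eq_or_eq with hχ | hχ
    · obtain ⟨w, hw, hmin⟩ := (S.filter fun d => m < d ∧ ¬ π m d).exists_min_image (pos χ) hD
      obtain ⟨hw₁, hw₂, hw₃⟩ := (hmem w).1 hw
      obtain ⟨k, hk₁, hk₂, hk₃, hk₄⟩ := hk w hw₁ hw₂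
      exact ⟨w, k, hw₁, hw₂, hw₃, fun _ d h₁ h₂ h₃ => hmin d ((hmem d).2 ⟨h₁, h₂, h₃⟩),
        fun h' => by simp [hχ] at h', hk₁, hk₂, hk₃, hk₄⟩
    · obtain ⟨w, hw, hmin⟩ := (S.filter fun d => m < d ∧ ¬ π m d).exists_max_image (pos χ) hD
      obtain ⟨hw₁, hw₂, hw₃⟩ := (hmem w).1 hw
      obtain ⟨k, hk₁, hk₂, hk₃, hk₄⟩ := hk w hw₁ hw₂
      exact ⟨w, k, hw₁, hw₂, hw₃, fun h' => by simp [hχ] at h',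
        fun _ d h₁ h₂ h₃ => hmin d ((hmem d).2 ⟨h₁, h₂, h₃⟩), hk₁, hk₂, hk₃, hk₄⟩
  · right
    push Not at h
    obtain ⟨c, hc, hmc⟩ := h
    obtain ⟨k, hk, hmax⟩ := (S.filter fun d => ¬ π m d).exists_max_image id
      ⟨c, Finset.mem_filter.2 ⟨hc, hmc⟩⟩
    obtain ⟨hk₁, hk₂⟩ := Finset.mem_filter.1 hk
    refine ⟨k, fun d hd hmd => ?_, hk₁, hk₂, fun j hj hmj => hmax j (Finset.mem_filter.2 ⟨hj, hmj⟩)⟩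
    by_contra hcon
    exact hD ⟨d, Finset.mem_filter.2 ⟨hd, hmd, hcon⟩⟩

variable {π : Setoid (Fin n)} {S : Finset (Fin n)} {m w k : Fin n}

theorem blockOf_eq_self (h : ∀ c ∈ S, π m c) : blockOf π S m = S := by
  ext c
  rw [mem_blockOf]
  exact ⟨fun h => h.1, fun hc => ⟨hc, h c hc⟩⟩

theorem IsTopMin.choose_eq (hm : IsTopMin π S m)
    (h : ∃ m, IsGreatest {a | a ∈ S ∧ ∀ c ∈ S, π a c → a ≤ c} m) : h.choose = m :=
  h.choose_spec.unique hm

theorem momentAux_single (hm : IsTopMin π S m) (h : ∀ c ∈ S, π m c) (T : Fin n → A) :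
    momentAux 𝒜 χ π S T = 𝒜.E (orderedProd S T) := by
  have hm' : ∃ m, IsGreatest {a | a ∈ S ∧ ∀ c ∈ S, π a c → a ≤ c} m := ⟨m, hm⟩
  have hV := blockOf_eq_self h
  unfold blockOf at hV
  rw [momentAux, dif_pos hm']
  have hc := hm.choose_eq hm'
  -- The later choices in the recursion depend on the chosen minimum, which must become a variable
  -- before it can be identified with m.
  generalize hm'.choose = m' at hc ⊢
  subst hc
  dsimp only
  rw [if_pos hV, hV]
  rfl

theorem momentAux_inner (hm : IsTopMin π S m) (h : ¬ ∀ c ∈ S, π m c)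
    (hk : IsInnerStep χ π S m w k) (T : Fin n → A) :
    momentAux 𝒜 χ π S T = momentAux 𝒜 χ π (S \ blockOf π S m)
      (Function.update T k (𝒜.op (χ m) (𝒜.E (orderedProd (blockOf π S m) T)) * T k)) := by
  classical
  have hm' : ∃ m, IsGreatest {a | a ∈ S ∧ ∀ c ∈ S, π a c → a ≤ c} m := ⟨m, hm⟩
  have hV : ¬ S.filter (fun c => π m c) = S := fun hV => h fun c hc => by
    rw [← hV] at hc
    exact (Finset.mem_filter.1 hc).2
  have hD : ∀ d, d ∈ {d | d ∈ S ∧ m < d ∧ d ∉ S.filter fun c => π m c} ↔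
      d ∈ S ∧ m < d ∧ ¬ π m d := by
    intro d
    simp only [Set.mem_ofPred_eq, Finset.mem_filter]
    tauto
  -- The nearest node is unique, because positions are injective; the choice made by the recursion
  -- is therefore forced.
  have key : ∀ w', (match χ m with
      | Side.left => IsFirst χ {d | d ∈ S ∧ m < d ∧ d ∉ S.filter fun c => π m c} w'
      | Side.right => IsLast χ {d | d ∈ S ∧ m < d ∧ d ∉ S.filter fun c => π m c} w') ↔
      w' = w := by
    intro w'
    have hw := (hD w).2 ⟨hk.mem, hk.lt, hk.not_rel⟩
    rcases (χ m).eq_or_eq with hχ | hχ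
    · have hn := hk.nearest_left hχ
      simp only [hχ]
      rw [isFirst_iff]
      constructor
      · rintro ⟨h₁, h₂⟩
        obtain ⟨a₁, a₂, a₃⟩ := (hD w').1 h₁
        exact pos_injective χ (le_antisymm (h₂ w hw) (hn w' a₁ a₂ a₃))
      · rintro rfl
        exact ⟨hw, fun d hd => by
          obtain ⟨a₁, a₂, a₃⟩ := (hD d).1 hd
          exact hn d a₁ a₂ a₃⟩
    · have hn := hk.nearest_right hχ
      simp only [hχ]
      rw [isLast_iff]
      constructor
      · rintro ⟨h₁, h₂⟩
        obtain ⟨a₁, a₂, a₃⟩ := (hD w').1 h₁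
        exact pos_injective χ (le_antisymm (hn w' a₁ a₂ a₃) (h₂ w hw))
      · rintro rfl
        exact ⟨hw, fun d hd => by
          obtain ⟨a₁, a₂, a₃⟩ := (hD d).1 hd
          exact hn d a₁ a₂ a₃⟩
  have hleast : IsLeast {j | j ∈ S ∧ m < j ∧ π w j} k :=
    ⟨⟨hk.least_mem, hk.lt_least, hk.rel⟩, fun j hj => hk.least j hj.1 hj.2.1 hj.2.2⟩
  have hex : ∃ k w, (match χ m with
      | Side.left => IsFirst χ {d | d ∈ S ∧ m < d ∧ d ∉ S.filter fun c => π m c} w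
      | Side.right => IsLast χ {d | d ∈ S ∧ m < d ∧ d ∉ S.filter fun c => π m c} w) ∧
      IsLeast {j | j ∈ S ∧ m < j ∧ π w j} k := ⟨k, w, (key w).2 rfl, hleast⟩
  rw [momentAux, dif_pos hm']
  have hc := hm.choose_eq hm'
  generalize hm'.choose = m' at hc ⊢
  subst hc
  dsimp only
  have hch : hex.choose = k := by
    obtain ⟨w', h₁, h₂⟩ := hex.choose_spec
    obtain rfl := (key w').1 h₁
    exact h₂.unique hleast
  rw [if_neg hV]
  refine (dif_pos hex).trans ?_
  rw [hch]
  rfl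

theorem momentAux_outer (hm : IsTopMin π S m) (h : ¬ ∀ c ∈ S, π m c)
    (hk : IsOuterStep π S m k) (T : Fin n → A) :
    momentAux 𝒜 χ π S T = momentAux 𝒜 χ π (S \ blockOf π S m)
      (Function.update T k (T k * 𝒜.op (χ m) (𝒜.E (orderedProd (blockOf π S m) T)))) := by
  classical
  have hm' : ∃ m, IsGreatest {a | a ∈ S ∧ ∀ c ∈ S, π a c → a ≤ c} m := ⟨m, hm⟩
  have hV : ¬ S.filter (fun c => π m c) = S := fun hV => h fun c hc => by
    rw [← hV] at hc
    exact (Finset.mem_filter.1 hc).2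
  have hD : ∀ d, d ∉ {d | d ∈ S ∧ m < d ∧ d ∉ S.filter fun c => π m c} := by
    rintro d ⟨h₁, h₂, h₃⟩
    exact h₃ (Finset.mem_filter.2 ⟨h₁, hk.rel_of_lt d h₁ h₂⟩)
  have hnex : ¬ ∃ k w, (match χ m with
      | Side.left => IsFirst χ {d | d ∈ S ∧ m < d ∧ d ∉ S.filter fun c => π m c} w
      | Side.right => IsLast χ {d | d ∈ S ∧ m < d ∧ d ∉ S.filter fun c => π m c} w) ∧
      IsLeast {j | j ∈ S ∧ m < j ∧ π w j} k := by
    rintro ⟨k, w, h₁, -⟩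
    rcases (χ m).eq_or_eq with hχ | hχ
    · simp only [hχ] at h₁
      exact hD w h₁.1
    · simp only [hχ] at h₁
      exact hD w h₁.1
  have hgr : IsGreatest {j | j ∈ S ∧ j ∉ S.filter fun c => π m c} k := by
    refine ⟨⟨hk.mem, fun h => hk.not_rel (Finset.mem_filter.1 h).2⟩, ?_⟩
    rintro j ⟨h₁, h₂⟩
    exact hk.greatest j h₁ fun h' => h₂ (Finset.mem_filter.2 ⟨h₁, h'⟩)
  have hex : ∃ k, IsGreatest {j | j ∈ S ∧ j ∉ S.filter fun c => π m c} k := ⟨k, hgr⟩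
  rw [momentAux, dif_pos hm']
  have hc := hm.choose_eq hm'
  generalize hm'.choose = m' at hc ⊢
  subst hc
  dsimp only
  rw [if_neg hV]
  refine (dif_neg hnex).trans ((dif_pos hex).trans ?_)
  rw [hex.choose_spec.unique hgr]
  rfl

theorem momentAux_empty (T : Fin n → A) : momentAux 𝒜 χ π ∅ T = 0 := by
  rw [momentAux, dif_neg]
  rintro ⟨m, hm⟩
  simpa using hm.1.1

theorem IsTopMin.mem (hm : IsTopMin π S m) : m ∈ S := hm.1.1

/-- The other blocks keep their minima when the block of m is removed. Thresholds for tails can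
accordingly be lowered at each step of the recursion. -/
theorem IsTopMin.le_of_sdiff {m' : Fin n} (hm : IsTopMin π S m)
    (hm' : IsTopMin π (S \ blockOf π S m) m') : m' ≤ m := by
  obtain ⟨h₁, h₂⟩ := Finset.mem_sdiff.1 hm'.mem
  refine hm.2 ⟨h₁, fun c hc hmc => hm'.1.2 c (Finset.mem_sdiff.2 ⟨hc, fun hcV => h₂ ?_⟩) hmc⟩
  exact mem_blockOf.2 ⟨h₁, π.trans (mem_blockOf.1 hcV).2 (π.symm hmc)⟩

theorem IsTopMin.sdiff_ssubset (hm : IsTopMin π S m) : S \ blockOf π S m ⊂ S :=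
  Finset.sdiff_ssubset (fun _ hc => (mem_blockOf.1 hc).1)
    ⟨m, mem_blockOf.2 ⟨hm.mem, π.refl m⟩⟩

theorem exists_isTopMin (π : Setoid (Fin n)) (hS : S.Nonempty) : ∃ m, IsTopMin π S m :=
  exists_isGreatest_min π hS

end Space

section Space

variable {B A : Type*} [Ring B] [Algebra ℂ B] [Ring A] [Algebra ℂ A] {𝒜 : BBSpace B A}
  {n : ℕ} {χ : Fin n → Side} {π : Setoid (Fin n)} {S : Finset (Fin n)} {m w k : Fin n}

/-! ### Elements of `B` inside expectations -/

theorem BBSpace.coe_op_congr {s s' : Side} (h : s = s') (b : B) :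
    (𝒜.op s b : A) = 𝒜.op s' b := by
  subst h; rfl

theorem BBSpace.E_mul_op (a : A) (s s' : Side) (b : B) :
    𝒜.E (a * 𝒜.op s b) = 𝒜.E (a * 𝒜.op s' b) := by
  cases s <;> cases s'
  · rfl
  · exact 𝒜.E_left_eq_right a b
  · exact (𝒜.E_left_eq_right a b).symm
  · rfl

theorem BBSpace.E_L_mul (b : B) (a : A) : 𝒜.E (𝒜.L b * a) = b * 𝒜.E a := by
  have := 𝒜.E_mul b 1 a
  rwa [mul_one] at this

theorem BBSpace.E_R_mul (b : B) (a : A) : 𝒜.E (𝒜.R b * a) = 𝒜.E a * b := by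
  have := 𝒜.E_mul 1 b a
  rwa [one_mul] at this

theorem BBSpace.commute_op {s s' : Side} (h : s' ≠ s) (b : B) (T : 𝒜.face s') :
    Commute (𝒜.op s b : A) (T : A) := by
  cases s <;> cases s'
  · exact absurd rfl h
  · exact T.2 _ ⟨b, rfl⟩
  · exact T.2 _ ⟨b, rfl⟩
  · exact absurd rfl h

/-! ### Tuples with the same tails -/

/-- Two tuples that agree at the nodes of `S` above `t`, and whose products over the remaining nodes
of every block cannot be distinguished by `E`. -/
def TailEq (𝒜 : BBSpace B A) (π : Setoid (Fin n)) (S : Finset (Fin n)) (t : Fin n)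
    (T T' : Fin n → A) : Prop :=
  (∀ i ∈ S, i < t → T i = T' i) ∧
    ∀ w ∈ S, ∀ U : Finset (Fin n), (∀ i, i ∈ U ↔ i ∈ S ∧ π w i ∧ t ≤ i) →
      ∀ a, 𝒜.E (a * orderedProd U T) = 𝒜.E (a * orderedProd U T')

/-- Between `t'` and t the tuples agree, and these entries are absorbed into the arbitrary left
factor a. -/
theorem TailEq.mono {t t' : Fin n} {T T' : Fin n → A} (h : TailEq 𝒜 π S t T T') (ht : t' ≤ t) :
    TailEq 𝒜 π S t' T T' := by
  refine ⟨fun i hi hit => h.1 i hi (hit.trans_le ht), fun w hw U hU a => ?_⟩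
  rw [orderedProd_eq_mul U t T, orderedProd_eq_mul U t T', ← mul_assoc, ← mul_assoc,
    orderedProd_congr (T := T) (T' := T') (U := U.filter (· < t))]
  · refine h.2 w hw _ (fun i => ?_) _
    rw [Finset.mem_filter, hU]
    constructor
    · rintro ⟨⟨h₁, h₂, -⟩, h₃⟩
      exact ⟨h₁, h₂, h₃⟩
    · rintro ⟨h₁, h₂, h₃⟩
      exact ⟨⟨h₁, h₂, ht.trans h₃⟩, h₃⟩
  · intro i hi
    obtain ⟨h₁, h₂⟩ := Finset.mem_filter.1 hi
    exact h.1 i ((hU i).1 h₁).1 h₂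

theorem TailEq.E_eq {T T' : Fin n → A} (h : TailEq 𝒜 π S m T T') (hm : IsTopMin π S m) :
    𝒜.E (orderedProd (blockOf π S m) T) = 𝒜.E (orderedProd (blockOf π S m) T') := by
  have := h.2 m hm.mem (blockOf π S m) (fun i => ?_) 1
  · rwa [one_mul, one_mul] at this
  · rw [mem_blockOf]
    exact ⟨fun h => ⟨h.1, h.2, hm.1.2 i h.1 h.2⟩, fun h => ⟨h.1, h.2.1⟩⟩

theorem IsInnerStep.mem_sdiff (hk : IsInnerStep χ π S m w k) : k ∈ S \ blockOf π S m :=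
  Finset.mem_sdiff.2 ⟨hk.least_mem, fun h =>
    hk.not_rel (π.trans (mem_blockOf.1 h).2 (π.symm hk.rel))⟩

theorem IsOuterStep.mem_sdiff (hk : IsOuterStep π S m k) : k ∈ S \ blockOf π S m :=
  Finset.mem_sdiff.2 ⟨hk.mem, fun h => hk.not_rel (mem_blockOf.1 h).2⟩

/-- Below `m`, the node `k` is the first one of its block. -/
theorem IsInnerStep.filter_lt_eq_empty (hk : IsInnerStep χ π S m w k) {w' : Fin n}
    {U : Finset (Fin n)} (hU : ∀ i, i ∈ U ↔ i ∈ S \ blockOf π S m ∧ π w' i ∧ m ≤ i) (hkU : k ∈ U) :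
    U.filter (· < k) = ∅ := by
  refine Finset.filter_eq_empty_iff.2 fun j hj => ?_
  obtain ⟨h₁, h₂, h₃⟩ := (hU j).1 hj
  obtain ⟨h₄, h₅⟩ := Finset.mem_sdiff.1 h₁
  rw [mem_blockOf] at h₅
  have hne : m ≠ j := by
    rintro rfl
    exact h₅ ⟨h₄, π.refl _⟩
  exact not_lt.2 (hk.least j h₄ (lt_of_le_of_ne h₃ hne)
    (π.trans hk.rel (π.trans (π.symm ((hU k).1 hkU).2.1) h₂)))

/-- The block of m is itself a tail and enters only through its expectation. An inner step
multiplies on the left of the first node of a tail, which the arbitrary factor a absorbs. After an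
outer step no remaining node is at or beyond m, and the modified entry is one where the tuples
agree. Equality of tails is thus inherited by the next stage. -/
theorem momentAux_congr (S : Finset (Fin n)) : ∀ (m : Fin n) (T T' : Fin n → A),
    IsTopMin π S m → TailEq 𝒜 π S m T T' →
    momentAux 𝒜 χ π S T = momentAux 𝒜 χ π S T' := by
  induction S using Finset.strongInduction with
  | H S ih =>
  intro m T T' hm hT
  have hE := hT.E_eq hm
  rcases step_cases χ π S m with h | ⟨h, ⟨w, k, hk⟩ | ⟨k, hk⟩⟩
  · rw [momentAux_single hm h, momentAux_single hm h]
    rwa [blockOf_eq_self h] at hE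
  · rw [momentAux_inner hm h hk, momentAux_inner hm h hk, hE]
    obtain ⟨m', hm'⟩ := exists_isTopMin π ⟨k, hk.mem_sdiff⟩
    refine ih _ hm.sdiff_ssubset m' _ _ hm' (TailEq.mono ?_ (hm.le_of_sdiff hm'))
    refine ⟨fun i hi him => ?_, fun w' hw' U hU a => ?_⟩
    · have hik : i ≠ k := (him.trans hk.lt_least).ne
      rw [Function.update_of_ne hik, Function.update_of_ne hik]
      exact hT.1 i (Finset.mem_sdiff.1 hi).1 him
    · have hw'' := Finset.mem_sdiff.1 hw'
      have hU' : ∀ i, i ∈ U ↔ i ∈ S ∧ π w' i ∧ m ≤ i := fun i => by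
        rw [hU, Finset.mem_sdiff]
        refine ⟨fun h => ⟨h.1.1, h.2⟩, fun h => ⟨⟨h.1, fun hi => hw''.2 ?_⟩, h.2⟩⟩
        exact mem_blockOf.2 ⟨hw''.1, π.trans (mem_blockOf.1 hi).2 (π.symm h.2.1)⟩
      have key := hT.2 w' hw''.1 U hU'
      by_cases hkU : k ∈ U
      -- As k comes first in U, the new coefficient stands at the left end of the product over U.
      · have hemp := hk.filter_lt_eq_empty hU hkU
        rw [orderedProd_update hkU, orderedProd_update hkU, mul_assoc, mul_assoc]
        have h₁ := orderedProd_eq_mul_mul hkU T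
        have h₂ := orderedProd_eq_mul_mul hkU T'
        rw [hemp, orderedProd_empty, one_mul] at h₁ h₂ ⊢
        rw [orderedProd_empty, one_mul, ← h₁, ← h₂, ← mul_assoc, ← mul_assoc]
        exact key _
      · rw [orderedProd_update_of_notMem hkU, orderedProd_update_of_notMem hkU]
        exact key a
  · rw [momentAux_outer hm h hk, momentAux_outer hm h hk, hE, hT.1 k hk.mem hk.lt]
    obtain ⟨m', hm'⟩ := exists_isTopMin π ⟨k, hk.mem_sdiff⟩
    refine ih _ hm.sdiff_ssubset m' _ _ hm' (TailEq.mono ?_ (hm.le_of_sdiff hm'))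
    refine ⟨fun i hi him => ?_, fun w' hw' U hU a => ?_⟩
    · by_cases hik : i = k
      · subst hik
        rw [Function.update_self, Function.update_self]
      · rw [Function.update_of_ne hik, Function.update_of_ne hik]
        exact hT.1 i (Finset.mem_sdiff.1 hi).1 him
    · have hemp : U = ∅ := by
        refine Finset.eq_empty_iff_forall_notMem.2 fun i hi => ?_
        obtain ⟨h₁, -, h₃⟩ := (hU i).1 hi
        obtain ⟨h₄, h₅⟩ := Finset.mem_sdiff.1 h₁
        rcases h₃.eq_or_lt with rfl | h₃
        · exact h₅ (mem_blockOf.2 ⟨h₄, π.refl _⟩)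
        · exact h₅ (mem_blockOf.2 ⟨h₄, hk.rel_of_lt i h₄ h₃⟩)
      rw [hemp, orderedProd_empty, orderedProd_empty]

theorem momentAux_congr_of_eq {T T' : Fin n → A} (h : ∀ k ∈ S, T k = T' k) :
    momentAux 𝒜 χ π S T = momentAux 𝒜 χ π S T' := by
  rcases S.eq_empty_or_nonempty with rfl | hS
  · rw [momentAux_empty, momentAux_empty]
  obtain ⟨m, hm⟩ := exists_isTopMin π hS
  refine momentAux_congr S m T T' hm ⟨fun i hi _ => h i hi, fun w hw U hU a => ?_⟩
  rw [orderedProd_congr fun i hi => h i ((hU i).1 hi).1]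

/-! ### The recursion in terms of the order along the boundary -/

theorem coe_insertAfter (T : ∀ k, 𝒜.face (χ k)) (b : B) :
    (fun i => (insertAfter T k b i : A)) =
      Function.update (fun i => (T i : A)) k (𝒜.after (χ k) (T k) b) := by
  funext i
  by_cases h : i = k
  · subst h
    simp [insertAfter]
  · simp [insertAfter, h]

theorem coe_insertBefore (T : ∀ k, 𝒜.face (χ k)) (b : B) :
    (fun i => (insertBefore T k b i : A)) =
      Function.update (fun i => (T i : A)) k (𝒜.before (χ k) (T k) b) := by
  funext i
  by_cases h : i = k
  · subst h
    simp [insertBefore]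
  · simp [insertBefore, h]

/-- Remaining nodes above m do not compete with w: those on the left precede m, and those on the
right come after all nodes below m. -/
theorem IsInnerStep.isSucc (hk : IsInnerStep χ π S m w k) (hχ : χ m = Side.left) :
    IsSucc χ (S \ blockOf π S m) (pos χ m) w := by
  have hm := m.2
  have hw := w.2
  have hmw := hk.lt
  rw [Fin.lt_def] at hmw
  refine ⟨Finset.mem_sdiff.2 ⟨hk.mem, fun h => hk.not_rel (mem_blockOf.1 h).2⟩, ?_, ?_⟩
  · rw [pos_left hχ]
    rcases (χ w).eq_or_eq with h | h
    · rw [pos_left h]; omega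
    · rw [pos_right h]; omega
  · intro d hd hmd
    obtain ⟨h₁, h₂⟩ := Finset.mem_sdiff.1 hd
    have h₃ : ¬ π m d := fun h => h₂ (mem_blockOf.2 ⟨h₁, h⟩)
    rcases lt_trichotomy m d with h | rfl | h
    · exact hk.nearest_left hχ d h₁ h h₃
    · exact absurd (π.refl _) h₃
    · have hd := d.2
      rw [Fin.lt_def] at h
      rw [pos_left hχ] at hmd
      rcases (χ d).eq_or_eq with h' | h'
      · rw [pos_left h'] at hmd
        omega
      · rw [pos_right h']
        rcases (χ w).eq_or_eq with h'' | h''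
        · rw [pos_left h'']; omega
        · rw [pos_right h'']; omega

theorem IsInnerStep.isPred (hk : IsInnerStep χ π S m w k) (hχ : χ m = Side.right) :
    IsPred χ (S \ blockOf π S m) (pos χ m) w := by
  have hm := m.2
  have hw := w.2
  have hmw := hk.lt
  rw [Fin.lt_def] at hmw
  refine ⟨Finset.mem_sdiff.2 ⟨hk.mem, fun h => hk.not_rel (mem_blockOf.1 h).2⟩, ?_, ?_⟩
  · rw [pos_right hχ]
    rcases (χ w).eq_or_eq with h | h
    · rw [pos_left h]; omega
    · rw [pos_right h]; omega
  · intro d hd hmd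
    obtain ⟨h₁, h₂⟩ := Finset.mem_sdiff.1 hd
    have h₃ : ¬ π m d := fun h => h₂ (mem_blockOf.2 ⟨h₁, h⟩)
    rcases lt_trichotomy m d with h | rfl | h
    · exact hk.nearest_right hχ d h₁ h h₃
    · exact absurd (π.refl _) h₃
    · have hd := d.2
      rw [Fin.lt_def] at h
      rw [pos_right hχ] at hmd
      rcases (χ d).eq_or_eq with h' | h'
      · rw [pos_left h']
        rcases (χ w).eq_or_eq with h'' | h''
        · rw [pos_left h'']; omega
        · rw [pos_right h'']; omega
      · rw [pos_right h'] at hmd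
        omega

theorem IsOuterStep.lt_of_mem_sdiff (hk : IsOuterStep π S m k) {d : Fin n}
    (hd : d ∈ S \ blockOf π S m) : d < m ∧ d ≤ k := by
  obtain ⟨h₁, h₂⟩ := Finset.mem_sdiff.1 hd
  have h₃ : ¬ π m d := fun h => h₂ (mem_blockOf.2 ⟨h₁, h⟩)
  have h₄ := hk.greatest d h₁ h₃
  exact ⟨h₄.trans_lt hk.lt, h₄⟩

theorem IsOuterStep.isPred (hk : IsOuterStep π S m k) (hχ : χ k = Side.left) :
    IsPred χ (S \ blockOf π S m) (pos χ m) k := by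
  have hm := m.2
  have hkm := hk.lt
  rw [Fin.lt_def] at hkm
  refine ⟨hk.mem_sdiff, ?_, fun d hd hdm => ?_⟩
  · rw [pos_left hχ]
    rcases (χ m).eq_or_eq with h | h
    · rw [pos_left h]; omega
    · rw [pos_right h]; omega
  · obtain ⟨h₁, h₂⟩ := hk.lt_of_mem_sdiff hd
    rw [Fin.lt_def] at h₁
    rw [Fin.le_def] at h₂
    have := d.2
    rw [pos_left hχ]
    rcases (χ d).eq_or_eq with h | h
    · rw [pos_left h]; omega
    · rw [pos_right h] at hdm
      rcases (χ m).eq_or_eq with h' | h'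
      · rw [pos_left h'] at hdm; omega
      · rw [pos_right h'] at hdm; omega

theorem IsOuterStep.isSucc (hk : IsOuterStep π S m k) (hχ : χ k = Side.right) :
    IsSucc χ (S \ blockOf π S m) (pos χ m) k := by
  have hm := m.2
  have hkm := hk.lt
  rw [Fin.lt_def] at hkm
  refine ⟨hk.mem_sdiff, ?_, fun d hd hdm => ?_⟩
  · rw [pos_right hχ]
    rcases (χ m).eq_or_eq with h | h
    · rw [pos_left h]; omega
    · rw [pos_right h]; omega
  · obtain ⟨h₁, h₂⟩ := hk.lt_of_mem_sdiff hd
    rw [Fin.lt_def] at h₁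
    rw [Fin.le_def] at h₂
    have := d.2
    rw [pos_right hχ]
    rcases (χ d).eq_or_eq with h | h
    · rw [pos_left h] at hdm
      rcases (χ m).eq_or_eq with h' | h'
      · rw [pos_left h'] at hdm; omega
      · rw [pos_right h'] at hdm; omega
    · rw [pos_right h]; omega

/-- Multiplication from the left by the copy of `b` on the side of `m`, at the first node below `m`
on the adjacent spine, amounts to an insertion of `b` at the node of that spine nearest to `m`. -/
theorem IsInnerStep.tailEq (hk : IsInnerStep χ π S m w k) (T : ∀ k, 𝒜.face (χ k)) (b : B) (y : A)
    (h₁ : χ w = χ m → y = 𝒜.op (χ m) b * T w) (h₂ : χ w ≠ χ m → y = T w * 𝒜.op (χ w) b) :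
    TailEq 𝒜 π (S \ blockOf π S m) m
      (Function.update (fun i => (T i : A)) k (𝒜.op (χ m) b * T k))
      (Function.update (fun i => (T i : A)) w y) := by
  refine ⟨fun i hi him => ?_, fun w' hw' U hU a => ?_⟩
  · rw [Function.update_of_ne (him.trans hk.lt_least).ne, Function.update_of_ne (him.trans hk.lt).ne]
  have hwS : w ∈ S \ blockOf π S m :=
    Finset.mem_sdiff.2 ⟨hk.mem, fun h => hk.not_rel (mem_blockOf.1 h).2⟩
  by_cases hkU : k ∈ U
  · have hwU : w ∈ U := (hU w).2 ⟨hwS, π.trans ((hU k).1 hkU).2.1 (π.symm hk.rel), hk.lt.le⟩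
    have hUT := orderedProd_eq_mul_mul hkU fun i => (T i : A)
    have hUw := orderedProd_eq_mul_mul hwU fun i => (T i : A)
    rw [orderedProd_update hkU, orderedProd_update hwU]
    -- The multiplication at k puts the copy of b at the left end of the product over U; it has to
    -- travel right, as far as w.
    rw [hk.filter_lt_eq_empty hU hkU, orderedProd_empty, one_mul] at hUT ⊢
    rw [mul_assoc (𝒜.op (χ m) b : A), ← hUT]
    have hnear : ∀ i ∈ U, (χ m = Side.left → pos χ w ≤ pos χ i) ∧
        (χ m = Side.right → pos χ i ≤ pos χ w) := by
      intro i hi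
      obtain ⟨a₁, -, a₃⟩ := (hU i).1 hi
      obtain ⟨a₄, a₅⟩ := Finset.mem_sdiff.1 a₁
      have a₆ : ¬ π m i := fun h => a₅ (mem_blockOf.2 ⟨a₄, h⟩)
      have a₇ : m < i := lt_of_le_of_ne a₃ fun h => a₆ (h ▸ π.refl m)
      exact ⟨fun h => hk.nearest_left h i a₄ a₇ a₆, fun h => hk.nearest_right h i a₄ a₇ a₆⟩
    by_cases hχ : χ w = χ m
    -- If w is on the side of m, then the nodes of U above w are all on the opposite side, since
    -- otherwise one of them would be nearer to m. The copy of b commutes past them.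
    · rw [h₁ hχ, hUw, mul_assoc (𝒜.op (χ m) b : A), ← mul_assoc, ← mul_assoc, ← mul_assoc a,
        ← mul_assoc (a * _)]
      have hc : Commute (𝒜.op (χ m) b : A) (orderedProd (U.filter (· < w)) fun i => (T i : A)) := by
        refine commute_orderedProd fun i hi => BBSpace.commute_op (fun hi' => ?_) b (T i)
        obtain ⟨hi, hiw⟩ := Finset.mem_filter.1 hi
        obtain ⟨a₁, a₂⟩ := hnear i hi
        rw [Fin.lt_def] at hiw
        have := w.2
        rcases (χ m).eq_or_eq with h | h
        · have := a₁ h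
          rw [pos_left (hχ.trans h), pos_left (hi'.trans h)] at this
          omega
        · have := a₂ h
          rw [pos_right (hχ.trans h), pos_right (hi'.trans h)] at this
          omega
      rw [mul_assoc a, mul_assoc a, hc.eq]
      simp only [mul_assoc]
    -- If the node nearest to m is on the opposite side, all of U is there and w is its last node.
    -- The copy of b commutes to the right end, where the expectation lets it change sides.
    · have hside : ∀ i ∈ U, χ i ≠ χ m ∧ i ≤ w := by
        intro i hi
        obtain ⟨a₁, a₂⟩ := hnear i hi
        have := w.2
        have := i.2
        rw [Fin.le_def]
        rcases (χ m).eq_or_eq with h | h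
        · have a₃ := a₁ h
          rw [h] at hχ ⊢
          rw [pos_right (Side.ne_left.1 hχ)] at a₃
          rcases (χ i).eq_or_eq with h' | h'
          · rw [pos_left h'] at a₃
            omega
          · rw [pos_right h'] at a₃
            exact ⟨Side.ne_left.2 h', by omega⟩
        · have a₃ := a₂ h
          rw [h] at hχ ⊢
          rw [pos_left (Side.ne_right.1 hχ)] at a₃
          rcases (χ i).eq_or_eq with h' | h'
          · rw [pos_left h'] at a₃
            exact ⟨Side.ne_right.2 h', a₃⟩
          · rw [pos_right h'] at a₃
            omega
      have hemp : U.filter (w < ·) = ∅ :=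
        Finset.filter_eq_empty_iff.2 fun i hi => not_lt.2 (hside i hi).2
      have hc : Commute (𝒜.op (χ m) b : A) (orderedProd U fun i => (T i : A)) :=
        commute_orderedProd fun i hi => BBSpace.commute_op (hside i hi).1 b (T i)
      rw [hemp, orderedProd_empty, mul_one] at hUw
      rw [hemp, orderedProd_empty, mul_one, hc.eq, ← mul_assoc, BBSpace.E_mul_op _ _ (χ w), h₂ hχ,
        hUw]
      simp only [mul_assoc]
  · have hwU : w ∉ U := fun h => hkU ((hU k).2
      ⟨hk.mem_sdiff, π.trans ((hU w).1 h).2.1 hk.rel, hk.lt_least.le⟩)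
    rw [orderedProd_update_of_notMem hkU, orderedProd_update_of_notMem hwU]

/-- As k is the last remaining node, the coefficient stands at the right end of an expectation,
where `L_b` and `R_b` are interchangeable. -/
theorem IsOuterStep.tailEq (hk : IsOuterStep π S m k) (T : Fin n → A) (s s' : Side) (b : B) :
    TailEq 𝒜 π (S \ blockOf π S m) k (Function.update T k (T k * 𝒜.op s b))
      (Function.update T k (T k * 𝒜.op s' b)) := by
  refine ⟨fun i hi him => ?_, fun w' hw' U hU a => ?_⟩
  · rw [Function.update_of_ne him.ne, Function.update_of_ne him.ne]
  by_cases hkU : k ∈ U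
  · have hemp : U.filter (k < ·) = ∅ := Finset.filter_eq_empty_iff.2 fun i hi =>
      not_lt.2 (hk.lt_of_mem_sdiff ((hU i).1 hi).1).2
    rw [orderedProd_update hkU, orderedProd_update hkU, hemp, orderedProd_empty, mul_one, mul_one]
    simp only [← mul_assoc]
    exact BBSpace.E_mul_op _ _ _ _
  · rw [orderedProd_update_of_notMem hkU, orderedProd_update_of_notMem hkU]

/-- The recursion for the moments, in terms of the order along the boundary. -/
theorem momentAux_reduce (hm : IsTopMin π S m) (h : ¬ ∀ c ∈ S, π m c) (T : ∀ k, 𝒜.face (χ k)) :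
    (∃ θ, IsPred χ (S \ blockOf π S m) (pos χ m) θ ∧ momentAux 𝒜 χ π S (fun i => (T i : A)) =
      momentAux 𝒜 χ π (S \ blockOf π S m) (fun i => (insertAfter T θ
        (𝒜.E (orderedProd (blockOf π S m) fun i => (T i : A))) i : A))) ∨
    (∃ γ, IsSucc χ (S \ blockOf π S m) (pos χ m) γ ∧ momentAux 𝒜 χ π S (fun i => (T i : A)) =
      momentAux 𝒜 χ π (S \ blockOf π S m) (fun i => (insertBefore T γ
        (𝒜.E (orderedProd (blockOf π S m) fun i => (T i : A))) i : A))) := by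
  rcases step_cases χ π S m with h' | ⟨-, ⟨w, k, hk⟩ | ⟨k, hk⟩⟩
  · exact absurd h' h
  · obtain ⟨m', hm'⟩ := exists_isTopMin π ⟨k, hk.mem_sdiff⟩
    have hle := hm.le_of_sdiff hm'
    rcases (χ m).eq_or_eq with hχ | hχ
    · refine Or.inr ⟨w, hk.isSucc hχ, ?_⟩
      rw [momentAux_inner hm h hk, coe_insertBefore]
      refine momentAux_congr _ m' _ _ hm' ((hk.tailEq T _ _ (fun hw => ?_) fun hw => ?_).mono hle)
      · rw [BBSpace.before_of_left (hw.trans hχ), Subalgebra.coe_mul, BBSpace.coe_op_congr hw]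
      · rw [hχ] at hw
        rw [BBSpace.before_of_right (Side.ne_left.1 hw), Subalgebra.coe_mul]
    · refine Or.inl ⟨w, hk.isPred hχ, ?_⟩
      rw [momentAux_inner hm h hk, coe_insertAfter]
      refine momentAux_congr _ m' _ _ hm' ((hk.tailEq T _ _ (fun hw => ?_) fun hw => ?_).mono hle)
      · rw [BBSpace.after_of_right (hw.trans hχ), Subalgebra.coe_mul, BBSpace.coe_op_congr hw]
      · rw [hχ] at hw
        rw [BBSpace.after_of_left (Side.ne_right.1 hw), Subalgebra.coe_mul]
  · obtain ⟨m', hm'⟩ := exists_isTopMin π ⟨k, hk.mem_sdiff⟩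
    have hle := (hk.lt_of_mem_sdiff hm'.mem).2
    -- The recursion multiplies by the copy of b on the side of m, whereas an insertion at k
    -- requires the copy on the side of k.
    have key := momentAux_congr (𝒜 := 𝒜) (χ := χ) _ m' _ _ hm' ((hk.tailEq (fun i => (T i : A)) (χ m) (χ k)
      (𝒜.E (orderedProd (blockOf π S m) fun i => (T i : A)))).mono hle)
    rw [momentAux_outer hm h hk, key]
    rcases (χ k).eq_or_eq with hχ | hχ
    · refine Or.inl ⟨k, hk.isPred hχ, ?_⟩
      rw [coe_insertAfter, BBSpace.after_of_left hχ, Subalgebra.coe_mul]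
    · refine Or.inr ⟨k, hk.isSucc hχ, ?_⟩
      rw [coe_insertBefore, BBSpace.before_of_right hχ, Subalgebra.coe_mul]

end Space

section Space

variable {B A : Type*} [Ring B] [Algebra ℂ B] [Ring A] [Algebra ℂ A] {𝒜 : BBSpace B A}
  {n : ℕ} {χ : Fin n → Side} {π : Setoid (Fin n)} {S : Finset (Fin n)} {m w k : Fin n}

/-! ### Linearity of the moments -/

theorem isLinearMap_orderedProd_update {U : Finset (Fin n)} (hk : k ∈ U) (T : Fin n → A) :
    IsLinearMap ℂ fun x => orderedProd U (Function.update T k x) := by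
  simp only [orderedProd_update hk]
  exact ⟨fun x y => by rw [add_mul, mul_add], fun c x => by rw [smul_mul_assoc, mul_smul_comm]⟩

theorem BBSpace.isLinearMap_coe_op_E {f : A → A} (hf : IsLinearMap ℂ f) (s : Side) :
    IsLinearMap ℂ fun x => (𝒜.op s (𝒜.E (f x)) : A) :=
  ((𝒜.face s).val.toLinearMap ∘ₗ (BBSpace.op_isLinearMap s).mk' _ ∘ₗ 𝒜.E ∘ₗ hf.mk' _).isLinear

/-- One step of the recursion preserves linearity. -/
theorem isLinearMap_step {F : (Fin n → A) → B} {V S' : Finset (Fin n)} {k j : Fin n} {s : Side}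
    (μ : A →ₗ[ℂ] A →ₗ[ℂ] A) (T : Fin n → A) (hkV : k ∉ V) (hj : j ∈ V ∨ j ∈ S') (hjV : j ∈ S' → j ∉ V)
    (hloc : ∀ T T', (∀ i ∈ S', T i = T' i) → F T = F T')
    (hV : ∀ i ∈ V, i ∉ S')
    (hk : IsLinearMap ℂ fun x => F (Function.update T k x))
    (hF : ∀ T, j ∈ S' → IsLinearMap ℂ fun x => F (Function.update T j x)) :
    IsLinearMap ℂ fun x => F (Function.update (Function.update T j x) k
      (μ (𝒜.op s (𝒜.E (orderedProd V (Function.update T j x)))) (Function.update T j x k))) := by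
  -- A variable entry in the removed block V enters only through the coefficient. One in the
  -- remaining set leaves the coefficient constant, and is either the multiplied entry itself or
  -- untouched by this step.
  rcases hj with hj | hj
  · have hne : k ≠ j := fun h => hkV (h ▸ hj)
    have heq : ∀ x, F (Function.update (Function.update T j x) k
        (μ (𝒜.op s (𝒜.E (orderedProd V (Function.update T j x)))) (Function.update T j x k))) =
        F (Function.update T k
          (μ (𝒜.op s (𝒜.E (orderedProd V (Function.update T j x)))) (T k))) := by
      intro x
      rw [Function.update_of_ne hne]
      refine hloc _ _ fun i hi => ?_
      have hij : i ≠ j := fun h => hV j hj (h ▸ hi)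
      by_cases hik : i = k
      · subst hik
        rw [Function.update_self, Function.update_self]
      · rw [Function.update_of_ne hik, Function.update_of_ne hij, Function.update_of_ne hik]
    simp only [heq]
    exact (hk.mk' _ ∘ₗ μ.flip (T k) ∘ₗ
      (BBSpace.isLinearMap_coe_op_E (isLinearMap_orderedProd_update hj T) s).mk' _).isLinear
  · have hjV := hjV hj
    simp only [orderedProd_update_of_notMem hjV]
    by_cases hjk : j = k
    · subst hjk
      simp only [Function.update_self, Function.update_idem]
      exact (hk.mk' _ ∘ₗ μ _).isLinear
    · simp only [Function.update_of_ne (Ne.symm hjk), Function.update_comm hjk]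
      exact hF _ hj

theorem isLinearMap_momentAux (S : Finset (Fin n)) : ∀ (j : Fin n) (T : Fin n → A), j ∈ S →
    IsLinearMap ℂ fun x => momentAux 𝒜 χ π S (Function.update T j x) := by
  induction S using Finset.strongInduction with
  | H S ih =>
  intro j T hj
  obtain ⟨m, hm⟩ := exists_isTopMin π ⟨j, hj⟩
  have hV : ∀ i ∈ blockOf π S m, i ∉ S \ blockOf π S m := fun i hi h => (Finset.mem_sdiff.1 h).2 hi
  have hj' : j ∈ blockOf π S m ∨ j ∈ S \ blockOf π S m := by
    by_cases h : j ∈ blockOf π S m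
    · exact Or.inl h
    · exact Or.inr (Finset.mem_sdiff.2 ⟨hj, h⟩)
  rcases step_cases χ π S m with h | ⟨h, ⟨w, k, hk⟩ | ⟨k, hk⟩⟩
  · simp only [momentAux_single hm h]
    exact (𝒜.E ∘ₗ (isLinearMap_orderedProd_update hj T).mk' _).isLinear
  · simp only [momentAux_inner hm h hk]
    exact isLinearMap_step (LinearMap.mul ℂ A) T (Finset.mem_sdiff.1 hk.mem_sdiff).2 hj'
      (fun h => (Finset.mem_sdiff.1 h).2) (fun T T' => momentAux_congr_of_eq) hV
      (ih _ hm.sdiff_ssubset k T hk.mem_sdiff) fun T h => ih _ hm.sdiff_ssubset j T h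
  · simp only [momentAux_outer hm h hk]
    exact isLinearMap_step (LinearMap.mul ℂ A).flip T (Finset.mem_sdiff.1 hk.mem_sdiff).2 hj'
      (fun h => (Finset.mem_sdiff.1 h).2) (fun T T' => momentAux_congr_of_eq) hV
      (ih _ hm.sdiff_ssubset k T hk.mem_sdiff) fun T h => ih _ hm.sdiff_ssubset j T h

theorem coe_update (T : ∀ k, 𝒜.face (χ k)) (k : Fin n) (x : 𝒜.face (χ k)) :
    (fun i => (Function.update T k x i : A)) = Function.update (fun i => (T i : A)) k x := by
  funext i
  by_cases h : i = k
  · subst h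
    simp
  · simp [h]

theorem momentFunction_linear (π : BNC χ) (T : ∀ k, 𝒜.face (χ k)) (k : Fin n) :
    IsLinearMap ℂ fun x : 𝒜.face (χ k) => momentFunction 𝒜 χ π (Function.update T k x) := by
  simp only [momentFunction, moment, coe_update]
  exact ((isLinearMap_momentAux (χ := χ) (π := π.1) Finset.univ k (fun i => (T i : A))
    (Finset.mem_univ k)).mk' _ ∘ₗ (𝒜.face (χ k)).val.toLinearMap).isLinear

/-! ### Restriction of the moments -/

theorem blockOf_map {m' : ℕ} (e : Fin m' ↪o Fin n) (S : Finset (Fin m')) (m : Fin m') :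
    blockOf π (S.map e.toEmbedding) (e m) =
      (blockOf (Setoid.comap e π) S m).map e.toEmbedding := by
  ext c
  simp only [mem_blockOf, Finset.mem_map]
  constructor
  · rintro ⟨⟨a, ha, rfl⟩, h⟩
    exact ⟨a, ⟨ha, h⟩, rfl⟩
  · rintro ⟨a, ⟨ha, h⟩, rfl⟩
    exact ⟨⟨a, ha, rfl⟩, h⟩

theorem pos_comp_le {m' : ℕ} (e : Fin m' ↪o Fin n) (a b : Fin m') :
    pos (fun k => χ (e k)) a ≤ pos (fun k => χ (e k)) b ↔ pos χ (e a) ≤ pos χ (e b) := by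
  have h₁ := e.lt_iff_lt (a := a) (b := b)
  have h₂ := e.lt_iff_lt (a := b) (b := a)
  simp only [Fin.lt_def] at h₁ h₂
  have := a.2
  have := b.2
  have := (e a).2
  have := (e b).2
  rcases (χ (e a)).eq_or_eq with ha | ha <;> rcases (χ (e b)).eq_or_eq with hb | hb
  · rw [pos_left (χ := fun k => χ (e k)) ha, pos_left (χ := fun k => χ (e k)) hb, pos_left ha,
      pos_left hb]
    omega
  · rw [pos_left (χ := fun k => χ (e k)) ha, pos_right (χ := fun k => χ (e k)) hb, pos_left ha,
      pos_right hb]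
    omega
  · rw [pos_right (χ := fun k => χ (e k)) ha, pos_left (χ := fun k => χ (e k)) hb, pos_right ha,
      pos_left hb]
    omega
  · rw [pos_right (χ := fun k => χ (e k)) ha, pos_right (χ := fun k => χ (e k)) hb, pos_right ha,
      pos_right hb]
    omega

/-- The recursion works on subsets of a fixed set of nodes, while restrictions renumber. All of its
choices are made by comparing nodes in the natural or the boundary order, and an increasing map
preserves both. -/
theorem momentAux_map {m' : ℕ} (e : Fin m' ↪o Fin n) (S : Finset (Fin m')) : ∀ T : Fin n → A,
    momentAux 𝒜 χ π (S.map e.toEmbedding) T =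
      momentAux 𝒜 (fun k => χ (e k)) (Setoid.comap e π) S fun k => T (e k) := by
  induction S using Finset.strongInduction with
  | H S ih =>
  intro T
  rcases S.eq_empty_or_nonempty with rfl | hS
  · rw [Finset.map_empty, momentAux_empty, momentAux_empty]
  obtain ⟨m, hm⟩ := exists_isTopMin (Setoid.comap e π) hS
  have hmem : ∀ a, e a ∈ S.map e.toEmbedding ↔ a ∈ S := fun a => Finset.mem_map' e.toEmbedding
  have hex : ∀ {c}, c ∈ S.map e.toEmbedding → ∃ a ∈ S, e a = c := fun hc => Finset.mem_map.1 hc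
  have hm' : IsTopMin π (S.map e.toEmbedding) (e m) := by
    refine ⟨⟨(hmem m).2 hm.mem, fun c hc hmc => ?_⟩, ?_⟩
    · obtain ⟨a, ha, rfl⟩ := hex hc
      exact e.le_iff_le.2 (hm.1.2 a ha hmc)
    · rintro c ⟨hc, hmin⟩
      obtain ⟨a, ha, rfl⟩ := hex hc
      exact e.le_iff_le.2 (hm.2 ⟨ha, fun c hc hac => e.le_iff_le.1 (hmin (e c) ((hmem c).2 hc) hac)⟩)
  have hupd : ∀ (k : Fin m') (x : A), (fun i => Function.update T (e k) x (e i)) =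
      Function.update (fun i => T (e i)) k x := fun k x =>
    Function.update_comp_eq_of_injective T e.injective k x
  have hsd : S.map e.toEmbedding \ blockOf π (S.map e.toEmbedding) (e m) =
      (S \ blockOf (Setoid.comap e π) S m).map e.toEmbedding := by
    rw [blockOf_map, ← Finset.map_sdiff]
  rcases step_cases (fun k => χ (e k)) (Setoid.comap e π) S m with h | ⟨h, ⟨w, k, hk⟩ | ⟨k, hk⟩⟩
  · rw [momentAux_single hm h, momentAux_single hm', orderedProd_map]
    intro c hc
    obtain ⟨a, ha, rfl⟩ := hex hc
    exact h a ha
  · have h' : ¬ ∀ c ∈ S.map e.toEmbedding, π (e m) c := fun h' =>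
      h fun c hc => h' (e c) ((hmem c).2 hc)
    have hk' : IsInnerStep χ π (S.map e.toEmbedding) (e m) (e w) (e k) := by
      refine ⟨(hmem w).2 hk.mem, e.lt_iff_lt.2 hk.lt, hk.not_rel, fun hχ d hd hmd hr => ?_,
        fun hχ d hd hmd hr => ?_, (hmem k).2 hk.least_mem, e.lt_iff_lt.2 hk.lt_least, hk.rel,
        fun j hj hmj hr => ?_⟩
      · obtain ⟨a, ha, rfl⟩ := hex hd
        exact (pos_comp_le e w a).1 (hk.nearest_left hχ a ha (e.lt_iff_lt.1 hmd) hr)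
      · obtain ⟨a, ha, rfl⟩ := hex hd
        exact (pos_comp_le e a w).1 (hk.nearest_right hχ a ha (e.lt_iff_lt.1 hmd) hr)
      · obtain ⟨a, ha, rfl⟩ := hex hj
        exact e.le_iff_le.2 (hk.least a ha (e.lt_iff_lt.1 hmj) hr)
    rw [momentAux_inner hm h hk, momentAux_inner hm' h' hk', hsd, ih _ hm.sdiff_ssubset, hupd,
      blockOf_map, orderedProd_map]
  · have h' : ¬ ∀ c ∈ S.map e.toEmbedding, π (e m) c := fun h' =>
      h fun c hc => h' (e c) ((hmem c).2 hc)
    have hk' : IsOuterStep π (S.map e.toEmbedding) (e m) (e k) := by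
      refine ⟨fun d hd hmd => ?_, (hmem k).2 hk.mem, hk.not_rel, fun j hj hr => ?_⟩
      · obtain ⟨a, ha, rfl⟩ := hex hd
        exact hk.rel_of_lt a ha (e.lt_iff_lt.1 hmd)
      · obtain ⟨a, ha, rfl⟩ := hex hj
        exact e.le_iff_le.2 (hk.greatest a ha hr)
    rw [momentAux_outer hm h hk, momentAux_outer hm' h' hk', hsd, ih _ hm.sdiff_ssubset, hupd,
      blockOf_map, orderedProd_map]

theorem map_enum_univ (S : Finset (Fin n)) : Finset.univ.map (enum S).toEmbedding = S := by
  ext k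
  simp only [Finset.mem_map, Finset.mem_univ, true_and]
  constructor
  · rintro ⟨i, rfl⟩
    exact enum_mem S i
  · exact exists_enum_eq

theorem momentFunction_on (π : BNC χ) (T : ∀ k, 𝒜.face (χ k)) (S : Finset (Fin n)) :
    (momentFunction 𝒜).on π T S = momentAux 𝒜 χ π.1 S fun i => (T i : A) := by
  have := momentAux_map (𝒜 := 𝒜) (χ := χ) (π := π.1) (enum S) Finset.univ fun i => (T i : A)
  rw [map_enum_univ] at this
  rw [this]
  rfl

/-! ### The shift rules for the moments -/

theorem momentFunction_one (k : Fin n) (T : ∀ k, 𝒜.face (χ k)) :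
    momentFunction 𝒜 χ (BNC.one χ) T = 𝒜.E (orderedProd Finset.univ fun i => (T i : A)) := by
  obtain ⟨m, hm⟩ := exists_isTopMin (BNC.one χ).1 ⟨k, Finset.mem_univ k⟩
  exact momentAux_single hm (fun _ _ => trivial) _

theorem filter_last_lt_eq_empty (U : Finset (Fin (n + 1))) : U.filter (Fin.last n < ·) = ∅ :=
  Finset.filter_eq_empty_iff.2 fun i _ => not_lt.2 (Fin.le_last i)

/-- For one block the moment is the expectation of a product, through which a copy of b can move
past entries of the opposite face. It stops at the next node of its own side, or leaves the
expectation at the left end; at the right end it may change sides. -/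
theorem momentFunction_hasShiftRules : HasShiftRules (momentFunction 𝒜) where
  prop_i := by
    intro n χ T b q ⟨hq, hmax⟩
    rw [momentFunction_one (Fin.last n), momentFunction_one (Fin.last n), coe_update, coe_update,
      orderedProd_update (Finset.mem_univ _), orderedProd_update (Finset.mem_univ _),
      filter_last_lt_eq_empty, orderedProd_empty, mul_one, Subalgebra.coe_mul, Subalgebra.coe_mul,
      ← mul_assoc, BBSpace.E_mul_op _ _ (χ q)]
    have h₁ := orderedProd_eq_mul_mul (Finset.mem_univ (Fin.last n)) fun i => (T i : A)
    have h₂ := orderedProd_eq_mul_mul (Finset.mem_univ q) fun i => (T i : A)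
    rw [filter_last_lt_eq_empty, orderedProd_empty, mul_one] at h₁
    have hc : Commute (𝒜.op (χ q) b : A)
        (orderedProd (Finset.univ.filter (q < ·)) fun i => (T i : A)) := by
      refine commute_orderedProd fun i hi => BBSpace.commute_op (fun hi' => ?_) b (T i)
      exact not_le.2 (Finset.mem_filter.1 hi).2 (hmax (show χ i ≠ χ (Fin.last n) from hi' ▸ hq))
    rw [← h₁, h₂, mul_assoc (T q : A), hc.eq]
    simp only [mul_assoc]
  prop_i_empty := by
    intro n χ T b hemp
    have hall : ∀ k, χ k = χ (Fin.last n) := fun k => by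
      by_contra hk
      exact (Set.eq_empty_iff_forall_notMem.1 hemp) k hk
    rw [momentFunction_one (Fin.last n), momentFunction_one (Fin.last n), coe_update,
      orderedProd_update (Finset.mem_univ _),
      filter_last_lt_eq_empty, orderedProd_empty, mul_one, Subalgebra.coe_mul, ← mul_assoc]
    have h₁ := orderedProd_eq_mul_mul (Finset.mem_univ (Fin.last n)) fun i => (T i : A)
    rw [filter_last_lt_eq_empty, orderedProd_empty, mul_one] at h₁
    rw [← h₁]
    have hc : ∀ s, s ≠ χ (Fin.last n) → Commute (𝒜.op s b : A)
        (orderedProd Finset.univ fun i => (T i : A)) := fun s hs =>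
      commute_orderedProd fun i _ => BBSpace.commute_op (fun hi' => hs (hi'.symm.trans (hall i))) b
        (T i)
    -- With all entries on one side, the copy of b on the other side commutes with the entire
    -- product; switching sides under E first lets it leave at the left end.
    rcases (χ (Fin.last n)).eq_or_eq with h | h
    · rw [BBSpace.E_mul_op _ _ Side.right, ← (hc Side.right (by simp [h])).eq, h,
        BBSpace.coe_op_right, BBSpace.E_R_mul]
    · rw [BBSpace.E_mul_op _ _ Side.left, ← (hc Side.left (by simp [h])).eq, h,
        BBSpace.coe_op_left, BBSpace.E_L_mul]
  prop_ii := by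
    intro n χ T b p q ⟨⟨hq, hqp⟩, hmax⟩
    rw [momentFunction_one p, momentFunction_one p, coe_update, coe_update,
      orderedProd_update (Finset.mem_univ p), Subalgebra.coe_mul, Subalgebra.coe_mul,
      orderedProd_eq_mul_mul (Finset.mem_univ p) (Function.update _ _ _),
      Function.update_of_ne hqp.ne', orderedProd_update_of_notMem (U := Finset.univ.filter (p < ·))
        (by simpa using hqp.le)]
    have hqU : q ∈ Finset.univ.filter (· < p) := by simpa using hqp
    have hc : Commute (𝒜.op (χ q) b : A)
        (orderedProd ((Finset.univ.filter (· < p)).filter (q < ·)) fun i => (T i : A)) := by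
      refine commute_orderedProd fun i hi => BBSpace.commute_op (fun hi' => ?_) b (T i)
      obtain ⟨h₁, h₂⟩ := Finset.mem_filter.1 hi
      exact not_le.2 h₂ (hmax ⟨hi'.trans hq, (Finset.mem_filter.1 h₁).2⟩)
    rw [orderedProd_update hqU, orderedProd_eq_mul_mul hqU (fun i => (T i : A)),
      mul_assoc (T q : A), hc.eq, BBSpace.coe_op_congr hq]
    simp only [mul_assoc]
  prop_ii_empty := by
    intro n χ T b p hemp
    rw [momentFunction_one p, momentFunction_one p, coe_update,
      orderedProd_update (Finset.mem_univ p), Subalgebra.coe_mul]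
    have hc : Commute (𝒜.op (χ p) b : A)
        (orderedProd (Finset.univ.filter (· < p)) fun i => (T i : A)) := by
      refine commute_orderedProd fun i hi => BBSpace.commute_op (fun hi' => ?_) b (T i)
      exact (Set.eq_empty_iff_forall_notMem.1 hemp) i ⟨hi', (Finset.mem_filter.1 hi).2⟩
    rw [mul_assoc (𝒜.op (χ p) b : A), ← mul_assoc, ← hc.eq, mul_assoc,
      ← orderedProd_eq_mul_mul (Finset.mem_univ p)]
    rcases (χ p).eq_or_eq with h | h
    · rw [h, BBSpace.coe_op_left, BBSpace.E_L_mul]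
    · rw [h, BBSpace.coe_op_right, BBSpace.E_R_mul]

theorem momentFunction_isEvaluation (π : BNC χ) :
    IsEvaluation π.1 ((momentFunction 𝒜).family π) where
  empty := BiFun.family_empty _ π
  congr := BiFun.family_congr _ π
  single := fun _ T p b hS hπ =>
    momentFunction_hasShiftRules.isBalanced.family_single π hS hπ T p b
  reduce := by
    intro S hS
    have hSn : S.Nonempty := by
      by_contra h
      rw [Finset.not_nonempty_iff_eq_empty] at h
      exact hS (by simp [h])
    obtain ⟨m, hm⟩ := exists_isTopMin π.1 hSn
    have h : ¬ ∀ c ∈ S, π.1 m c := fun h =>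
      hS fun a ha a' ha' => π.1.trans (π.1.symm (h a ha)) (h a' ha')
    have hVn : (blockOf π.1 S m).Nonempty := ⟨m, mem_blockOf.2 ⟨hm.mem, π.1.refl m⟩⟩
    have hWn : (S \ blockOf π.1 S m).Nonempty := by
      push Not at h
      obtain ⟨c, hc, hmc⟩ := h
      exact ⟨c, Finset.mem_sdiff.2 ⟨hc, fun h => hmc (mem_blockOf.1 h).2⟩⟩
    have hcl : ∀ a ∈ blockOf π.1 S m, π.1 m a := fun a ha => (mem_blockOf.1 ha).2
    -- Needed to identify the coefficient in the recursion, an expectation, with the value of the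
    -- family on this block.
    have hmV : IsTopMin π.1 (blockOf π.1 S m) m := by
      refine ⟨⟨mem_blockOf.2 ⟨hm.mem, π.1.refl m⟩, fun c hc hmc =>
        hm.1.2 c (mem_blockOf.1 hc).1 hmc⟩, ?_⟩
      rintro a ⟨ha, hmin⟩
      exact hmin m (mem_blockOf.2 ⟨hm.mem, π.1.refl m⟩) (π.1.symm (hcl a ha))
    refine ⟨blockOf π.1 S m, pos χ m, hVn, fun hV => ?_, isGap_block π.2 hm,
      isSaturated_block π.1 S m,
      fun a ha a' ha' => π.1.trans (π.1.symm (hcl a ha)) (hcl a' ha'), fun T => ?_⟩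
    · rw [hV, Finset.sdiff_self] at hWn
      exact Finset.not_nonempty_empty hWn
    · rw [BiFun.family_of_nonempty _ π hSn, BiFun.family_of_nonempty _ π hVn, momentFunction_on,
        momentFunction_on, momentAux_single hmV hcl]
      rcases momentAux_reduce hm h T with ⟨θ, hθ, h'⟩ | ⟨γ, hγ, h'⟩
      · left
        rw [insL_of_isPred hθ, BiFun.family_of_nonempty _ π hWn, momentFunction_on, h']
      · right
        rw [insR_of_isSucc hγ, BiFun.family_of_nonempty _ π hWn, momentFunction_on, h']

/-! ### Rules that follow from the evaluation by intervals -/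

theorem isSaturated_univ {V : Finset (Fin n)} : IsSaturated π Finset.univ V ↔ IsUnionOfBlocks π V :=
  ⟨fun h a b hab ha => h a ha b (Finset.mem_univ b) hab, fun h a ha b _ hab => h a b hab ha⟩

theorem eq_sdiff_of_disjoint {V W : Finset (Fin n)} (hd : Disjoint V W)
    (hu : V ∪ W = Finset.univ) : Finset.univ \ V = W := by
  rw [← hu, Finset.union_sdiff_cancel_left hd]

theorem isFactorizing_of_isEvaluation {Φ : BiFun 𝒜}
    (h : ∀ ⦃n : ℕ⦄ (χ : Fin n → Side) (π : BNC χ), IsEvaluation π.1 (Φ.family π)) :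
    IsFactorizing Φ := by
  intro n χ π T V W hV hW hd hu hπ hlt
  have hWV := eq_sdiff_of_disjoint hd hu
  -- With the cut 0 no entry precedes V, so its value comes out as a left factor.
  have key := (h χ π).split Finset.univ V 0 ⟨Finset.subset_univ V, fun s hs hsV v hv =>
    ⟨fun h => absurd h (Nat.not_lt_zero _), fun _ => hlt v hv s (hWV ▸ Finset.mem_sdiff.2 ⟨hs, hsV⟩)⟩⟩
    (isSaturated_univ.2 hπ) T
  rw [hWV, insL_of_forall fun _ _ => Nat.zero_le _, Φ.family_of_nonempty π hV,
    Φ.family_of_nonempty π hW, Φ.family_of_nonempty π (hV.mono (Finset.subset_univ V)),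
    Φ.on_univ] at key
  exact key

/-- Evaluating V first inserts its value after θ; the equality of the two insertions at a cut gives
the form with γ. -/
theorem isNesting_of_isEvaluation {Φ : BiFun 𝒜}
    (h : ∀ ⦃n : ℕ⦄ (χ : Fin n → Side) (π : BNC χ), IsEvaluation π.1 (Φ.family π)) :
    IsNesting Φ := by
  intro n χ π T V W p θ γ hV hd hu hπ hgap hθ hγ
  have key := (h χ π).split Finset.univ V p hgap (isSaturated_univ.2 hπ) T
  have hW : W.Nonempty := ⟨θ, hθ.1⟩
  rw [eq_sdiff_of_disjoint hd hu, Φ.family_of_nonempty π hV,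
    Φ.family_of_nonempty π (hV.mono (Finset.subset_univ V)), Φ.on_univ] at key
  constructor
  · rw [key, insL_of_isPred hθ, Φ.family_of_nonempty π hW]
  · rw [key, (h χ π).insL_eq_insR, insR_of_isSucc hγ, Φ.family_of_nonempty π hW]

theorem momentFunction_isBiMultiplicative (𝒜 : BBSpace B A) :
    IsBiMultiplicative 𝒜 (momentFunction 𝒜) :=
  isBiMultiplicative_of_rules (fun _ _ => momentFunction_linear)
    momentFunction_hasShiftRules.isBalanced
    (isFactorizing_of_isEvaluation fun _ _ => momentFunction_isEvaluation)
    (isNesting_of_isEvaluation fun _ _ => momentFunction_isEvaluation)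

end Space

end BiFree

theorem mainTheorem5 {B A : Type*} [Ring B] [Algebra ℂ B] [Ring A] [Algebra ℂ A]
    (𝒜 : BiFree.BBSpace B A) :
    (∀ (Φ : BiFree.BiFun 𝒜) (f : BiFree.IA),
      BiFree.IsBiMultiplicative 𝒜 Φ → BiFree.IsMultiplicative f →
        BiFree.IsBiMultiplicative 𝒜 (BiFree.convolution Φ f)) ∧
    BiFree.IsBiMultiplicative 𝒜 (BiFree.cumulantFunction 𝒜) :=
  ⟨fun _ _ hΦ hf => hΦ.convolution hf.isFactorizing,
    (BiFree.momentFunction_isBiMultiplicative 𝒜).convolution BiFree.moebius_isFactorizing⟩
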